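/- Let $n,m\in\mathbb N$ with $m\ge 1$, and let $P=(P_j(D))_{j=1}^N$ and $Q=(Q_j(D))_{j=1}^M$ be two systems of linear partial differential operators with constant complex coefficients on $\mathbb R^n$ ($D_k=-i\partial_{x_k}$), each operator of both systems being of order exactly $m$. Assume: (i) $P$ and $Q$ satisfy condition $(\mathscr H)$, where $P$ satisfies $(\mathscr H)$ if there are $C>0$ and $\gamma\ge m$ with $$\sum_{j=1}^N|\partial_\xi^\alpha P_j(\xi)|\le C\Big(1+\sum_{j=1}^N|P_j(\xi)|\Big)^{1-|\alpha|/\gamma}\qquad\forall\alpha\in\mathbb N_0^n,\ \xi\in\mathbb R^n;$$ $\gamma_P\ge m$ denotes the smallest such $\gamma$ (the infimum of all such $\gamma$, which is attained), and $\gamma_Q$ is defined likewise; (ii) $P$ and $Q$ are $1$-equally strong, i.e. for some $C>0$ and all $\xi\in\mathbb R^n$, $\sum_{j}|Q_j(\xi)|\le C(1+\sum_{j}|P_j(\xi)|)$ and $\sum_{j}|P_j(\xi)|\le C(1+\sum_{j}|Q_j(\xi)|)$. Let $\Omega\subseteq\mathbb R^n$ be open, and let $\omega:[0,\infty)\to[0,\infty)$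 be a non-quasianalytic weight function, i.e. continuous, increasing (in the wide sense), with $(\alpha)$ $\omega(2t)\le L(\omega(t)+1)$ for some $L>0$ and all $t\ge0$; $(\beta)$ $\int_1^\infty\omega(t)t^{-2}\,dt<\infty$; $(\gamma)$ $\log t=o(\omega(t))$ as $t\to\infty$; $(\delta)$ $t\mapsto\omega(e^t)$ is convex on $\mathbb R$. For a weight $\sigma$ put $\varphi_\sigma^*(y)=\sup_{t\ge0}\{yt-\sigma(e^t)\}$ for $y\ge 0$, and for $K\subset\Omega$ compact, $\lambda>0$ and $u\in C^\infty(\Omega)$ (complex-valued) put $$p^P_{K,\lambda}(u)=\sup_{\beta\in\mathbb N_0^N}\|P_1(D)^{\beta_1}\cdots P_N(D)^{\beta_N}u\|_{L^2(K)}\,e^{-\lambda\varphi_\sigma^*(|\beta|m/\lambda)}.$$ Let $\mathcal E^P_{(\sigma)}(\Omega)$ (Beurling case) be the set of $u\in C^\infty(\Omega)$ such that $p^P_{K,\lambda}(u)<\infty$ for all compact $K\subset\Omega$ and all $\lambda>0$, and let $\mathcal E^P_{\{\sigma\}}(\Omega)$ (Roumieu case) be the set of $u\in C^\infty(\Omega)$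 such that for every compact $K\subset\Omega$ there is an integer $\ell\ge1$ with $p^P_{K,1/\ell}(u)<\infty$. Define the spaces for $Q$ in the same way. Then $\gamma_P=\gamma_Q$, and for every $s\ge\gamma_P/m=\gamma_Q/m$ and $\omega'(t)=\omega(t^{1/s})$, $$\mathcal E^P_{(\omega')}(\Omega)=\mathcal E^Q_{(\omega')}(\Omega)\qquad\text{and}\qquad \mathcal E^P_{\{\omega'\}}(\Omega)=\mathcal E^Q_{\{\omega'\}}(\Omega).$$ -/

import Mathlib

noncomputable section

namespace IterateSystems

/-- Composition `f₁ ∘ f₂ ∘ ⋯ ∘ f_k` of a finite family of self-maps, where the `j`-th map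
is the `e j`-th iterate of `f j`. -/
def iterComp {k : ℕ} {X : Type*} (f : Fin k → X → X) (e : Fin k → ℕ) : X → X :=
  (List.ofFn fun j => (f j)^[e j]).foldr (fun g h => g ∘ h) id

/-- The operator `D_j = -i ∂_{x_j}`. -/
def D {n : ℕ} (j : Fin n) (u : EuclideanSpace ℝ (Fin n) → ℂ) :
    EuclideanSpace ℝ (Fin n) → ℂ :=
  fun x => -Complex.I * fderiv ℝ u x (EuclideanSpace.single j 1)

/-- The operator `p(D) = ∑_α a_α D^α` with symbol `p(ξ) = ∑_α a_α ξ^α`. -/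
def polyOp {n : ℕ} (p : MvPolynomial (Fin n) ℂ) (u : EuclideanSpace ℝ (Fin n) → ℂ) :
    EuclideanSpace ℝ (Fin n) → ℂ :=
  fun x => ∑ α ∈ p.support, p.coeff α * iterComp D (fun j => α j) u x

/-- The iterate `P^β = P_1(D)^{β_1} ∘ ⋯ ∘ P_N(D)^{β_N}` of the system `P`. -/
def sysIter {n N : ℕ} (P : Fin N → MvPolynomial (Fin n) ℂ) (β : Fin N → ℕ)
    (u : EuclideanSpace ℝ (Fin n) → ℂ) : EuclideanSpace ℝ (Fin n) → ℂ :=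
  iterComp (fun j => polyOp (P j)) β u

/-- The system has order `m`: each of its operators has order `m`. -/
def HasOrder {n N : ℕ} (P : Fin N → MvPolynomial (Fin n) ℂ) (m : ℕ) : Prop :=
  ∀ j, (P j).totalDegree = m

/-- The value `p(ξ)` of a symbol at a real point `ξ`. -/
def symb {n : ℕ} (p : MvPolynomial (Fin n) ℂ) (ξ : EuclideanSpace ℝ (Fin n)) : ℂ :=
  MvPolynomial.eval (fun i => (ξ i : ℂ)) p

/-- The derivative `p^{(α)} = ∂_ξ^α p` of a symbol. -/
def symbDeriv {n : ℕ} (α : Fin n → ℕ) (p : MvPolynomial (Fin n) ℂ) :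
    MvPolynomial (Fin n) ℂ :=
  iterComp (fun i q => MvPolynomial.pderiv i q) α p

/-- The inequality of condition `(ℋ)` with exponent parameter `γ`. -/
def CondHWith {n N : ℕ} (P : Fin N → MvPolynomial (Fin n) ℂ) (γ : ℝ) : Prop :=
  ∃ C : ℝ, 0 < C ∧ ∀ (α : Fin n → ℕ) (ξ : EuclideanSpace ℝ (Fin n)),
    ∑ j, ‖symb (symbDeriv α (P j)) ξ‖
      ≤ C * (1 + ∑ j, ‖symb (P j) ξ‖) ^ (1 - ((∑ i, α i : ℕ) : ℝ) / γ)

/-- Condition `(ℋ)` for a system of order `m`. -/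
def CondH {n N : ℕ} (P : Fin N → MvPolynomial (Fin n) ℂ) (m : ℕ) : Prop :=
  ∃ γ : ℝ, (m : ℝ) ≤ γ ∧ CondHWith P γ

/-- The number `γ_P` of a system of order `m` satisfying `(ℋ)`: the smallest `γ ≥ m` for which
the inequality of `(ℋ)` holds. -/
def gammaOf {n N : ℕ} (P : Fin N → MvPolynomial (Fin n) ℂ) (m : ℕ) : ℝ :=
  sInf {γ : ℝ | (m : ℝ) ≤ γ ∧ CondHWith P γ}

/-- `Q` is `h`-weaker than `P`, written `Q ≺_h P`. -/
def HWeaker {n M N : ℕ} (h : ℝ) (Q : Fin M → MvPolynomial (Fin n) ℂ)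
    (P : Fin N → MvPolynomial (Fin n) ℂ) : Prop :=
  ∃ C : ℝ, 0 < C ∧ ∀ ξ : EuclideanSpace ℝ (Fin n),
    ∑ j, ‖symb (Q j) ξ‖ ≤ C * (1 + ∑ j, ‖symb (P j) ξ‖) ^ h

/-- `P` and `Q` are `h`-equally strong. -/
def EquallyStrong {n N M : ℕ} (h : ℝ) (P : Fin N → MvPolynomial (Fin n) ℂ)
    (Q : Fin M → MvPolynomial (Fin n) ℂ) : Prop :=
  HWeaker h P Q ∧ HWeaker h Q P

/-- Non-quasianalytic weight functions `ω : [0,∞) → [0,∞)`; only the values of `ω` on `[0,∞)`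
are used. -/
structure IsNQWeight (ω : ℝ → ℝ) : Prop where
  nonneg : ∀ t, 0 ≤ t → 0 ≤ ω t
  continuousOn : ContinuousOn ω (Set.Ici 0)
  monotoneOn : MonotoneOn ω (Set.Ici 0)
  alpha : ∃ L : ℝ, 0 < L ∧ ∀ t, 0 ≤ t → ω (2 * t) ≤ L * (ω t + 1)
  beta : MeasureTheory.IntegrableOn (fun t => ω t / t ^ 2) (Set.Ioi 1)
  gamma : Asymptotics.IsLittleO Filter.atTop Real.log ω
  delta : ConvexOn ℝ Set.univ (fun t => ω (Real.exp t))

/-- The Young conjugate `φ_ω^*(y) = sup_{t ≥ 0} (y t - φ_ω(t))` of `φ_ω(t) = ω(e^t)`. -/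
def youngConj (ω : ℝ → ℝ) (y : ℝ) : ℝ :=
  ⨆ t : Set.Ici (0 : ℝ), (y * (t : ℝ) - ω (Real.exp t))

/-- The semi-norm `p^P_{K,μ}(u) = sup_β ‖P^β u‖_{L²(K)} exp(-μ φ_ω^*(|β| m / μ))`, with values
in `[0,∞]`, for a system of order `m`. -/
def seminormP {n N : ℕ} (P : Fin N → MvPolynomial (Fin n) ℂ) (m : ℕ) (ω : ℝ → ℝ)
    (K : Set (EuclideanSpace ℝ (Fin n))) (μ : ℝ) (u : EuclideanSpace ℝ (Fin n) → ℂ) : ENNReal :=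
  ⨆ β : Fin N → ℕ,
    MeasureTheory.eLpNorm (sysIter P β u) 2 (MeasureTheory.volume.restrict K) *
      ENNReal.ofReal (Real.exp (-(μ * youngConj ω (((∑ j, β j : ℕ) : ℝ) * m / μ))))

/-- The Beurling space `ℰ^P_{(ω)}(Ω)` for a system of order `m`. Functions on the open set `Ω` are
represented by functions on the whole space, whose values off `Ω` play no role. -/
def beurling {n N : ℕ} (P : Fin N → MvPolynomial (Fin n) ℂ) (m : ℕ) (ω : ℝ → ℝ)
    (Ω : Set (EuclideanSpace ℝ (Fin n))) : Set (EuclideanSpace ℝ (Fin n) → ℂ) :=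
  {u | ContDiffOn ℝ ((⊤ : ℕ∞) : WithTop ℕ∞) u Ω ∧
    ∀ K : Set (EuclideanSpace ℝ (Fin n)), IsCompact K → K ⊆ Ω →
      ∀ μ : ℝ, 0 < μ → seminormP P m ω K μ u < ⊤}

/-- The Roumieu space `ℰ^P_{\{ω\}}(Ω)` for a system of order `m`. -/
def roumieu {n N : ℕ} (P : Fin N → MvPolynomial (Fin n) ℂ) (m : ℕ) (ω : ℝ → ℝ)
    (Ω : Set (EuclideanSpace ℝ (Fin n))) : Set (EuclideanSpace ℝ (Fin n) → ℂ) :=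
  {u | ContDiffOn ℝ ((⊤ : ℕ∞) : WithTop ℕ∞) u Ω ∧
    ∀ K : Set (EuclideanSpace ℝ (Fin n)), IsCompact K → K ⊆ Ω →
      ∃ l : ℕ, 0 < l ∧ seminormP P m ω K (1 / (l : ℝ)) u < ⊤}

end IterateSystems

end

/-! Condition `(ℋ)` with exponent `γ` says that the size `|P| = 1 + ∑ j, ‖P j‖` of the symbols
varies slowly on balls of radius `|P| ^ (1 / γ)`. By interpolation on such balls it passes to every
equally strong system, whence `γ_P = γ_Q`.

The infimum `γ_P` is attained because the supremum of one real polynomial on a level set of another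
is algebraic in the level (its points are critical, and the algebraic Sard theorem applies). The
Newton polygon gives algebraic functions only finitely many exponents of growth, so a polynomial
growth bound with exponent `θ + ε` for all `ε > 0` holds with exponent `θ`.

Fourier transformation and cutoff functions turn `(ℋ)` and equal strength into the local estimate
`‖Q i (D) u‖ ≤ C * (∑ j, ‖P j (D) u‖ + t ^ (-γ) * ‖u‖)`, where the norm on the left is over `K` and
those on the right are over its `t`-neighbourhood. Applying it `k` times with `t = δ / k` bounds the
iterates of order `k` for `Q` by those of order `l ≤ k` for `P`, with factors
`C ^ k * k ^ (γ * (k - l))`. The Young conjugate absorbs them because `σ t = o(t ^ (m / γ))` for the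
weight `σ t = ω (t ^ (1 / s))`: this is the role of `s ≥ γ / m`. -/

noncomputable section

namespace IterateSystems

open Filter Topology Asymptotics MeasureTheory Metric

section AlgebraicSard

open scoped IntermediateField.algebraAdjoinAdjoin
open MvPolynomial

theorem exists_derivation_algebraMap_eq {R S T : Type*} [CommRing R] [CommRing S] [CommRing T]
    [Algebra R S] [Algebra R T] [Algebra S T] [IsScalarTower R S T] [Algebra.FormallyEtale S T]
    (d : Derivation R S S) :
    ∃ d' : Derivation R T T, ∀ s, d' (algebraMap S T s) = algebraMap S T (d s) := by
  have hbc := KaehlerDifferential.isBaseChange_of_formallyEtale R S T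
  let f := ((Algebra.linearMap S T).compDer d).liftKaehlerDifferential
  refine ⟨(hbc.lift f).compDer (KaehlerDifferential.D R T), fun s => ?_⟩
  change hbc.lift f (KaehlerDifferential.D R T (algebraMap S T s)) = _
  rw [← KaehlerDifferential.map_D R R S T, hbc.lift_eq, Derivation.liftKaehlerDifferential_comp_D]
  rfl

theorem derivation_aeval {R A M σ : Type*} [CommRing R] [CommRing A] [Algebra R A]
    [AddCommGroup M] [Module R M] [Module A M] [Fintype σ] (d : Derivation R A M) (ξ : σ → A)
    (p : MvPolynomial σ R) :
    d (aeval ξ p) = ∑ l, aeval ξ (pderiv l p) • d (ξ l) := by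
  classical
  induction p using MvPolynomial.induction_on with
  | C a => simp
  | add p q hp hq => simp only [map_add, hp, hq, add_smul, Finset.sum_add_distrib]
  | mul_X p i hp =>
    simp only [map_mul, aeval_X, Derivation.leibniz, hp, Finset.smul_sum, pderiv_X, smul_eq_mul,
      map_add, add_smul, Finset.sum_add_distrib, mul_smul]
    congr 1
    simp [Pi.single_apply]

variable {K L σ ι : Type*} [Field K]

theorem exists_ne_zero_aeval_mem {A : Type*} [CommRing A] [Algebra K A] (I : Ideal A) (y : ι → A)
    (h : ∀ p : Ideal A, p.IsPrime → I ≤ p →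
      ¬ AlgebraicIndependent K (fun i => Ideal.Quotient.mk p (y i))) :
    ∃ H : MvPolynomial ι K, H ≠ 0 ∧ aeval y H ∈ I := by
  by_contra! hI
  let T := (nonZeroDivisors (MvPolynomial ι K)).map (aeval y : MvPolynomial ι K →ₐ[K] A)
  have hdisj : Disjoint (I : Set A) T := by
    rw [Set.disjoint_left]
    rintro _ haI ⟨H, hH, rfl⟩
    exact hI H (nonZeroDivisors.ne_zero hH) haI
  obtain ⟨p, hp, hIp, hpT⟩ := I.exists_le_prime_disjoint T hdisj
  refine h p hp hIp (algebraicIndependent_iff.2 fun H hH => ?_)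
  by_contra hne
  refine Set.disjoint_left.1 hpT (Ideal.Quotient.eq_zero_iff_mem.1 ?_)
    ⟨H, mem_nonZeroDivisors_of_ne_zero hne, rfl⟩
  exact (comp_aeval_apply y (Ideal.Quotient.mkₐ K p) H).trans hH

/-- The ideal of the critical scheme of the polynomial map `F`, in the chart `c i₀ = 1`: its points
are the pairs `(x, c)` such that `∑ i, c i • dF i` vanishes at `x`. -/
def criticalIdeal [Fintype ι] (F : ι → MvPolynomial σ K) (i₀ : ι) :
    Ideal (MvPolynomial (σ ⊕ ι) K) :=
  Ideal.span (insert (X (Sum.inr i₀) - 1)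
    (Set.range fun l => ∑ i, X (Sum.inr i) * rename Sum.inl (pderiv l (F i))))

theorem algHom_rename_inl {τ B : Type*} [CommRing B] [Algebra K B]
    (φ : MvPolynomial (σ ⊕ τ) K →ₐ[K] B) (q : MvPolynomial σ K) :
    φ (rename Sum.inl q) = aeval (fun k => φ (X (Sum.inl k))) q := by
  have h : φ.comp (rename Sum.inl) = aeval (fun k => φ (X (Sum.inl k))) := by
    ext
    simp
  exact DFunLike.congr_fun h q

theorem criticalIdeal_le_ker_iff [Fintype ι] {B : Type*} [CommRing B] [Algebra K B]
    (F : ι → MvPolynomial σ K) (i₀ : ι) (φ : MvPolynomial (σ ⊕ ι) K →ₐ[K] B) :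
    criticalIdeal F i₀ ≤ RingHom.ker φ ↔ φ (X (Sum.inr i₀)) = 1 ∧
      ∀ l, ∑ i, φ (X (Sum.inr i)) * aeval (fun k => φ (X (Sum.inl k))) (pderiv l (F i)) = 0 := by
  simp only [criticalIdeal, Ideal.span_le, Set.insert_subset_iff, Set.range_subset_iff,
    SetLike.mem_coe, RingHom.mem_ker, map_sub, map_one, sub_eq_zero, map_sum, map_mul,
    algHom_rename_inl]

variable [Field L] [Algebra K L]

theorem formallyEtale_adjoin_of_isTranscendenceBasis [CharZero K] {v : ι → L}
    (hv : IsTranscendenceBasis K v) :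
    Algebra.FormallyEtale (Algebra.adjoin K (Set.range v)) L := by
  have : Algebra.IsAlgebraic (IntermediateField.adjoin K (Set.range v)) L := hv.isAlgebraic_field
  have : Algebra.FormallyEtale (IntermediateField.adjoin K (Set.range v)) L :=
    .of_isSeparable _ L
  have : Algebra.FormallyEtale (Algebra.adjoin K (Set.range v))
      (IntermediateField.adjoin K (Set.range v)) := .of_isLocalization (nonZeroDivisors _)
  exact .comp _ (IntermediateField.adjoin K (Set.range v)) _

theorem exists_derivation_adjoin_eq_single [DecidableEq ι] {v : ι → L}
    (hv : AlgebraicIndependent K v) (i : ι) :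
    ∃ d : Derivation K (Algebra.adjoin K (Set.range v)) (Algebra.adjoin K (Set.range v)),
      ∀ j, (d ⟨v j, Algebra.subset_adjoin ⟨j, rfl⟩⟩ : L) = if j = i then 1 else 0 := by
  let e : MvPolynomial ι K ≃ₐ[K] Algebra.adjoin K (Set.range v) := hv.aevalEquiv
  have he (j : ι) : e.symm ⟨v j, Algebra.subset_adjoin ⟨j, rfl⟩⟩ = X j := by
    rw [AlgEquiv.symm_apply_eq]
    ext
    simp [e]
  refine ⟨Derivation.mk' (e.toLinearMap ∘ₗ (pderiv i).toLinearMap ∘ₗ e.symm.toLinearMap) ?_,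
    fun j => ?_⟩
  · intro a b
    simp
  · change (e (pderiv i (e.symm _)) : L) = _
    rw [he, pderiv_X, Pi.single_apply, eq_comm]
    split_ifs <;> simp_all

theorem exists_derivation_eq_single [CharZero K] [DecidableEq ι] {y : ι → L}
    (hy : AlgebraicIndependent K y) (i : ι) :
    ∃ d : Derivation K L L, ∀ j, d (y j) = if j = i then 1 else 0 := by
  classical
  obtain ⟨s, hys, hs⟩ := exists_isTranscendenceBasis_superset hy.coe_range
  have hmem (j : ι) : y j ∈ s := hys ⟨j, rfl⟩
  have := formallyEtale_adjoin_of_isTranscendenceBasis hs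
  obtain ⟨d, hd⟩ := exists_derivation_adjoin_eq_single hs.1 ⟨y i, hmem i⟩
  obtain ⟨d', hd'⟩ := exists_derivation_algebraMap_eq (T := L) d
  refine ⟨d', fun j => (hd' ⟨y j, Algebra.subset_adjoin ⟨⟨y j, hmem j⟩, rfl⟩⟩).trans ?_⟩
  exact (hd ⟨y j, hmem j⟩).trans (by simp only [Subtype.mk.injEq, hy.injective.eq_iff])

variable [CharZero K] [Finite σ] [Fintype ι]

theorem not_algebraicIndependent_of_critical (F : ι → MvPolynomial σ K) (ξ : σ → L) {c : ι → L}
    (hc : c ≠ 0) (hcrit : ∀ l, ∑ i, c i * aeval ξ (pderiv l (F i)) = 0) :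
    ¬ AlgebraicIndependent K (fun i => aeval ξ (F i)) := by
  classical
  cases nonempty_fintype σ
  intro hy
  obtain ⟨i₀, hi₀⟩ := Function.ne_iff.1 hc
  obtain ⟨d, hd⟩ := exists_derivation_eq_single hy i₀
  refine hi₀ ?_
  calc c i₀ = ∑ i, c i * d (aeval ξ (F i)) := by simp [hd]
    _ = ∑ l, (∑ i, c i * aeval ξ (pderiv l (F i))) * d (ξ l) := by
        simp only [derivation_aeval, Finset.mul_sum, Finset.sum_mul, smul_eq_mul, mul_assoc]
        exact Finset.sum_comm
    _ = 0 := by simp [hcrit]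

theorem exists_ne_zero_aeval_mem_criticalIdeal (F : ι → MvPolynomial σ K) (i₀ : ι) :
    ∃ H : MvPolynomial ι K, H ≠ 0 ∧
      aeval (fun i => (rename Sum.inl (F i) : MvPolynomial (σ ⊕ ι) K)) H ∈ criticalIdeal F i₀ := by
  refine exists_ne_zero_aeval_mem _ _ fun p _ hp hind => ?_
  let κ := FractionRing (MvPolynomial (σ ⊕ ι) K ⧸ p)
  let j : (MvPolynomial (σ ⊕ ι) K ⧸ p) →ₐ[K] κ := IsScalarTower.toAlgHom K _ κ
  have hj : Function.Injective j := IsFractionRing.injective _ κ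
  let φ : MvPolynomial (σ ⊕ ι) K →ₐ[K] κ := j.comp (Ideal.Quotient.mkₐ K p)
  have hker : criticalIdeal F i₀ ≤ RingHom.ker φ := fun a ha => by
    change j (Ideal.Quotient.mk p a) = 0
    rw [Ideal.Quotient.eq_zero_iff_mem.2 (hp ha), map_zero]
  obtain ⟨h1, hcrit⟩ := (criticalIdeal_le_ker_iff F i₀ φ).1 hker
  refine not_algebraicIndependent_of_critical F _ (c := fun i => φ (X (Sum.inr i)))
    (fun h0 => one_ne_zero (h1.symm.trans (congrFun h0 i₀))) hcrit ?_
  simp only [← algHom_rename_inl]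
  have hφ : (fun i => φ (rename Sum.inl (F i))) =
      j ∘ fun i => Ideal.Quotient.mk p (rename Sum.inl (F i)) := rfl
  exact hφ ▸ hind.map' hj

/-- The algebraic Sard theorem. As `K` need not be algebraically closed, the polynomial is found at
the generic points of the critical scheme. -/
theorem exists_ne_zero_eval_eq_zero_of_critical (F : ι → MvPolynomial σ K) :
    ∃ H : MvPolynomial ι K, H ≠ 0 ∧ ∀ (x : σ → K) (c : ι → K), c ≠ 0 →
      (∀ l, ∑ i, c i * eval x (pderiv l (F i)) = 0) → eval (fun i => eval x (F i)) H = 0 := by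
  choose H hH0 hH using exists_ne_zero_aeval_mem_criticalIdeal F
  refine ⟨∏ i, H i, Finset.prod_ne_zero_iff.2 fun i _ => hH0 i, fun x c hc hcrit => ?_⟩
  obtain ⟨i, hi⟩ := Function.ne_iff.1 hc
  let φ : MvPolynomial (σ ⊕ ι) K →ₐ[K] K := aeval (Sum.elim x fun k => (c i)⁻¹ * c k)
  have hker : criticalIdeal F i ≤ RingHom.ker φ := by
    refine (criticalIdeal_le_ker_iff F i φ).2 ⟨by simpa [φ] using inv_mul_cancel₀ hi, fun l => ?_⟩
    simp only [φ, aeval_X, Sum.elim_inl, Sum.elim_inr, mul_assoc, ← Finset.mul_sum]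
    exact mul_eq_zero_of_right _ (hcrit l)
  have hφ : φ (aeval (fun i => rename Sum.inl (F i)) (H i)) =
      eval (fun i => eval x (F i)) (H i) := by
    simp only [comp_aeval_apply, algHom_rename_inl, φ, aeval_X, Sum.elim_inl]
    rfl
  rw [map_prod]
  exact Finset.prod_eq_zero (Finset.mem_univ i) (hφ.symm.trans (hker (hH i)))

end AlgebraicSard

section Extremum

open MvPolynomial

variable {σ ι : Type*}

theorem hasStrictFDerivAt_eval {𝕜 : Type*} [NontriviallyNormedField 𝕜] [Fintype σ]
    (p : MvPolynomial σ 𝕜) (x : σ → 𝕜) :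
    HasStrictFDerivAt (fun z => eval z p)
      (∑ l, eval x (pderiv l p) • (ContinuousLinearMap.proj l : (σ → 𝕜) →L[𝕜] 𝕜)) x := by
  classical
  induction p using MvPolynomial.induction_on with
  | C a =>
    simp only [eval_C]
    refine (hasStrictFDerivAt_const a x).congr_fderiv ?_
    ext v
    simp
  | add p q hp hq =>
    simp only [map_add]
    refine (hp.add hq).congr_fderiv ?_
    ext v
    simp [add_mul, Finset.sum_add_distrib]
  | mul_X p i hp =>
    have hX := (ContinuousLinearMap.proj i : (σ → 𝕜) →L[𝕜] 𝕜).hasStrictFDerivAt (x := x)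
    simp only [map_mul, eval_X]
    refine (hp.mul hX).congr_fderiv ?_
    ext v
    simp [pderiv_X, Pi.single_apply, add_mul, Finset.sum_add_distrib, Finset.mul_sum, mul_assoc,
      apply_ite (eval x)]

/-- Lagrange multipliers make a constrained maximum a critical point, so Sard's theorem applies. -/
theorem exists_ne_zero_eval_eq_zero_of_isMaxOn [Finite σ] [Finite ι] (F : ι → MvPolynomial σ ℝ)
    (i₀ : ι) :
    ∃ H : MvPolynomial ι ℝ, H ≠ 0 ∧ ∀ x : σ → ℝ,
      IsMaxOn (fun z => eval z (F i₀)) {z | ∀ i, i ≠ i₀ → eval z (F i) = eval x (F i)} x →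
        eval (fun i => eval x (F i)) H = 0 := by
  classical
  cases nonempty_fintype σ
  cases nonempty_fintype ι
  obtain ⟨H, hH0, hH⟩ := exists_ne_zero_eval_eq_zero_of_critical F
  refine ⟨H, hH0, fun x hx => ?_⟩
  have hext : IsLocalExtrOn (fun z => eval z (F i₀))
      {z | ∀ i : {i // i ≠ i₀}, eval z (F i) = eval x (F i)} x := by
    refine Or.inr (IsMaxOn.localize ?_)
    simpa only [Subtype.forall] using hx
  obtain ⟨Λ, Λ₀, hΛ, hsum⟩ := IsLocalExtrOn.exists_multipliers_of_hasStrictFDerivAt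
    (f := fun (i : {i // i ≠ i₀}) z => eval z (F i)) hext
    (fun i => hasStrictFDerivAt_eval (F i) x) (hasStrictFDerivAt_eval (F i₀) x)
  refine hH x (fun i => if h : i = i₀ then Λ₀ else Λ ⟨i, h⟩) (fun h0 => hΛ ?_) fun l => ?_
  · refine Prod.ext (funext fun i => ?_) ?_
    · simpa [i.2] using congrFun h0 i
    · simpa using congrFun h0 i₀
  · have hl := congrArg (fun T => T (Pi.single l 1)) hsum
    simp only [_root_.add_apply, _root_.sum_apply, _root_.smul_apply,
      ContinuousLinearMap.proj_apply, Pi.single_apply, smul_eq_mul, mul_ite, mul_one, mul_zero,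
      Finset.sum_ite_eq', Finset.mem_univ, if_true, _root_.zero_apply] at hl
    rw [← hl, Fintype.sum_eq_add_sum_subtype_ne _ i₀, add_comm]
    simp only [dite_true]
    congr 1
    exact Finset.sum_congr rfl fun i _ => by rw [dif_neg i.2]

end Extremum

section NewtonPolygon

open Polynomial

theorem exists_eventually_abs_log_eval_sub_le {p : ℝ[X]} (hp : p ≠ 0) :
    ∃ K : ℝ, ∀ᶠ r in atTop,
      p.eval r ≠ 0 ∧ |Real.log |p.eval r| - p.natDegree * Real.log r| ≤ K := by
  have hlim : Tendsto (fun r => p.eval r / r ^ p.natDegree) atTop (𝓝 p.leadingCoeff) := by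
    simpa using p.div_tendsto_atTop_leadingCoeff_div_of_degree_eq (X ^ p.natDegree)
      (by rw [degree_X_pow, degree_eq_natDegree hp])
  have hlc : p.leadingCoeff ≠ 0 := leadingCoeff_ne_zero.2 hp
  have hlog := (hlim.log hlc).abs
  refine ⟨|Real.log p.leadingCoeff| + 1, ?_⟩
  filter_upwards [hlog.eventually_le_const (lt_add_one _), hlim.eventually_ne hlc,
    eventually_gt_atTop 0] with r hr hne hr0
  have hp0 : p.eval r ≠ 0 := fun h => hne (by rw [h, zero_div])
  rw [Real.log_div hp0 (pow_pos hr0 _).ne', Real.log_pow] at hr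
  exact ⟨hp0, by rwa [Real.log_abs]⟩

theorem exists_abs_le_card_mul_of_sum_eq_zero {ι : Type*} {s : Finset ι} {f : ι → ℝ}
    (hs : s.Nonempty) (hf : ∀ i ∈ s, f i ≠ 0) (hsum : ∑ i ∈ s, f i = 0) :
    ∃ i ∈ s, ∃ j ∈ s, i ≠ j ∧ |f i| ≤ |f j| ∧ |f j| ≤ s.card * |f i| := by
  classical
  obtain ⟨j, hj, hmax⟩ := s.exists_max_image (fun i => |f i|) hs
  have hfj : |f j| ≤ ∑ i ∈ s.erase j, |f i| := by
    rw [← Finset.add_sum_erase s f hj, add_eq_zero_iff_eq_neg] at hsum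
    rw [hsum, abs_neg]
    exact Finset.abs_sum_le_sum_abs _ _
  have hne : (s.erase j).Nonempty := by
    refine Finset.nonempty_of_sum_ne_zero (f := fun i => |f i|) ?_
    exact ((abs_pos.2 (hf j hj)).trans_le hfj).ne'
  obtain ⟨i, hi, hi_max⟩ := (s.erase j).exists_max_image (fun i => |f i|) hne
  obtain ⟨hij, his⟩ := Finset.mem_erase.1 hi
  refine ⟨i, his, j, hj, hij, hmax i his, hfj.trans ?_⟩
  calc ∑ k ∈ s.erase j, |f k| ≤ (s.erase j).card • |f i| := Finset.sum_le_card_nsmul _ _ _ hi_max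
    _ = (s.erase j).card * |f i| := nsmul_eq_mul _ _
    _ ≤ s.card * |f i| := by gcongr; exact Finset.erase_subset j s

theorem abs_log_sub_slope_mul_le {a a' r y K c : ℝ} {d d' i j : ℕ} (hij : i ≠ j) (hy : 0 < y)
    (ha : a ≠ 0) (ha' : a' ≠ 0) (hc : 1 ≤ c) (hK : |Real.log |a| - d * Real.log r| ≤ K)
    (hK' : |Real.log |a'| - d' * Real.log r| ≤ K) (hle : |a * y ^ i| ≤ |a' * y ^ j|)
    (hge : |a' * y ^ j| ≤ c * |a * y ^ i|) :
    |Real.log y - ((d : ℝ) - d') / ((j : ℝ) - i) * Real.log r| ≤ 2 * K + Real.log c := by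
  have hlog {b : ℝ} (hb : b ≠ 0) (k : ℕ) :
      Real.log |b * y ^ k| = Real.log |b| + k * Real.log y := by
    rw [abs_mul, Real.log_mul (abs_ne_zero.2 hb) (by positivity), Real.log_abs (y ^ k),
      Real.log_pow]
  have hpos {b : ℝ} (hb : b ≠ 0) (k : ℕ) : 0 < |b * y ^ k| := by positivity
  have h1 := Real.log_le_log (hpos ha i) hle
  have h2 := Real.log_le_log (hpos ha' j) hge
  rw [Real.log_mul (by positivity) (hpos ha i).ne'] at h2
  rw [hlog ha, hlog ha'] at h1 h2
  have hlogc := Real.log_nonneg hc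
  have hmain : |((j : ℝ) - i) * Real.log y - ((d : ℝ) - d') * Real.log r| ≤
      2 * K + Real.log c := by
    rw [abs_le] at hK hK' ⊢
    constructor <;> linarith
  have hji : 1 ≤ |(j : ℝ) - i| := by
    exact_mod_cast Int.one_le_abs (sub_ne_zero.2 (Nat.cast_injective.ne hij.symm : (j : ℤ) ≠ i))
  have hji0 : (j : ℝ) - i ≠ 0 := abs_pos.1 (one_pos.trans_le hji)
  calc _ = |((j : ℝ) - i) * Real.log y - ((d : ℝ) - d') * Real.log r| / |(j : ℝ) - i| := by
        rw [← abs_div]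
        congr 1
        field_simp
    _ ≤ _ := (div_le_self (abs_nonneg _) hji).trans hmain

/-- Newton polygon: as `r → ∞`, the positive roots `y` of `A(r, ·)` are comparable to `r ^ b` for
finitely many exponents `b`. -/
theorem exists_slopes_of_root {A : ℝ[X][X]} (hA : A ≠ 0) :
    ∃ (B : Finset ℝ) (K : ℝ), ∀ᶠ r in atTop, ∀ y, 0 < y → A.evalEval r y = 0 →
      ∃ b ∈ B, |Real.log y - b * Real.log r| ≤ K := by
  classical
  let S := A.support
  let d (j : ℕ) : ℕ := (A.coeff j).natDegree
  have hS : S.Nonempty := nonempty_support_iff.2 hA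
  have hcoeff : ∃ K : ℝ, ∀ᶠ r in atTop, ∀ j ∈ S,
      (A.coeff j).eval r ≠ 0 ∧ |Real.log |(A.coeff j).eval r| - d j * Real.log r| ≤ K := by
    choose! K hK using fun j (hj : j ∈ S) =>
      exists_eventually_abs_log_eval_sub_le (mem_support_iff.1 hj)
    refine ⟨∑ j ∈ S, |K j|, (Filter.eventually_all_finset S).2 fun j hj => ?_⟩
    filter_upwards [hK j hj] with r hr
    exact ⟨hr.1, hr.2.trans ((le_abs_self _).trans
      (Finset.single_le_sum (f := fun j => |K j|) (fun _ _ => abs_nonneg _) hj))⟩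
  obtain ⟨K, hK⟩ := hcoeff
  refine ⟨(S ×ˢ S).image fun p => ((d p.1 : ℝ) - d p.2) / ((p.2 : ℝ) - p.1),
    2 * K + Real.log S.card, ?_⟩
  filter_upwards [hK] with r hr y hy hroot
  have hsum : ∑ j ∈ S, (A.coeff j).eval r * y ^ j = 0 := by
    have hA : eval (C y) A = ∑ j ∈ S, A.coeff j * C y ^ j := eval_eq_sum
    rw [← hroot, evalEval, hA]
    simp only [eval_finsetSum, eval_mul, eval_pow, eval_C]
  obtain ⟨i, hi, j, hj, hij, hle, hge⟩ := exists_abs_le_card_mul_of_sum_eq_zero hS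
    (fun j hj => mul_ne_zero (hr j hj).1 (pow_pos hy j).ne') hsum
  refine ⟨_, Finset.mem_image_of_mem _ (Finset.mk_mem_product hi hj), ?_⟩
  exact abs_log_sub_slope_mul_le hij hy (hr i hi).1 (hr j hj).1
    (by exact_mod_cast Finset.card_pos.2 hS) (hr i hi).2 (hr j hj).2 hle hge

theorem exists_pos_forall_add_le (B : Finset ℝ) (θ : ℝ) :
    ∃ ε > 0, ∀ b ∈ B, θ < b → θ + ε ≤ b := by
  have h : ∀ᶠ ε in 𝓝[>] (0 : ℝ), ∀ b ∈ B, θ < b → θ + ε ≤ b := by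
    refine (Filter.eventually_all_finset B).2 fun b _ => eventually_imp_distrib_left.2 fun hb => ?_
    filter_upwards [Ioc_mem_nhdsGT (sub_pos.2 hb)] with ε hε
    linarith [hε.2]
  exact (eventually_mem_nhdsWithin.and h).exists

theorem le_exp_mul_rpow_of_abs_log_sub_le {r y b K θ : ℝ} (hr : 1 ≤ r) (hy : 0 < y)
    (hK : |Real.log y - b * Real.log r| ≤ K) (hb : b ≤ θ) : y ≤ Real.exp K * r ^ θ := by
  have hlog : b * Real.log r ≤ θ * Real.log r :=
    mul_le_mul_of_nonneg_right hb (Real.log_nonneg hr)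
  rw [Real.rpow_def_of_pos (by linarith), ← Real.exp_add, ← Real.log_le_iff_le_exp hy]
  linarith [(abs_le.1 hK).2]

theorem le_exp_of_abs_log_sub_le {r y b C K θ ε : ℝ} (hr : 1 ≤ r) (hy : 0 < y) (hC : 0 < C)
    (hε : 0 < ε) (hK : |Real.log y - b * Real.log r| ≤ K) (hyr : y ≤ C * r ^ (θ + ε))
    (hb : θ + 2 * ε ≤ b) : r ≤ Real.exp ((K + Real.log C) / ε) := by
  have hr0 : 0 < r := by linarith
  have h := Real.log_le_log hy hyr
  rw [Real.log_mul hC.ne' (Real.rpow_pos_of_pos hr0 _).ne', Real.log_rpow hr0] at h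
  have hlog := mul_le_mul_of_nonneg_right hb (Real.log_nonneg hr)
  rw [← Real.log_le_iff_le_exp hr0, le_div_iff₀ hε]
  linarith [(abs_le.1 hK).1]

/-- The exponents of the Newton polygon being finite in number, a root that grows more slowly than
`r ^ (θ + ε)` for all `ε > 0` cannot have an exponent beyond `θ`. -/
theorem exists_bound_of_root {X : Type*} {A : ℝ[X][X]} (hA : A ≠ 0) {r y : X → ℝ}
    (hr : ∀ x, 1 ≤ r x) (hroot : ∀ x, A.evalEval (r x) (y x) = 0) {θ : ℝ}
    (hε : ∀ ε > 0, ∃ C : ℝ, ∀ x, y x ≤ C * r x ^ (θ + ε)) :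
    ∃ C > 0, ∀ x, y x ≤ C * r x ^ θ := by
  obtain ⟨B, K, hB⟩ := exists_slopes_of_root hA
  obtain ⟨r₀, hB⟩ := eventually_atTop.1 hB
  obtain ⟨ε, hεpos, hgap⟩ := exists_pos_forall_add_le B θ
  obtain ⟨C₀, hC₀⟩ := hε (ε / 2) (half_pos hεpos)
  let C := max C₀ 1
  let R := max r₀ (Real.exp ((K + Real.log C) / (ε / 2)))
  have hC : 0 < C := one_pos.trans_le (le_max_right _ _)
  have : 0 < R := (Real.exp_pos _).trans_le (le_max_right _ _)
  refine ⟨max (C * R ^ (ε / 2)) (Real.exp K), lt_max_of_lt_right (Real.exp_pos _), fun x => ?_⟩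
  have hr0 : 0 < r x := one_pos.trans_le (hr x)
  have : 0 < r x ^ θ := Real.rpow_pos_of_pos hr0 θ
  have hyC : y x ≤ C * r x ^ (θ + ε / 2) := (hC₀ x).trans (by gcongr; exact le_max_left _ _)
  rcases le_or_gt (y x) 0 with hy | hy
  · exact hy.trans (by positivity)
  rcases le_or_gt (r x) R with hrR | hrR
  · calc y x ≤ C * (r x ^ θ * r x ^ (ε / 2)) := by rwa [← Real.rpow_add hr0]
      _ ≤ C * (r x ^ θ * R ^ (ε / 2)) := by gcongr
      _ = C * R ^ (ε / 2) * r x ^ θ := by ring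
      _ ≤ _ := by gcongr; exact le_max_left _ _
  · obtain ⟨b, hb, hbK⟩ := hB (r x) ((le_max_left _ _).trans hrR.le) (y x) hy (hroot x)
    have hbθ : b ≤ θ := by
      by_contra! hlt
      have hle := le_exp_of_abs_log_sub_le (hr x) hy hC (half_pos hεpos) hbK hyC
        (by linarith [hgap b hb hlt])
      exact (hle.trans (le_max_right _ _)).not_gt hrR
    exact (le_exp_mul_rpow_of_abs_log_sub_le (hr x) hy hbK hbθ).trans
      (by gcongr; exact le_max_right _ _)

end NewtonPolygon

section LevelSup

open MvPolynomial

theorem eval_leadingCoeff_eq_zero_of_tendsto {n : ℕ} (H : MvPolynomial (Fin (n + 1)) ℝ)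
    {ρ : ℕ → ℝ} {z : ℕ → Fin n → ℝ} {z₀ : Fin n → ℝ} (hρ : Tendsto ρ atTop atTop)
    (hz : Tendsto z atTop (𝓝 z₀)) (h : ∀ k, eval (Fin.cons (ρ k) (z k) : Fin (n + 1) → ℝ) H = 0) :
    eval z₀ (finSuccEquiv ℝ n H).leadingCoeff = 0 := by
  set p := finSuccEquiv ℝ n H
  have hroot (k : ℕ) :
      ∑ j ∈ Finset.range (p.natDegree + 1), eval (z k) (p.coeff j) * ρ k ^ j = 0 := by
    rw [← h k, eval_eq_eval_mv_eval', Polynomial.eval_map, Polynomial.eval₂_eq_sum_range]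
  have hterm (j : ℕ) (hj : j ∈ Finset.range (p.natDegree + 1)) :
      Tendsto (fun k => eval (z k) (p.coeff j) * (ρ k ^ j / ρ k ^ p.natDegree)) atTop
        (𝓝 (eval z₀ (p.coeff j) * if j = p.natDegree then 1 else 0)) := by
    refine (((continuous_eval (p.coeff j)).tendsto z₀).comp hz).mul ?_
    split_ifs with hjd
    · subst hjd
      refine tendsto_const_nhds.congr' ?_
      filter_upwards [hρ.eventually_gt_atTop 0] with k hk
      rw [div_self (pow_pos hk _).ne']
    · exact (tendsto_pow_div_pow_atTop_zero (by grind)).comp hρ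
  have hzero (k : ℕ) : ∑ j ∈ Finset.range (p.natDegree + 1),
      eval (z k) (p.coeff j) * (ρ k ^ j / ρ k ^ p.natDegree) = 0 := by
    simp only [← mul_div_assoc]
    rw [← Finset.sum_div, hroot, zero_div]
  have hlim := tendsto_nhds_unique (tendsto_finsetSum _ hterm)
    (tendsto_const_nhds.congr fun k => (hzero k).symm)
  simpa using hlim

theorem exists_seq_isMaxOn_tendsto {E : Type*} [TopologicalSpace E] {S : Set E} {N g : E → ℝ}
    {M : ℝ} (hN : ∀ R, IsCompact (S ∩ {x | N x ≤ R})) (hg : ContinuousOn g S)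
    (hM : IsLUB (g '' S) M) (hMS : M ∉ g '' S) :
    ∃ x : ℕ → E, (∀ k, x k ∈ S) ∧ (∀ k, IsMaxOn g (S ∩ {z | N z ≤ N (x k)}) (x k)) ∧
      Tendsto (N ∘ x) atTop atTop ∧ Tendsto (g ∘ x) atTop (𝓝 M) := by
  obtain ⟨u, -, -, hu, huS⟩ := hM.exists_seq_strictMono_tendsto_of_notMem hMS hM.nonempty
  choose x' hx'S hx'u using huS
  choose x hx hxmax using fun k => (hN (N (x' k))).exists_isMaxOn ⟨x' k, hx'S k, le_refl (N (x' k))⟩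
    (hg.mono Set.inter_subset_left)
  have hlt {z : E} (hz : z ∈ S) : g z < M :=
    (hM.1 ⟨z, hz, rfl⟩).lt_of_ne fun h => hMS ⟨z, hz, h⟩
  have hgx : Tendsto (g ∘ x) atTop (𝓝 M) :=
    tendsto_of_tendsto_of_tendsto_of_le_of_le hu tendsto_const_nhds
      (fun k => (hx'u k).ge.trans (hxmax k ⟨hx'S k, le_refl (N (x' k))⟩)) fun k => (hlt (hx k).1).le
  refine ⟨x, fun k => (hx k).1,
    fun k => (hxmax k).on_subset fun z hz =>
      ⟨hz.1, show N z ≤ N (x' k) from le_trans hz.2 (hx k).2⟩,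
    tendsto_atTop.2 fun R => ?_, hgx⟩
  have hsup : ∃ m < M, ∀ z ∈ S ∩ {x | N x ≤ R}, g z ≤ m := by
    rcases (S ∩ {x | N x ≤ R}).eq_empty_or_nonempty with h | h
    · exact ⟨M - 1, by linarith, by simp [h]⟩
    · obtain ⟨z, hz, hzmax⟩ := (hN R).exists_isMaxOn h (hg.mono Set.inter_subset_left)
      exact ⟨g z, hlt hz.1, hzmax⟩
  obtain ⟨m, hm, hmR⟩ := hsup
  filter_upwards [hgx.eventually (eventually_gt_nhds hm)] with k hk
  exact (not_le.1 fun h => (hmR (x k) ⟨(hx k).1, h⟩).not_gt hk).le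

variable {σ : Type*}

theorem isCompact_inter_sum_sq_le [Fintype σ] {S : Set (σ → ℝ)} (hS : IsClosed S) (R : ℝ) :
    IsCompact (S ∩ {x | ∑ l, x l ^ 2 ≤ R}) := by
  refine Metric.isCompact_of_isClosed_isBounded
    (hS.inter (isClosed_le (by fun_prop) continuous_const)) ?_
  refine (Metric.isBounded_closedBall (x := 0) (r := √R)).subset ?_
  rintro x ⟨-, hx⟩
  rw [mem_closedBall_zero_iff, pi_norm_le_iff_of_nonneg (Real.sqrt_nonneg R)]
  exact fun l => Real.abs_le_sqrt ((Finset.single_le_sum (f := fun l => x l ^ 2)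
    (fun _ _ => sq_nonneg _) (Finset.mem_univ l)).trans hx)

variable [Finite σ]

theorem exists_ne_zero_eval_eq_zero_of_isGreatest (F G : MvPolynomial σ ℝ) :
    ∃ H : MvPolynomial (Fin 2) ℝ, H ≠ 0 ∧ ∀ r M,
      IsGreatest ((eval · G) '' {x | eval x F = r}) M → eval ![M, r] H = 0 := by
  obtain ⟨H, hH0, hH⟩ := exists_ne_zero_eval_eq_zero_of_isMaxOn ![G, F] 0
  refine ⟨H, hH0, ?_⟩
  rintro _ _ ⟨⟨x, rfl, rfl⟩, hmax⟩
  have h := hH x fun z hz => hmax ⟨z, by simpa using hz 1 one_ne_zero, rfl⟩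
  convert h using 3
  ext i
  fin_cases i <;> rfl

/-- When the supremum of `G` on a level set of `F` is not attained, it is approached along points
that maximize `G` for prescribed values of `F` and of the squared norm, which tends to infinity. -/
theorem exists_ne_zero_eval_eq_zero_of_isLUB_of_notMem (F G : MvPolynomial σ ℝ) :
    ∃ H : MvPolynomial (Fin 2) ℝ, H ≠ 0 ∧ ∀ r M,
      IsLUB ((eval · G) '' {x | eval x F = r}) M → M ∉ (eval · G) '' {x | eval x F = r} →
        eval ![M, r] H = 0 := by
  cases nonempty_fintype σ
  let N : MvPolynomial σ ℝ := ∑ l, X l ^ 2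
  have hN (x : σ → ℝ) : eval x N = ∑ l, x l ^ 2 := by simp [N]
  obtain ⟨H, hH0, hH⟩ := exists_ne_zero_eval_eq_zero_of_isMaxOn ![N, G, F] 1
  refine ⟨(finSuccEquiv ℝ 2 H).leadingCoeff, by simpa using hH0, fun r M hM hMr => ?_⟩
  have hclosed : IsClosed {x | eval x F = r} := isClosed_eq (continuous_eval F) continuous_const
  obtain ⟨x, hxr, hxmax, hxN, hxG⟩ := exists_seq_isMaxOn_tendsto (N := (eval · N))
    (by simpa only [hN] using isCompact_inter_sum_sq_le hclosed)
    (continuous_eval G).continuousOn hM hMr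
  refine eval_leadingCoeff_eq_zero_of_tendsto H hxN (z := fun k => ![eval (x k) G, r])
    (tendsto_pi_nhds.2 (Fin.forall_fin_two.2 ⟨hxG, tendsto_const_nhds⟩)) fun k => ?_
  have hcrit := hH (x k) fun z hz => hxmax k
    ⟨(hz 2 (by decide)).trans (hxr k), (hz 0 (by decide)).le⟩
  convert hcrit using 3
  rw [← show eval (x k) F = r from hxr k]
  ext i
  fin_cases i <;> rfl

theorem evalEval_aeval_fin_two {R : Type*} [CommRing R] (H : MvPolynomial (Fin 2) R) (a b : R) :
    (aeval ![Polynomial.X, Polynomial.C Polynomial.X] H : Polynomial (Polynomial R)).evalEval b a =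
      eval ![a, b] H := by
  induction H using MvPolynomial.induction_on with
  | C c => simp [Polynomial.algebraMap_apply]
  | add p q hp hq => simp only [map_add, Polynomial.evalEval_add, hp, hq]
  | mul_X p i hp =>
    simp only [map_mul, Polynomial.evalEval_mul, hp, aeval_X, eval_X]
    fin_cases i <;> simp [Polynomial.evalEval]

theorem exists_evalEval_eq_zero_of_isLUB (F G : MvPolynomial σ ℝ) :
    ∃ A : Polynomial (Polynomial ℝ), A ≠ 0 ∧ ∀ r M,
      IsLUB ((eval · G) '' {x | eval x F = r}) M → A.evalEval r M = 0 := by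
  obtain ⟨H₁, hH₁0, hH₁⟩ := exists_ne_zero_eval_eq_zero_of_isGreatest F G
  obtain ⟨H₂, hH₂0, hH₂⟩ := exists_ne_zero_eval_eq_zero_of_isLUB_of_notMem F G
  refine ⟨aeval ![Polynomial.X, Polynomial.C Polynomial.X] (H₁ * H₂), fun h0 => ?_,
    fun r M hM => ?_⟩
  · refine mul_ne_zero hH₁0 hH₂0 (MvPolynomial.funext fun v => ?_)
    have hv : v = ![v 0, v 1] := by simp [funext_iff, Fin.forall_fin_two]
    rw [hv, ← evalEval_aeval_fin_two, h0]
    simp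
  · rw [evalEval_aeval_fin_two, map_mul, mul_eq_zero]
    by_cases hMr : M ∈ (eval · G) '' {x | eval x F = r}
    · exact Or.inl (hH₁ r M ⟨hMr, hM.1⟩)
    · exact Or.inr (hH₂ r M hM hMr)

theorem exists_bound_rpow_of_forall_pos {F G : MvPolynomial σ ℝ} (hF : ∀ x, 1 ≤ eval x F) {θ : ℝ}
    (hε : ∀ ε > 0, ∃ C : ℝ, ∀ x, eval x G ≤ C * eval x F ^ (θ + ε)) :
    ∃ C > 0, ∀ x, eval x G ≤ C * eval x F ^ θ := by
  obtain ⟨A, hA, hroot⟩ := exists_evalEval_eq_zero_of_isLUB F G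
  let level (x₀ : σ → ℝ) : Set ℝ := (eval · G) '' {x | eval x F = eval x₀ F}
  have hbound {C ε : ℝ} (hC : ∀ x, eval x G ≤ C * eval x F ^ (θ + ε)) (x₀ : σ → ℝ) :
      C * eval x₀ F ^ (θ + ε) ∈ upperBounds (level x₀) := by
    rintro _ ⟨x, hx, rfl⟩
    exact (hC x).trans_eq (congrArg (fun r => C * r ^ (θ + ε)) hx)
  obtain ⟨C₁, hC₁⟩ := hε 1 one_pos
  have hlub (x₀ : σ → ℝ) : IsLUB (level x₀) (sSup (level x₀)) :=
    isLUB_csSup ⟨_, x₀, rfl, rfl⟩ ⟨_, hbound hC₁ x₀⟩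
  obtain ⟨C, hC, h⟩ := exists_bound_of_root hA hF (fun x₀ => hroot _ _ (hlub x₀))
    fun ε hε0 => (hε ε hε0).imp fun C hC x₀ => (hlub x₀).2 (hbound hC x₀)
  exact ⟨C, hC, fun x => ((hlub x).1 ⟨x, rfl, rfl⟩).trans (h x)⟩

end LevelSup

section Hasse

open MvPolynomial

variable {σ R M : Type*} [CommSemiring R]

/-- The polynomial `p(X + Y)` as a polynomial in `Y` with coefficients in `R[X]`; its coefficients
are the Taylor coefficients of `p`. -/
def taylorShift : MvPolynomial σ R →ₐ[R] MvPolynomial σ (MvPolynomial σ R) :=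
  aeval fun i => C (X i) + X i

/-- The Taylor coefficient `p^{(α)} / α!` of a polynomial, in a form that makes sense over any
coefficient semiring. -/
def hasse (α : σ →₀ ℕ) : MvPolynomial σ R →ₗ[R] MvPolynomial σ R :=
  (lcoeff (MvPolynomial σ R) α).restrictScalars R ∘ₗ taylorShift.toLinearMap

theorem taylorShift_C (a : R) : taylorShift (C a : MvPolynomial σ R) = C (C a) := by
  simp [taylorShift, MvPolynomial.algebraMap_apply, algebraMap_eq]

theorem taylorShift_X (i : σ) : taylorShift (X i : MvPolynomial σ R) = C (X i) + X i := by
  simp [taylorShift]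

theorem hasse_zero (p : MvPolynomial σ R) : hasse 0 p = p := by
  have h : (constantCoeff : MvPolynomial σ (MvPolynomial σ R) →+* _).comp
      (taylorShift : MvPolynomial σ R →ₐ[R] _).toRingHom = RingHom.id _ :=
    ringHom_ext (fun a => by simp) fun i => by simp [taylorShift_X]
  exact DFunLike.congr_fun h p

theorem pderiv_taylorShift (i : σ) (p : MvPolynomial σ R) :
    pderiv i (taylorShift p) = taylorShift (pderiv i p) := by
  classical
  induction p using MvPolynomial.induction_on with
  | C a => rw [taylorShift_C, pderiv_C, pderiv_C, map_zero]
  | add p q hp hq => simp only [map_add, hp, hq]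
  | mul_X p j hp =>
    have hX : pderiv i (taylorShift (X j : MvPolynomial σ R)) = taylorShift (pderiv i (X j)) := by
      rw [taylorShift_X, map_add, pderiv_C, zero_add, pderiv_X, pderiv_X]
      rcases eq_or_ne i j with rfl | h
      · simp
      · simp [h.symm]
    simp only [map_mul, map_add, pderiv_mul, hp, hX]

theorem succ_smul_hasse_add_single (α : σ →₀ ℕ) (i : σ) (p : MvPolynomial σ R) :
    (α i + 1) • hasse (α + Finsupp.single i 1) p = hasse α (pderiv i p) := by
  change _ • coeff _ (taylorShift p) = coeff _ (taylorShift _)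
  rw [← pderiv_taylorShift, coeff_pderiv, nsmul_eq_mul, mul_comm]
  norm_cast

theorem degree_le_of_mem_support_taylorShift {α : σ →₀ ℕ} {p : MvPolynomial σ R}
    (hα : α ∈ (taylorShift p).support) : α.degree ≤ p.totalDegree := by
  have hX (i : σ) : (C (X i) + X i : MvPolynomial σ (MvPolynomial σ R)).totalDegree ≤ 1 := by
    rcases subsingleton_or_nontrivial R with _ | _
    · rw [Subsingleton.elim (C (X i) + X i) 0, totalDegree_zero]
      exact Nat.zero_le 1
    · exact (totalDegree_add _ _).trans (by simp)
  refine (le_totalDegree hα).trans ?_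
  rw [taylorShift, aeval_def, eval₂_eq]
  refine (totalDegree_finsetSum _ _).trans (Finset.sup_le fun s hs => ?_)
  refine (totalDegree_mul _ _).trans ?_
  rw [MvPolynomial.algebraMap_apply, totalDegree_C, zero_add]
  refine (totalDegree_finsetProd _ _).trans ((Finset.sum_le_sum fun i _ => ?_).trans
    (le_totalDegree hs))
  exact (totalDegree_pow _ _).trans (mul_le_of_le_one_right zero_le (hX i))

theorem hasse_eq_zero_of_notMem_support {α : σ →₀ ℕ} {p : MvPolynomial σ R}
    (hα : α ∉ (taylorShift p).support) : hasse α p = 0 :=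
  notMem_support_iff.1 hα

/-- Abstract Leibniz rule. Both the Taylor formula and the product rule for `p(D)(χ v)` are
instances of it. -/
theorem eq_sum_hasse_of_map_mul_X [AddCommMonoid M] [Module R M]
    (Φ : (σ →₀ ℕ) → MvPolynomial σ R →ₗ[R] M) (Ψ : MvPolynomial σ R →ₗ[R] M)
    (δ : σ → M →ₗ[R] M) (hΨ : ∀ i p, Ψ (p * X i) = δ i (Ψ p)) (hone : Ψ 1 = Φ 0 1)
    (hΦ : ∀ α i p, δ i (Φ α p) = Φ (α + Finsupp.single i 1) p + Φ α (X i * p))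
    (p : MvPolynomial σ R) :
    Ψ p = ∑ α ∈ (taylorShift p).support, Φ α (hasse α p) := by
  let Λ : MvPolynomial σ (MvPolynomial σ R) →+ M :=
    { toFun q := (AddMonoidAlgebra.coeff q).sum fun α => Φ α
      map_zero' := Finsupp.sum_zero_index
      map_add' q q' := Finsupp.sum_add_index' (fun _ => map_zero _) fun _ => map_add _ }
  have hΛ_monomial (α : σ →₀ ℕ) (a : MvPolynomial σ R) : Λ (monomial α a) = Φ α a :=
    sum_monomial_eq (map_zero _)
  have hΛ_mul (i : σ) (q) : Λ (q * (C (X i) + X i)) = δ i (Λ q) := by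
    induction q using MvPolynomial.induction_on' with
    | monomial α a =>
      have hX : monomial α a * X i = monomial (α + Finsupp.single i 1) a := by
        rw [X, monomial_mul, mul_one]
      rw [mul_add, hX, mul_comm, C_mul_monomial, map_add, hΛ_monomial, hΛ_monomial, hΛ_monomial,
        hΦ, add_comm]
    | add q q' h h' => rw [add_mul, map_add, h, h', map_add, map_add]
  suffices h : Ψ p = Λ (taylorShift p) from h.trans sum_def
  induction p using MvPolynomial.induction_on with
  | C a =>
    have hC : (C a : MvPolynomial σ R) = a • 1 := by rw [smul_eq_C_mul, mul_one]
    have hshift : taylorShift (C a : MvPolynomial σ R) = monomial 0 (C a) := taylorShift_C a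
    rw [hshift, hΛ_monomial, hC, map_smul, map_smul, hone]
  | add p q hp hq => simp only [map_add, hp, hq]
  | mul_X p i hp => rw [hΨ, hp, map_mul, taylorShift_X, hΛ_mul]

theorem eval_add_eq_sum_hasse [Fintype σ] (x y : σ → R) (p : MvPolynomial σ R) :
    eval (x + y) p = ∑ α ∈ (taylorShift p).support, (∏ i, y i ^ α i) * eval x (hasse α p) := by
  classical
  have h := eq_sum_hasse_of_map_mul_X
    (fun α => LinearMap.lsmul R R (∏ i, y i ^ α i) ∘ₗ (aeval x).toLinearMap)
    (aeval (x + y)).toLinearMap (fun i => LinearMap.lsmul R R (x i + y i))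
    (fun i p => by simp [mul_comm, add_mul]) (by simp) (fun α i p => ?_) p
  · simpa [coe_aeval_eq_eval] using h
  · have hi : ∏ j, y j ^ (Finsupp.single i 1 : σ →₀ ℕ) j = y i := by
      simp [Finsupp.single_apply, pow_ite]
    simp only [LinearMap.coe_comp, Function.comp_apply, AlgHom.toLinearMap_apply, map_mul, aeval_X,
      LinearMap.lsmul_apply, smul_eq_mul, Finsupp.add_apply, pow_add, Finset.prod_mul_distrib, hi]
    ring

end Hasse

section SymbDeriv

open MvPolynomial

variable {n : ℕ}

theorem prod_factorial_add_single {ι : Type*} [Fintype ι] (α : ι →₀ ℕ) (i : ι) :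
    ∏ j, ((α + Finsupp.single i 1 : ι →₀ ℕ) j).factorial = (α i + 1) * ∏ j, (α j).factorial := by
  classical
  rw [← Finset.mul_prod_erase _ _ (Finset.mem_univ i),
    ← Finset.mul_prod_erase _ (fun j => (α j).factorial) (Finset.mem_univ i), ← mul_assoc]
  congr 1
  · simp [Nat.factorial_succ]
  · exact Finset.prod_congr rfl fun j hj => by
      simp [Finsupp.single_eq_of_ne (Finset.ne_of_mem_erase hj)]

theorem factorial_smul_hasse_add_single {R ι : Type*} [CommSemiring R] [Fintype ι] (α : ι →₀ ℕ)
    (i : ι) (k : ℕ) (p : MvPolynomial ι R) :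
    (∏ j, ((α + Finsupp.single i k : ι →₀ ℕ) j).factorial) • hasse (α + Finsupp.single i k) p =
      (∏ j, (α j).factorial) • hasse α ((pderiv i)^[k] p) := by
  induction k generalizing p with
  | zero => simp
  | succ k ih =>
    rw [Finsupp.single_add, ← add_assoc, prod_factorial_add_single, mul_comm, mul_smul,
      succ_smul_hasse_add_single, ih, Function.iterate_succ_apply]

theorem symbDeriv_eq_factorial_smul_hasse (α : Fin n →₀ ℕ) (p : MvPolynomial (Fin n) ℂ) :
    symbDeriv α p = (∏ j, (α j).factorial) • hasse α p := by
  have hlist (l : List (Fin n)) (β : Fin n →₀ ℕ) :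
      (∏ j, (β j).factorial) • hasse β ((l.map fun j =>
        (fun q : MvPolynomial (Fin n) ℂ => pderiv j q)^[α j]).foldr (fun g h => g ∘ h) id p) =
      (∏ j, ((β + (l.map fun j => Finsupp.single j (α j)).sum : Fin n →₀ ℕ) j).factorial) •
        hasse (β + (l.map fun j => Finsupp.single j (α j)).sum) p := by
    induction l generalizing β with
    | nil => simp
    | cons j l ih =>
      rw [List.map_cons, List.foldr_cons, Function.comp_apply,
        ← factorial_smul_hasse_add_single β j (α j), ih, List.map_cons, List.sum_cons, add_assoc]
  have hsum : ((List.finRange n).map fun j => Finsupp.single j (α j)).sum = α := by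
    rw [← List.ofFn_eq_map, List.sum_ofFn, Finsupp.univ_sum_single]
  have h := hlist (List.finRange n) 0
  rw [hsum, zero_add] at h
  rw [symbDeriv, iterComp, List.ofFn_eq_map, ← h]
  simp [hasse_zero]

end SymbDeriv

section Symbols

open MvPolynomial

variable {n N : ℕ} {P : Fin N → MvPolynomial (Fin n) ℂ} {γ : ℝ}

/-- The size `1 + ∑_j |P_j(ξ)|` of the symbols of a system, in which condition `(ℋ)` and the
relation `≺_h` are expressed. -/
def symbSize (P : Fin N → MvPolynomial (Fin n) ℂ) (ξ : EuclideanSpace ℝ (Fin n)) : ℝ :=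
  1 + ∑ j, ‖symb (P j) ξ‖

theorem one_le_symbSize (P : Fin N → MvPolynomial (Fin n) ℂ) (ξ) : 1 ≤ symbSize P ξ :=
  le_add_of_nonneg_right (Finset.sum_nonneg fun _ _ => norm_nonneg _)

theorem symbSize_pos (P : Fin N → MvPolynomial (Fin n) ℂ) (ξ) : 0 < symbSize P ξ :=
  one_pos.trans_le (one_le_symbSize P ξ)

theorem norm_symb_le_symbSize (P : Fin N → MvPolynomial (Fin n) ℂ) (j ξ) :
    ‖symb (P j) ξ‖ ≤ symbSize P ξ :=
  (Finset.single_le_sum (f := fun j => ‖symb (P j) ξ‖) (fun _ _ => norm_nonneg _)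
    (Finset.mem_univ j)).trans (le_add_of_nonneg_left zero_le_one)

theorem norm_symb_symbDeriv (α : Fin n →₀ ℕ) (p : MvPolynomial (Fin n) ℂ) (ξ) :
    ‖symb (symbDeriv α p) ξ‖ = (∏ i, (α i).factorial : ℕ) * ‖symb (hasse α p) ξ‖ := by
  rw [symbDeriv_eq_factorial_smul_hasse, symb, map_nsmul, nsmul_eq_mul, norm_mul,
    RCLike.norm_natCast, symb]

theorem CondHWith.exists_norm_hasse_le (h : CondHWith P γ) :
    ∃ C > 0, ∀ (α : Fin n →₀ ℕ) (ξ) (j),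
      ‖symb (hasse α (P j)) ξ‖ ≤ C * symbSize P ξ ^ (1 - (α.degree : ℝ) / γ) := by
  obtain ⟨C, hC, h⟩ := h
  refine ⟨C, hC, fun α ξ j => ?_⟩
  have hfact : (1 : ℝ) ≤ (∏ i, (α i).factorial : ℕ) := by
    exact_mod_cast Finset.prod_pos fun i _ => (α i).factorial_pos
  calc ‖symb (hasse α (P j)) ξ‖ ≤ ‖symb (symbDeriv α (P j)) ξ‖ := by
        rw [norm_symb_symbDeriv]
        exact le_mul_of_one_le_left (norm_nonneg _) hfact
    _ ≤ ∑ j, ‖symb (symbDeriv α (P j)) ξ‖ :=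
        Finset.single_le_sum (f := fun j => ‖symb (symbDeriv α (P j)) ξ‖)
          (fun _ _ => norm_nonneg _) (Finset.mem_univ j)
    _ ≤ C * symbSize P ξ ^ (1 - (α.degree : ℝ) / γ) := by
        simpa only [symbSize, Finsupp.degree_eq_sum] using h α ξ

theorem condHWith_of_forall_hasse (h : ∀ α : Fin n →₀ ℕ, ∃ C, ∀ ξ j,
    ‖symb (hasse α (P j)) ξ‖ ≤ C * symbSize P ξ ^ (1 - (α.degree : ℝ) / γ)) : CondHWith P γ := by
  choose C h using h
  let S := Finset.univ.biUnion fun j => (taylorShift (P j)).support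
  let B (α : Fin n →₀ ℕ) : ℝ := (∏ i, (α i).factorial : ℕ) * |C α|
  have hB (α) : 0 ≤ B α := by positivity
  have hbound (α : Fin n →₀ ℕ) (ξ) (j) : ‖symb (symbDeriv α (P j)) ξ‖ ≤
      (∑ β ∈ S, B β) * symbSize P ξ ^ (1 - (α.degree : ℝ) / γ) := by
    have hpow := Real.rpow_nonneg (symbSize_pos P ξ).le (1 - (α.degree : ℝ) / γ)
    rw [norm_symb_symbDeriv]
    by_cases hα : α ∈ (taylorShift (P j)).support
    · have hαS : α ∈ S := Finset.mem_biUnion.2 ⟨j, Finset.mem_univ j, hα⟩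
      calc _ ≤ (∏ i, (α i).factorial : ℕ) *
            (|C α| * symbSize P ξ ^ (1 - (α.degree : ℝ) / γ)) := by
            gcongr
            exact (h α ξ j).trans (by gcongr; exact le_abs_self _)
        _ = B α * symbSize P ξ ^ (1 - (α.degree : ℝ) / γ) := (mul_assoc _ _ _).symm
        _ ≤ _ := by
            gcongr
            exact Finset.single_le_sum (fun β _ => hB β) hαS
    · rw [hasse_eq_zero_of_notMem_support hα, symb, map_zero, norm_zero, mul_zero]
      exact mul_nonneg (Finset.sum_nonneg fun β _ => hB β) hpow
  have : 0 ≤ ∑ β ∈ S, B β := Finset.sum_nonneg fun β _ => hB β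
  refine ⟨N * (∑ β ∈ S, B β) + 1, by positivity, fun α ξ => ?_⟩
  have hpow := Real.rpow_nonneg (symbSize_pos P ξ).le (1 - ((∑ i, α i : ℕ) : ℝ) / γ)
  calc ∑ j, ‖symb (symbDeriv α (P j)) ξ‖
      ≤ ∑ _j : Fin N, (∑ β ∈ S, B β) * symbSize P ξ ^ (1 - ((∑ i, α i : ℕ) : ℝ) / γ) :=
        Finset.sum_le_sum fun j _ => by
          simpa [Finsupp.degree_eq_sum] using hbound (Finsupp.equivFunOnFinite.symm α) ξ j
    _ = N * (∑ β ∈ S, B β) * symbSize P ξ ^ (1 - ((∑ i, α i : ℕ) : ℝ) / γ) := by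
        rw [Finset.sum_const, Finset.card_univ, Fintype.card_fin, nsmul_eq_mul, mul_assoc]
    _ ≤ _ := mul_le_mul_of_nonneg_right (le_add_of_nonneg_right zero_le_one) hpow

theorem exists_re_im_eval (p : MvPolynomial (Fin n) ℂ) :
    ∃ a b : MvPolynomial (Fin n) ℝ, ∀ x : Fin n → ℝ,
      eval (fun i => (x i : ℂ)) p = (eval x a : ℂ) + (eval x b : ℂ) * Complex.I := by
  induction p using MvPolynomial.induction_on with
  | C z =>
    refine ⟨C z.re, C z.im, fun x => ?_⟩
    rw [eval_C, eval_C, eval_C, Complex.re_add_im]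
  | add p q hp hq =>
    obtain ⟨a, b, h⟩ := hp
    obtain ⟨a', b', h'⟩ := hq
    refine ⟨a + a', b + b', fun x => ?_⟩
    simp only [map_add, h, h', Complex.ofReal_add]
    ring
  | mul_X p i hp =>
    obtain ⟨a, b, h⟩ := hp
    refine ⟨a * X i, b * X i, fun x => ?_⟩
    simp only [map_mul, h, eval_X, Complex.ofReal_mul]
    ring

theorem exists_eval_eq_norm_symb_sq (p : MvPolynomial (Fin n) ℂ) :
    ∃ q : MvPolynomial (Fin n) ℝ, ∀ ξ : EuclideanSpace ℝ (Fin n),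
      eval (fun i => ξ i) q = ‖symb p ξ‖ ^ 2 := by
  obtain ⟨a, b, h⟩ := exists_re_im_eval p
  refine ⟨a ^ 2 + b ^ 2, fun ξ => ?_⟩
  rw [symb, h fun i => ξ i, ← Complex.normSq_eq_norm_sq, Complex.normSq_add_mul_I, map_add,
    map_pow, map_pow]

theorem exists_eval_comparable_symbSize_sq (P : Fin N → MvPolynomial (Fin n) ℂ) :
    ∃ F : MvPolynomial (Fin n) ℝ, ∀ ξ : EuclideanSpace ℝ (Fin n), 1 ≤ eval (fun i => ξ i) F ∧
      eval (fun i => ξ i) F ≤ symbSize P ξ ^ 2 ∧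
      symbSize P ξ ^ 2 ≤ (N + 1 : ℕ) * eval (fun i => ξ i) F := by
  choose q hq using fun j => exists_eval_eq_norm_symb_sq (P j)
  refine ⟨1 + ∑ j, q j, fun ξ => ?_⟩
  let f : Option (Fin N) → ℝ := fun o => o.elim 1 fun j => ‖symb (P j) ξ‖
  have hf : ∀ o ∈ Finset.univ, 0 ≤ f o := fun o _ => by
    cases o with
    | none => exact zero_le_one
    | some j => exact norm_nonneg _
  have hF : eval (fun i => ξ i) (1 + ∑ j, q j) = ∑ o, f o ^ 2 := by
    simp [Fintype.sum_option, f, hq]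
  have hsize : symbSize P ξ = ∑ o, f o := by simp [Fintype.sum_option, f, symbSize]
  refine ⟨?_, ?_, ?_⟩
  · simpa [hq] using Finset.sum_nonneg fun j _ => sq_nonneg ‖symb (P j) ξ‖
  · rw [hF, hsize]
    exact Finset.sum_sq_le_sq_sum_of_nonneg hf
  · rw [hF, hsize]
    simpa using sq_sum_le_card_mul_sum_sq (s := Finset.univ) (f := f)

theorem exists_norm_symb_le_rpow_of_forall_pos (P : Fin N → MvPolynomial (Fin n) ℂ)
    (p : MvPolynomial (Fin n) ℂ) {θ : ℝ} (hθ : 0 ≤ θ)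
    (h : ∀ ε > 0, ∃ C, ∀ ξ, ‖symb p ξ‖ ≤ C * symbSize P ξ ^ (θ + ε)) :
    ∃ C, ∀ ξ, ‖symb p ξ‖ ≤ C * symbSize P ξ ^ θ := by
  obtain ⟨F, hF⟩ := exists_eval_comparable_symbSize_sq P
  obtain ⟨G, hG⟩ := exists_eval_eq_norm_symb_sq p
  have hsq (C e : ℝ) (ξ) : (C * symbSize P ξ ^ e) ^ 2 = C ^ 2 * (symbSize P ξ ^ 2) ^ e := by
    rw [mul_pow, Real.rpow_pow_comm (symbSize_pos P ξ).le]
  obtain ⟨C, hC, hCG⟩ := exists_bound_rpow_of_forall_pos (F := F) (G := G)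
    (fun x => (hF (WithLp.toLp 2 x)).1) (θ := θ) fun ε hε => by
      obtain ⟨C, hC⟩ := h ε hε
      refine ⟨C ^ 2 * ((N + 1 : ℕ) : ℝ) ^ (θ + ε), fun x => ?_⟩
      obtain ⟨hF₁, -, hF₂⟩ := hF (WithLp.toLp 2 x)
      calc eval x G = ‖symb p (WithLp.toLp 2 x)‖ ^ 2 := hG (WithLp.toLp 2 x)
        _ ≤ (C * symbSize P (WithLp.toLp 2 x) ^ (θ + ε)) ^ 2 := by gcongr; exact hC _
        _ ≤ C ^ 2 * ((N + 1 : ℕ) * eval x F) ^ (θ + ε) := by rw [hsq]; gcongr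
        _ = _ := by rw [Real.mul_rpow (by positivity) (zero_le_one.trans hF₁), mul_assoc]
  refine ⟨√C, fun ξ => abs_le_of_sq_le_sq' ?_ ?_ |>.2⟩
  · calc ‖symb p ξ‖ ^ 2 ≤ C * eval (fun i => ξ i) F ^ θ := hG ξ ▸ hCG _
      _ ≤ C * (symbSize P ξ ^ 2) ^ θ := by
          gcongr
          exacts [zero_le_one.trans (hF ξ).1, (hF ξ).2.1]
      _ = (√C * symbSize P ξ ^ θ) ^ 2 := by rw [hsq, Real.sq_sqrt hC.le]
  · exact mul_nonneg (Real.sqrt_nonneg C) (Real.rpow_nonneg (symbSize_pos P ξ).le _)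

theorem le_gammaOf {m : ℕ} (hP : CondH P m) : (m : ℝ) ≤ gammaOf P m :=
  le_csInf hP fun _ h => h.1

theorem condHWith_gammaOf {m : ℕ} (hm : 0 < m) (hPm : ∀ j, (P j).totalDegree ≤ m)
    (hP : CondH P m) : CondHWith P (gammaOf P m) := by
  refine condHWith_of_forall_hasse fun α => ?_
  have hγ : (0 : ℝ) < gammaOf P m := (Nat.cast_pos.2 hm).trans_le (le_gammaOf hP)
  suffices h : ∀ j, ∃ C, ∀ ξ, ‖symb (hasse α (P j)) ξ‖ ≤
      C * symbSize P ξ ^ (1 - (α.degree : ℝ) / gammaOf P m) by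
    choose C hC using h
    refine ⟨∑ j, |C j|, fun ξ j => (hC j ξ).trans ?_⟩
    gcongr
    · exact Real.rpow_nonneg (symbSize_pos P ξ).le _
    · exact (le_abs_self _).trans
        (Finset.single_le_sum (f := fun j => |C j|) (fun _ _ => abs_nonneg _) (Finset.mem_univ j))
  intro j
  by_cases hα : α ∈ (taylorShift (P j)).support
  swap
  · exact ⟨0, fun ξ => by simp [hasse_eq_zero_of_notMem_support hα, symb]⟩
  have hαγ : (α.degree : ℝ) ≤ gammaOf P m :=
    (Nat.cast_le.2 ((degree_le_of_mem_support_taylorShift hα).trans (hPm j))).trans (le_gammaOf hP)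
  refine exists_norm_symb_le_rpow_of_forall_pos P _ (sub_nonneg.2 (div_le_one_of_le₀ hαγ hγ.le))
    fun ε hε => ?_
  have hcont : ContinuousAt (fun γ : ℝ => 1 - (α.degree : ℝ) / γ) (gammaOf P m) := by
    fun_prop (disch := exact hγ.ne')
  have hfreq : ∃ᶠ γ in 𝓝 (gammaOf P m), (m : ℝ) ≤ γ ∧ CondHWith P γ :=
    mem_closure_iff_frequently.1 (csInf_mem_closure hP ⟨m, fun _ h => h.1⟩)
  obtain ⟨γ, ⟨-, h⟩, hγε⟩ :=
    (hfreq.and_eventually (hcont.eventually_lt_const (lt_add_of_pos_right _ hε))).exists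
  obtain ⟨C, hC, h⟩ := h.exists_norm_hasse_le
  refine ⟨C, fun ξ => (h α ξ j).trans ?_⟩
  gcongr
  exact one_le_symbSize P ξ

end Symbols

section EqualStrength

open MvPolynomial

variable {n N M : ℕ} {P : Fin N → MvPolynomial (Fin n) ℂ} {Q : Fin M → MvPolynomial (Fin n) ℂ}
  {γ : ℝ}

theorem symb_add_eq_sum_hasse (p : MvPolynomial (Fin n) ℂ) (ξ η : EuclideanSpace ℝ (Fin n)) :
    symb p (ξ + η) =
      ∑ α ∈ (taylorShift p).support, (∏ i, (η i : ℂ) ^ α i) * symb (hasse α p) ξ := by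
  refine Eq.trans (congrArg (fun x => eval x p) (funext fun i => ?_))
    (eval_add_eq_sum_hasse (fun i => (ξ i : ℂ)) (fun i => (η i : ℂ)) p)
  exact Complex.ofReal_add (ξ i) (η i)

theorem norm_prod_pow_le (η : EuclideanSpace ℝ (Fin n)) (α : Fin n →₀ ℕ) :
    ‖∏ i, (η i : ℂ) ^ α i‖ ≤ ‖η‖ ^ α.degree := by
  rw [norm_prod, Finsupp.degree_eq_sum, ← Finset.prod_pow_eq_pow_sum]
  refine Finset.prod_le_prod (fun _ _ => norm_nonneg _) fun i _ => ?_
  rw [norm_pow, Complex.norm_real]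
  exact pow_le_pow_left₀ (norm_nonneg _) (PiLp.norm_apply_le η i) _

theorem rpow_one_div_pow_mul_rpow {a : ℝ} (ha : 0 < a) (k : ℕ) (γ : ℝ) :
    (a ^ (1 / γ)) ^ k * a ^ (1 - (k : ℝ) / γ) = a := by
  rw [← Real.rpow_natCast, ← Real.rpow_mul ha.le, ← Real.rpow_add ha, one_div_mul_eq_div,
    add_sub_cancel, Real.rpow_one]

theorem CondHWith.exists_symbSize_add_le (hP : CondHWith P γ) :
    ∃ C > 0, ∀ ξ η, ‖η‖ ≤ symbSize P ξ ^ (1 / γ) → symbSize P (ξ + η) ≤ C * symbSize P ξ := by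
  obtain ⟨C, hC, h⟩ := hP.exists_norm_hasse_le
  refine ⟨1 + ∑ j, ∑ _α ∈ (taylorShift (P j)).support, C, by positivity, fun ξ η hη => ?_⟩
  have hf := symbSize_pos P ξ
  rw [symbSize, add_mul, one_mul, Finset.sum_mul]
  refine add_le_add (one_le_symbSize P ξ) (Finset.sum_le_sum fun j _ => ?_)
  rw [symb_add_eq_sum_hasse, Finset.sum_mul]
  refine (norm_sum_le _ _).trans (Finset.sum_le_sum fun α _ => ?_)
  calc ‖(∏ i, (η i : ℂ) ^ α i) * symb (hasse α (P j)) ξ‖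
      ≤ (symbSize P ξ ^ (1 / γ)) ^ α.degree *
          (C * symbSize P ξ ^ (1 - (α.degree : ℝ) / γ)) := by
        rw [norm_mul]
        gcongr
        exacts [(norm_prod_pow_le η α).trans (by gcongr), h α ξ j]
    _ = C * symbSize P ξ := by
        rw [mul_left_comm, rpow_one_div_pow_mul_rpow hf]

theorem exists_sum_symb_eq_coeff (m : ℕ) (α : Fin n →₀ ℕ) :
    ∃ w : EuclideanSpace ℝ (Fin n) →₀ ℂ, ∀ p : MvPolynomial (Fin n) ℂ, p.totalDegree ≤ m →
      w.sum (fun η c => c * symb p η) = coeff α p := by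
  let V := restrictTotalDegree (Fin n) ℂ m
  let ev (η : EuclideanSpace ℝ (Fin n)) : Module.Dual ℂ V :=
    (aeval fun i => (η i : ℂ)).toLinearMap ∘ₗ V.subtype
  let W := Submodule.span ℂ (Set.range ev)
  have hbot : W.dualCoannihilator = ⊥ := by
    refine (Submodule.eq_bot_iff _).2 fun p hp => Subtype.ext ?_
    have hp0 (η : EuclideanSpace ℝ (Fin n)) : symb p η = 0 :=
      (Submodule.mem_dualCoannihilator _).1 hp (ev η) (Submodule.subset_span ⟨η, rfl⟩)
    refine funext_set (fun _ => Set.range ((↑) : ℝ → ℂ))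
      (fun _ => Set.infinite_range_of_injective Complex.ofReal_injective) fun x hx => ?_
    choose y hy using fun i => hx i (Set.mem_univ i)
    rw [← funext hy]
    exact (hp0 (WithLp.toLp 2 y)).trans (map_zero _).symm
  have hW : W = ⊤ := by
    rw [← Subspace.dualCoannihilator_dualAnnihilator_eq (W := W), hbot,
      Submodule.dualAnnihilator_bot]
  obtain ⟨w, hw⟩ := (Finsupp.mem_span_range_iff_exists_finsupp).1
    (hW ▸ Submodule.mem_top : lcoeff ℂ α ∘ₗ V.subtype ∈ W)
  refine ⟨w, fun p hp => ?_⟩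
  have h := LinearMap.congr_fun hw ⟨p, (mem_restrictTotalDegree _ _ _).2 hp⟩
  rw [Finsupp.sum, LinearMap.sum_apply] at h
  exact h

theorem exists_sum_symb_eq_hasse (m : ℕ) (α : Fin n →₀ ℕ) :
    ∃ w : EuclideanSpace ℝ (Fin n) →₀ ℂ, ∀ p : MvPolynomial (Fin n) ℂ, p.totalDegree ≤ m →
      ∀ (ξ : EuclideanSpace ℝ (Fin n)) (r : ℝ),
        w.sum (fun η c => c * symb p (ξ + r • η)) = (r : ℂ) ^ α.degree * symb (hasse α p) ξ := by
  classical
  obtain ⟨w, hw⟩ := exists_sum_symb_eq_coeff m α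
  refine ⟨w, fun p hp ξ r => ?_⟩
  let q : MvPolynomial (Fin n) ℂ :=
    ∑ β ∈ (taylorShift p).support, monomial β ((r : ℂ) ^ β.degree * symb (hasse β p) ξ)
  have hq_degree : q.totalDegree ≤ m := by
    refine (totalDegree_finsetSum _ _).trans (Finset.sup_le fun β hβ => ?_)
    exact (totalDegree_monomial_le _ _).trans
      ((degree_le_of_mem_support_taylorShift hβ).trans hp)
  have hq_symb (η : EuclideanSpace ℝ (Fin n)) : symb q η = symb p (ξ + r • η) := by
    rw [symb_add_eq_sum_hasse, symb, map_sum]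
    refine Finset.sum_congr rfl fun β _ => ?_
    simp only [eval_monomial, Finsupp.prod_fintype, pow_zero, implies_true, PiLp.smul_apply,
      smul_eq_mul, Complex.ofReal_mul, mul_pow, Finset.prod_mul_distrib,
      Finset.prod_pow_eq_pow_sum, Finsupp.degree_eq_sum]
    ring
  have hq_coeff : coeff α q = (r : ℂ) ^ α.degree * symb (hasse α p) ξ := by
    simp only [q, coeff_sum, coeff_monomial, Finset.sum_ite_eq', ite_eq_left_iff]
    intro hα
    rw [hasse_eq_zero_of_notMem_support hα, symb, map_zero, mul_zero]
  simp only [← hq_symb, hw q hq_degree, hq_coeff]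

theorem exists_pow_mul_norm_hasse_le (m : ℕ) (α : Fin n →₀ ℕ) :
    ∃ C > 0, ∀ p : MvPolynomial (Fin n) ℂ, p.totalDegree ≤ m →
      ∀ (ξ : EuclideanSpace ℝ (Fin n)) (r B : ℝ), 0 ≤ r →
        (∀ η, ‖η‖ ≤ r → ‖symb p (ξ + η)‖ ≤ B) → r ^ α.degree * ‖symb (hasse α p) ξ‖ ≤ C * B := by
  obtain ⟨w, hw⟩ := exists_sum_symb_eq_hasse m α
  let R := 1 + ∑ η ∈ w.support, ‖η‖
  have hR : 0 < R := by positivity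
  have hwR : ∀ η ∈ w.support, ‖η‖ ≤ R := fun η hη =>
    (Finset.single_le_sum (f := fun η => ‖η‖) (fun _ _ => norm_nonneg _) hη).trans
      (le_add_of_nonneg_left zero_le_one)
  refine ⟨R ^ α.degree * (1 + ∑ η ∈ w.support, ‖w η‖), by positivity, fun p hp ξ r B hr hB => ?_⟩
  have hB0 : 0 ≤ B := (norm_nonneg _).trans (hB 0 (norm_zero.trans_le hr))
  have hmem : ∀ η ∈ w.support, ‖(r / R) • η‖ ≤ r := fun η hη => by
    rw [norm_smul, Real.norm_of_nonneg (by positivity), div_mul_eq_mul_div, div_le_iff₀ hR]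
    exact mul_le_mul_of_nonneg_left (hwR η hη) hr
  have hscaled : (r / R) ^ α.degree * ‖symb (hasse α p) ξ‖ ≤ (∑ η ∈ w.support, ‖w η‖) * B :=
    calc (r / R) ^ α.degree * ‖symb (hasse α p) ξ‖
        = ‖w.sum fun η c => c * symb p (ξ + (r / R) • η)‖ := by
          rw [hw p hp, norm_mul, norm_pow, Complex.norm_real, Real.norm_of_nonneg (by positivity)]
      _ ≤ ∑ η ∈ w.support, ‖w η‖ * B :=
          norm_sum_le_of_le _ fun η hη => by rw [norm_mul]; gcongr; exact hB _ (hmem η hη)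
      _ = _ := (Finset.sum_mul ..).symm
  calc r ^ α.degree * ‖symb (hasse α p) ξ‖
      = R ^ α.degree * ((r / R) ^ α.degree * ‖symb (hasse α p) ξ‖) := by
        rw [← mul_assoc, ← mul_pow, mul_div_cancel₀ _ hR.ne']
    _ ≤ R ^ α.degree * ((1 + ∑ η ∈ w.support, ‖w η‖) * B) := by
        refine mul_le_mul_of_nonneg_left (hscaled.trans ?_) (by positivity)
        exact mul_le_mul_of_nonneg_right (le_add_of_nonneg_left zero_le_one) hB0
    _ = _ := (mul_assoc ..).symm

theorem HWeaker.exists_symbSize_le (h : HWeaker 1 Q P) :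
    ∃ C > 0, ∀ ξ, symbSize Q ξ ≤ C * symbSize P ξ := by
  obtain ⟨C, hC, h⟩ := h
  refine ⟨1 + C, by positivity, fun ξ => ?_⟩
  rw [add_mul, one_mul]
  exact add_le_add (one_le_symbSize P ξ) ((h ξ).trans_eq (by rw [Real.rpow_one, symbSize]))

theorem EquallyStrong.symm {h : ℝ} (hPQ : EquallyStrong h P Q) : EquallyStrong h Q P :=
  ⟨hPQ.2, hPQ.1⟩

theorem EquallyStrong.exists_symbSize_rpow_le (hPQ : EquallyStrong 1 P Q) (e : ℝ) :
    ∃ C > 0, ∀ ξ, symbSize P ξ ^ e ≤ C * symbSize Q ξ ^ e := by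
  obtain ⟨A, hA, hPA⟩ := hPQ.1.exists_symbSize_le
  obtain ⟨B, hB, hQB⟩ := hPQ.2.exists_symbSize_le
  rcases le_total 0 e with he | he
  · refine ⟨A ^ e, by positivity, fun ξ => ?_⟩
    rw [← Real.mul_rpow hA.le (symbSize_pos Q ξ).le]
    exact Real.rpow_le_rpow (symbSize_pos P ξ).le (hPA ξ) he
  · refine ⟨B⁻¹ ^ e, by positivity, fun ξ => ?_⟩
    have hQ := symbSize_pos Q ξ
    rw [← Real.mul_rpow (inv_nonneg.2 hB.le) hQ.le]
    exact Real.rpow_le_rpow_of_nonpos (by positivity) ((inv_mul_le_iff₀ hB).2 (hQB ξ)) he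

/- The values of `Q_j` on the ball of radius `|P|^{1/γ}` about `ξ`, on which `|P|` varies slowly,
control the Taylor coefficients of `Q_j` at `ξ`. -/
theorem CondHWith.of_equallyStrong (hPQ : EquallyStrong 1 P Q) (hP : CondHWith P γ) :
    CondHWith Q γ := by
  refine condHWith_of_forall_hasse fun α => ?_
  obtain ⟨A, hA, hslow⟩ := hP.exists_symbSize_add_le
  obtain ⟨B, hB, hQP⟩ := hPQ.2.exists_symbSize_le
  obtain ⟨E, _, hrpow⟩ := hPQ.exists_symbSize_rpow_le (1 - (α.degree : ℝ) / γ)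
  obtain ⟨C, hC, hhasse⟩ :=
    exists_pow_mul_norm_hasse_le (Finset.univ.sup fun j => (Q j).totalDegree) α
  refine ⟨C * (B * A) * E, fun ξ j => ?_⟩
  have hf := symbSize_pos P ξ
  have hball (η) (hη : ‖η‖ ≤ symbSize P ξ ^ (1 / γ)) :
      ‖symb (Q j) (ξ + η)‖ ≤ B * A * symbSize P ξ :=
    calc ‖symb (Q j) (ξ + η)‖ ≤ symbSize Q (ξ + η) := norm_symb_le_symbSize Q j _
      _ ≤ B * symbSize P (ξ + η) := hQP _
      _ ≤ B * (A * symbSize P ξ) := by gcongr; exact hslow ξ η hη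
      _ = B * A * symbSize P ξ := (mul_assoc ..).symm
  have hr : 0 < (symbSize P ξ ^ (1 / γ)) ^ α.degree := by positivity
  have hle := hhasse (Q j) (Finset.le_sup (f := fun j => (Q j).totalDegree) (Finset.mem_univ j))
    ξ _ _ (by positivity) hball
  calc ‖symb (hasse α (Q j)) ξ‖ ≤ C * (B * A) * symbSize P ξ ^ (1 - (α.degree : ℝ) / γ) := by
        refine le_of_mul_le_mul_left (hle.trans_eq ?_) hr
        linear_combination -(C * (B * A)) * rpow_one_div_pow_mul_rpow hf α.degree γ
    _ ≤ C * (B * A) * E * symbSize Q ξ ^ (1 - (α.degree : ℝ) / γ) := by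
        rw [mul_assoc _ E]
        gcongr
        exact hrpow ξ

theorem EquallyStrong.condHWith_iff (hPQ : EquallyStrong 1 P Q) :
    CondHWith P γ ↔ CondHWith Q γ :=
  ⟨.of_equallyStrong hPQ, .of_equallyStrong hPQ.symm⟩

theorem EquallyStrong.gammaOf_eq (hPQ : EquallyStrong 1 P Q) (m : ℕ) :
    gammaOf P m = gammaOf Q m := by
  simp only [gammaOf, hPQ.condHWith_iff]

end EqualStrength

section Weights

/-- The weights for which iterate spaces are compared: increasing functions on `[0,∞)` subject
to `(α)` and `(γ)` only. Unlike the non-quasianalytic weights, they are stable under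
`σ ↦ σ(t^a)` and `σ ↦ μ σ`. -/
structure IsWeight (σ : ℝ → ℝ) : Prop where
  nonneg : ∀ t, 0 ≤ t → 0 ≤ σ t
  monotoneOn : MonotoneOn σ (Set.Ici 0)
  alpha : ∃ L : ℝ, 0 < L ∧ ∀ t, 0 ≤ t → σ (2 * t) ≤ L * (σ t + 1)
  gamma : Real.log =o[atTop] σ

variable {σ : ℝ → ℝ}

theorem IsWeight.exists_nat_comp_mul_le (hσ : IsWeight σ) {a : ℝ} (ha : 0 ≤ a) :
    ∃ L : ℕ, 0 < L ∧ ∀ t, 0 ≤ t → σ (a * t) ≤ L * (σ t + 1) := by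
  have hpow (q : ℕ) : ∃ L : ℕ, 0 < L ∧ ∀ t, 0 ≤ t → σ (2 ^ q * t) ≤ L * (σ t + 1) := by
    induction q with
    | zero =>
      exact ⟨1, one_pos, fun t _ => by rw [pow_zero, one_mul, Nat.cast_one, one_mul]; linarith⟩
    | succ q ih =>
      obtain ⟨L, hL, h⟩ := ih
      obtain ⟨L', hL', h'⟩ := hσ.alpha
      refine ⟨⌈L'⌉₊ * (L + 1), by positivity, fun t ht => ?_⟩
      have hσt := hσ.nonneg t ht
      have hσq := hσ.nonneg (2 ^ q * t) (by positivity)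
      calc σ (2 ^ (q + 1) * t) = σ (2 * (2 ^ q * t)) := by rw [pow_succ', mul_assoc]
        _ ≤ L' * (σ (2 ^ q * t) + 1) := h' _ (by positivity)
        _ ≤ ⌈L'⌉₊ * (L * (σ t + 1) + (σ t + 1)) := by
          gcongr
          exacts [Nat.le_ceil L', h t ht, by linarith]
        _ = (⌈L'⌉₊ * (L + 1) : ℕ) * (σ t + 1) := by push_cast; ring
  obtain ⟨q, hq⟩ := pow_unbounded_of_one_lt a one_lt_two
  obtain ⟨L, hL, h⟩ := hpow q
  refine ⟨L, hL, fun t ht => (hσ.monotoneOn (mul_nonneg ha ht) ?_ ?_).trans (h t ht)⟩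
  · exact Set.mem_Ici.2 (by positivity)
  · exact mul_le_mul_of_nonneg_right hq.le ht

theorem IsWeight.const_mul (hσ : IsWeight σ) {μ : ℝ} (hμ : 0 < μ) :
    IsWeight fun t => μ * σ t where
  nonneg t ht := mul_nonneg hμ.le (hσ.nonneg t ht)
  monotoneOn := fun _ hx _ hy hxy => mul_le_mul_of_nonneg_left (hσ.monotoneOn hx hy hxy) hμ.le
  alpha := by
    obtain ⟨L, hL, h⟩ := hσ.alpha
    refine ⟨L * (1 + μ), by positivity, fun t ht => ?_⟩
    have hσt := hσ.nonneg t ht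
    calc μ * σ (2 * t) ≤ μ * (L * (σ t + 1)) := mul_le_mul_of_nonneg_left (h t ht) hμ.le
      _ ≤ L * (1 + μ) * (μ * σ t + 1) := by
        have : 0 ≤ L * (1 + μ ^ 2 * σ t) := by positivity
        linarith
  gamma := (isLittleO_const_mul_right_iff hμ.ne').2 hσ.gamma

theorem IsWeight.comp_rpow (hσ : IsWeight σ) {a : ℝ} (ha : 0 < a) :
    IsWeight fun t => σ (t ^ a) where
  nonneg t ht := hσ.nonneg _ (Real.rpow_nonneg ht a)
  monotoneOn := fun _ hx _ hy hxy => hσ.monotoneOn (Real.rpow_nonneg hx a)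
    (Real.rpow_nonneg hy a) (Real.rpow_le_rpow hx hxy ha.le)
  alpha := by
    obtain ⟨L, hL, h⟩ := hσ.exists_nat_comp_mul_le (Real.rpow_nonneg zero_le_two a)
    refine ⟨L, Nat.cast_pos.2 hL, fun t ht => ?_⟩
    rw [Real.mul_rpow zero_le_two ht]
    exact h _ (Real.rpow_nonneg ht a)
  gamma := by
    refine ((isLittleO_const_mul_left_iff ha.ne').1 ?_)
    refine (hσ.gamma.comp_tendsto (tendsto_rpow_atTop ha)).congr' ?_ EventuallyEq.rfl
    filter_upwards [eventually_gt_atTop 0] with t ht using Real.log_rpow ht a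

theorem IsWeight.exists_le_mul_rpow_add (hσ : IsWeight σ) {a : ℝ}
    (h : σ =o[atTop] fun t => t ^ a) {ε : ℝ} (hε : 0 < ε) :
    ∃ A, ∀ t, 0 ≤ t → σ t ≤ ε * t ^ a + A := by
  obtain ⟨T, hT⟩ := eventually_atTop.1 (h.bound hε)
  refine ⟨σ (max T 0), fun t ht => ?_⟩
  have hmax := hσ.nonneg (max T 0) (le_max_right _ _)
  rcases le_total t (max T 0) with htT | htT
  · have := hσ.monotoneOn ht (le_max_right T 0) htT
    have : 0 ≤ ε * t ^ a := by positivity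
    linarith
  · have := (le_abs_self _).trans (hT t ((le_max_left _ _).trans htT))
    rw [Real.norm_of_nonneg (Real.rpow_nonneg ht a)] at this
    linarith

end Weights

section YoungConj

variable {σ τ : ℝ → ℝ}

theorem IsWeight.bddAbove_youngConj (hσ : IsWeight σ) {y : ℝ} (hy : 0 ≤ y) :
    BddAbove (Set.range fun t : Set.Ici (0 : ℝ) => y * (t : ℝ) - σ (Real.exp t)) := by
  obtain ⟨T, hT⟩ := eventually_atTop.1
    (Real.tendsto_exp_atTop.eventually (hσ.gamma.bound (c := 1 / (y + 1)) (by positivity)))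
  refine ⟨y * |T|, ?_⟩
  rintro _ ⟨⟨t, ht : 0 ≤ t⟩, rfl⟩
  have hσt := hσ.nonneg (Real.exp t) (Real.exp_pos t).le
  rcases le_total T t with hTt | htT
  · have h := hT t hTt
    rw [Real.log_exp, Real.norm_of_nonneg ht, Real.norm_of_nonneg hσt, one_div_mul_eq_div,
      le_div_iff₀ (by positivity)] at h
    have : 0 ≤ y * |T| := by positivity
    simp only
    linarith
  · have := mul_le_mul_of_nonneg_left (htT.trans (le_abs_self T)) hy
    simp only
    linarith

theorem IsWeight.le_youngConj (hσ : IsWeight σ) {y t : ℝ} (hy : 0 ≤ y) (ht : 0 ≤ t) :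
    y * t - σ (Real.exp t) ≤ youngConj σ y :=
  le_ciSup (hσ.bddAbove_youngConj hy) ⟨t, ht⟩

theorem youngConj_le {y B : ℝ} (h : ∀ t, 0 ≤ t → y * t - σ (Real.exp t) ≤ B) :
    youngConj σ y ≤ B :=
  ciSup_le fun t => h t t.2

theorem mul_youngConj_div {μ : ℝ} (hμ : 0 < μ) (y : ℝ) :
    μ * youngConj σ (y / μ) = youngConj (fun t => μ * σ t) y := by
  rw [youngConj, Real.mul_iSup_of_nonneg hμ.le]
  refine iSup_congr fun t => ?_
  field_simp

theorem IsWeight.youngConj_add_le (hσ : IsWeight σ) {a b : ℝ} (ha : 0 ≤ a) (hb : 0 ≤ b) :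
    youngConj σ a + youngConj σ b ≤ youngConj σ (a + b) := by
  rw [← le_sub_iff_add_le]
  refine youngConj_le fun t ht => le_sub_comm.1 (youngConj_le fun t' ht' => ?_)
  have hσt := hσ.nonneg (Real.exp t) (Real.exp_pos t).le
  have hσt' := hσ.nonneg (Real.exp t') (Real.exp_pos t').le
  rcases le_total t t' with h | h
  · have := hσ.le_youngConj (add_nonneg ha hb) ht'
    have := mul_le_mul_of_nonneg_left h ha
    linarith
  · have := hσ.le_youngConj (add_nonneg ha hb) ht
    have := mul_le_mul_of_nonneg_left h hb
    linarith

theorem IsWeight.exists_youngConj_add_mul_le (hσ : IsWeight σ) {c : ℝ} (hc : 0 ≤ c) :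
    ∃ L : ℕ, 0 < L ∧ ∀ μ y : ℝ, 0 < μ → 0 ≤ y →
      youngConj (fun t => μ * σ t) y + c * y ≤ youngConj (fun t => μ / L * σ t) y + μ := by
  obtain ⟨L, hL, hLσ⟩ := hσ.exists_nat_comp_mul_le (Real.exp_pos c).le
  refine ⟨L, hL, fun μ y hμ hy => le_sub_iff_add_le.1 (youngConj_le fun t ht => ?_)⟩
  have hL0 : (0 : ℝ) < L := Nat.cast_pos.2 hL
  have hshift : μ / L * σ (Real.exp (t + c)) ≤ μ * (σ (Real.exp t) + 1) :=
    calc μ / L * σ (Real.exp (t + c)) ≤ μ / L * (L * (σ (Real.exp t) + 1)) := by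
          rw [add_comm t, Real.exp_add]
          gcongr
          exact hLσ _ (Real.exp_pos t).le
      _ = μ * (σ (Real.exp t) + 1) := by rw [← mul_assoc, div_mul_cancel₀ _ hL0.ne']
  have := (hσ.const_mul (div_pos hμ hL0)).le_youngConj hy (add_nonneg ht hc)
  linarith

theorem IsWeight.rpow_mul_exp_youngConj_le (hτ : IsWeight τ) {m γ A k l : ℝ} (hm : 0 < m)
    (hγ : 0 < γ) (hA : ∀ t, 0 ≤ t → τ t ≤ t ^ (m / γ) + A) (hl : 0 ≤ l) (hlk : l ≤ k) :
    k ^ (γ * (k - l)) * Real.exp (youngConj τ (l * m)) ≤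
      Real.exp (youngConj τ (k * m) + k + 1 + A) := by
  have hk : 0 ≤ k := hl.trans hlk
  have : 0 ≤ k - l := sub_nonneg.2 hlk
  set x := max k 1
  have hx : 0 < x := one_pos.trans_le (le_max_right k 1)
  have hlog : 0 ≤ γ / m * Real.log x :=
    mul_nonneg (by positivity) (Real.log_nonneg (le_max_right k 1))
  have hτx : τ (Real.exp (γ / m * Real.log x)) ≤ k + 1 + A := by
    refine (hA _ (Real.exp_pos _).le).trans ?_
    rw [← Real.exp_mul, mul_right_comm, div_mul_div_cancel₀ hm.ne', div_self hγ.ne', one_mul,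
      Real.exp_log hx]
    have : x ≤ k + 1 := max_le (by linarith) (by linarith)
    linarith
  have hconj := hτ.le_youngConj (y := (k - l) * m) (by positivity) hlog
  have hadd := hτ.youngConj_add_le (a := (k - l) * m) (b := l * m) (by positivity) (by positivity)
  rw [← add_mul, sub_add_cancel] at hadd
  calc k ^ (γ * (k - l)) * Real.exp (youngConj τ (l * m))
      ≤ x ^ (γ * (k - l)) * Real.exp (youngConj τ (l * m)) := by
        gcongr
        exact le_max_left k 1
    _ = Real.exp ((k - l) * m * (γ / m * Real.log x) + youngConj τ (l * m)) := by
        rw [Real.rpow_def_of_pos hx, ← Real.exp_add]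
        field_simp
    _ ≤ _ := Real.exp_le_exp.2 (by linarith)

theorem IsWeight.exists_pow_mul_rpow_mul_exp_le (hσ : IsWeight σ) {m γ : ℝ} (hm : 0 < m)
    (hγ : 0 < γ) (hσm : σ =o[atTop] fun t => t ^ (m / γ)) {C : ℝ} (hC : 0 ≤ C) :
    ∃ L : ℕ, 0 < L ∧ ∀ μ : ℝ, 0 < μ → ∃ B, ∀ k l : ℝ, 0 ≤ l → l ≤ k →
      C ^ k * k ^ (γ * (k - l)) * Real.exp (youngConj (fun t => μ * σ t) (l * m)) ≤
        B * Real.exp (youngConj (fun t => μ / L * σ t) (k * m)) := by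
  set c := Real.log (max C 1)
  have hc : 0 ≤ c := Real.log_nonneg (le_max_right C 1)
  obtain ⟨L, hL, hLσ⟩ := hσ.exists_youngConj_add_mul_le (c := (c + 1) / m) (by positivity)
  refine ⟨L, hL, fun μ hμ => ?_⟩
  obtain ⟨A, hA⟩ := hσ.exists_le_mul_rpow_add hσm (inv_pos.2 hμ)
  refine ⟨Real.exp (μ + 1 + μ * A), fun k l hl hlk => ?_⟩
  have hk : 0 ≤ k := hl.trans hlk
  have hμA (t : ℝ) (ht : 0 ≤ t) : μ * σ t ≤ t ^ (m / γ) + μ * A :=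
    (mul_le_mul_of_nonneg_left (hA t ht) hμ.le).trans_eq (by field_simp)
  have hCk : C ^ k ≤ Real.exp (c * k) := by
    rw [Real.exp_mul, Real.exp_log (one_pos.trans_le (le_max_right C 1))]
    exact Real.rpow_le_rpow hC (le_max_left C 1) hk
  have hL' := hLσ μ (k * m) hμ (by positivity)
  rw [show (c + 1) / m * (k * m) = (c + 1) * k by field_simp] at hL'
  calc C ^ k * k ^ (γ * (k - l)) * Real.exp (youngConj (fun t => μ * σ t) (l * m))
      ≤ Real.exp (c * k) * Real.exp (youngConj (fun t => μ * σ t) (k * m) + k + 1 + μ * A) := by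
        rw [mul_assoc]
        gcongr
        exact (hσ.const_mul hμ).rpow_mul_exp_youngConj_le hm hγ hμA hl hlk
    _ ≤ Real.exp (μ + 1 + μ * A) * Real.exp (youngConj (fun t => μ / L * σ t) (k * m)) := by
        rw [← Real.exp_add, ← Real.exp_add]
        exact Real.exp_le_exp.2 (by linarith)

end YoungConj

section NonQuasianalytic

variable {ω : ℝ → ℝ}

theorem IsNQWeight.isWeight (hω : IsNQWeight ω) : IsWeight ω :=
  ⟨hω.nonneg, hω.monotoneOn, hω.alpha, hω.gamma⟩

theorem IsNQWeight.div_le_integral (hω : IsNQWeight ω) {t : ℝ} (ht : 1 ≤ t) :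
    ω t / t ≤ 4 * ∫ x in t..2 * t, ω x / x ^ 2 := by
  have ht0 : 0 < t := one_pos.trans_le ht
  have hinteg : IntervalIntegrable (fun x => ω x / x ^ 2) volume t (2 * t) :=
    intervalIntegrable_iff.2 (hω.beta.mono_set fun x hx =>
      ht.trans_lt ((le_min le_rfl (by linarith)).trans_lt hx.1))
  have hle : ∀ x ∈ Set.Icc t (2 * t), ω t / (2 * t) ^ 2 ≤ ω x / x ^ 2 := fun x hx =>
    div_le_div₀ (hω.nonneg x (ht0.le.trans hx.1))
      (hω.monotoneOn ht0.le (ht0.le.trans hx.1) hx.1) (pow_pos (ht0.trans_le hx.1) 2)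
      (pow_le_pow_left₀ (ht0.le.trans hx.1) hx.2 2)
  calc ω t / t = 4 * ∫ _ in t..2 * t, ω t / (2 * t) ^ 2 := by
        rw [intervalIntegral.integral_const, smul_eq_mul]
        field_simp
        ring
    _ ≤ 4 * ∫ x in t..2 * t, ω x / x ^ 2 := by
        gcongr
        exact intervalIntegral.integral_mono_on (by linarith) (by simp) hinteg hle

theorem tendsto_integral_two_mul {E : Type*} [NormedAddCommGroup E] [NormedSpace ℝ E] {f : ℝ → E}
    {a : ℝ} (hf : IntegrableOn f (Set.Ioi a)) :
    Tendsto (fun t => ∫ x in t..2 * t, f x) atTop (𝓝 0) := by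
  have h := (intervalIntegral_tendsto_integral_Ioi a hf
    (tendsto_id.const_mul_atTop (r := (2 : ℝ)) two_pos)).sub
      (intervalIntegral_tendsto_integral_Ioi a hf tendsto_id)
  rw [sub_self] at h
  refine h.congr' ?_
  have hii {b : ℝ} (hb : a ≤ b) : IntervalIntegrable f volume a b :=
    (intervalIntegrable_iff_integrableOn_Ioc_of_le hb).2 (hf.mono_set Set.Ioc_subset_Ioi_self)
  filter_upwards [eventually_ge_atTop a, eventually_ge_atTop 0] with t ha h0
  exact intervalIntegral.integral_interval_sub_left (hii (by simp only [id]; linarith)) (hii ha)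

theorem IsNQWeight.isLittleO_id (hω : IsNQWeight ω) : ω =o[atTop] fun t => t := by
  refine (isLittleO_iff_tendsto' ?_).2 ?_
  · filter_upwards [eventually_gt_atTop 0] with t ht h0 using absurd h0 ht.ne'
  · have h := (tendsto_integral_two_mul hω.beta).const_mul 4
    rw [mul_zero] at h
    refine squeeze_zero' ?_ ?_ h
    · filter_upwards [eventually_ge_atTop 0] with t ht using div_nonneg (hω.nonneg t ht) ht
    · filter_upwards [eventually_ge_atTop 1] with t ht using hω.div_le_integral ht

theorem IsNQWeight.isLittleO_comp_rpow (hω : IsNQWeight ω) {a b : ℝ} (ha : 0 < a) (hab : a ≤ b) :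
    (fun t => ω (t ^ a)) =o[atTop] fun t => t ^ b := by
  refine (hω.isLittleO_id.comp_tendsto (tendsto_rpow_atTop ha)).trans_isBigO ?_
  refine IsBigO.of_bound 1 ?_
  filter_upwards [eventually_ge_atTop 1] with t ht
  rw [one_mul, Function.comp_apply, Real.norm_of_nonneg (by positivity),
    Real.norm_of_nonneg (by positivity)]
  exact Real.rpow_le_rpow_of_exponent_le ht hab

end NonQuasianalytic

section Operators

open MvPolynomial
open scoped ContDiff

open scoped IsMulCommutative in
/-- The evaluation of polynomials at pairwise commuting elements of a noncommutative algebra. -/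
def commAeval {R ι A : Type*} [CommRing R] [Ring A] [Algebra R A] (d : ι → A)
    (hd : ∀ i j, Commute (d i) (d j)) : MvPolynomial ι R →ₐ[R] A :=
  have : IsMulCommutative (Algebra.adjoin R (Set.range d)) :=
    Algebra.isMulCommutative_adjoin R (by
      rintro _ ⟨i, rfl⟩ _ ⟨j, rfl⟩
      exact hd i j)
  (Algebra.adjoin R (Set.range d)).val.comp
    (aeval fun j => ⟨d j, Algebra.subset_adjoin (Set.mem_range_self j)⟩)

theorem commAeval_X {R ι A : Type*} [CommRing R] [Ring A] [Algebra R A] (d : ι → A)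
    (hd : ∀ i j, Commute (d i) (d j)) (j : ι) : commAeval (R := R) d hd (X j) = d j := by
  simp [commAeval]

theorem iterComp_rel {k : ℕ} {X Y : Type*} (r : X → Y → Prop) {f : Fin k → X → X}
    {g : Fin k → Y → Y} (h : ∀ j x y, r x y → r (f j x) (g j y)) (e : Fin k → ℕ) {x : X} {y : Y}
    (hxy : r x y) : r (iterComp f e x) (iterComp g e y) := by
  have hiterate (j : Fin k) (i : ℕ) : ∀ x y, r x y → r ((f j)^[i] x) ((g j)^[i] y) := by
    induction i with
    | zero => exact fun _ _ h => h
    | succ _ ih => exact fun x y hxy => ih _ _ (h j x y hxy)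
  rw [iterComp, iterComp, List.ofFn_eq_map, List.ofFn_eq_map]
  induction List.finRange k with
  | nil => exact hxy
  | cons j l ih => exact hiterate j _ _ _ ih

theorem iterComp_eq_prod_pow {k : ℕ} {A X : Type*} [CommMonoid A] (φ : A → X → X)
    (hone : φ 1 = id) (hmul : ∀ a b, φ (a * b) = φ a ∘ φ b) (a : Fin k → A) (e : Fin k → ℕ) :
    iterComp (fun j => φ (a j)) e = φ (∏ j, a j ^ e j) := by
  have hpow (a : A) (i : ℕ) : (φ a)^[i] = φ (a ^ i) := by
    induction i with
    | zero => rw [Function.iterate_zero, pow_zero, hone]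
    | succ i ih => rw [Function.iterate_succ, ih, pow_succ, hmul]
  rw [iterComp, ← List.prod_ofFn, List.ofFn_eq_map, List.ofFn_eq_map]
  induction List.finRange k with
  | nil => exact hone.symm
  | cons j l ih =>
    rw [List.map_cons, List.foldr_cons, ih, hpow, List.map_cons, List.prod_cons, hmul]

/-- The algebra of smooth complex-valued functions on `ℝⁿ`, on which the operators `p(D)` act as
endomorphisms. -/
def smoothFun (n : ℕ) : Subalgebra ℂ (EuclideanSpace ℝ (Fin n) → ℂ) where
  carrier := {u | ContDiff ℝ ∞ u}
  add_mem' hu hv := by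
    rw [Set.mem_ofPred_eq] at hu hv ⊢
    exact hu.add hv
  mul_mem' hu hv := by
    rw [Set.mem_ofPred_eq] at hu hv ⊢
    exact hu.mul hv
  algebraMap_mem' _ := by
    rw [Set.mem_ofPred_eq]
    exact contDiff_const

variable {n : ℕ}

theorem contDiff_coe (u : smoothFun n) : ContDiff ℝ ∞ u.1 := u.2

theorem differentiable_coe (u : smoothFun n) : Differentiable ℝ u.1 :=
  (contDiff_coe u).differentiable (by simp)

theorem continuous_coe (u : smoothFun n) : Continuous u.1 := (contDiff_coe u).continuous

theorem contDiff_D {u : EuclideanSpace ℝ (Fin n) → ℂ} (hu : ContDiff ℝ ∞ u) (j : Fin n) :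
    ContDiff ℝ ∞ (D j u) :=
  contDiff_const.mul ((hu.fderiv_right (by simp)).clm_apply contDiff_const)

theorem D_D_apply {u : EuclideanSpace ℝ (Fin n) → ℂ} (hu : ContDiff ℝ ∞ u) (i j : Fin n)
    (x : EuclideanSpace ℝ (Fin n)) :
    D i (D j u) x =
      -fderiv ℝ (fderiv ℝ u) x (EuclideanSpace.single i 1) (EuclideanSpace.single j 1) := by
  have hdiff : DifferentiableAt ℝ (fderiv ℝ u) x :=
    ((hu.fderiv_right (m := ∞) (by simp)).differentiable (by simp)) x
  unfold D
  rw [fderiv_const_mul (hdiff.clm_apply (differentiableAt_const _)),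
    fderiv_clm_apply hdiff (differentiableAt_const _), fderiv_fun_const]
  simp [← mul_assoc]

/-- The derivation `D_j` of the algebra of smooth functions. -/
def dOp (j : Fin n) : Derivation ℂ (smoothFun n) (smoothFun n) where
  toFun u := ⟨D j u.1, contDiff_D (contDiff_coe u) j⟩
  map_add' u v := by
    ext x
    change D j (u.1 + v.1) x = D j u.1 x + D j v.1 x
    simp only [D]
    rw [fderiv_add (differentiable_coe u x) (differentiable_coe v x), add_apply, mul_add]
  map_smul' c u := by
    ext x
    change D j (c • u.1) x = c * D j u.1 x
    simp only [D]
    rw [fderiv_const_smul (differentiable_coe u x), smul_apply, smul_eq_mul]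
    ring
  map_one_eq_zero' := by
    ext x
    change D j 1 x = 0
    simp [D]
  leibniz' u v := by
    ext x
    change D j (u.1 * v.1) x = u.1 x * D j v.1 x + v.1 x * D j u.1 x
    simp only [D]
    rw [fderiv_mul (differentiable_coe u x) (differentiable_coe v x), add_apply, smul_apply,
      smul_apply, smul_eq_mul, smul_eq_mul]
    ring

theorem dOp_comm (i j : Fin n) :
    Commute (dOp i : Module.End ℂ (smoothFun n)) (dOp j : Module.End ℂ (smoothFun n)) := by
  ext u x
  change D i (D j u.1) x = D j (D i u.1) x
  have hsymm : IsSymmSndFDerivAt ℝ u.1 x :=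
    (contDiff_coe u).contDiffAt.isSymmSndFDerivAt (by
      rw [minSmoothness_of_isRCLikeNormedField]
      exact WithTop.coe_le_coe.2 le_top)
  rw [D_D_apply (contDiff_coe u), D_D_apply (contDiff_coe u), hsymm.eq]

/-- The operator `p(D)` on smooth functions, as a homomorphism in the symbol `p`. It agrees with
`polyOp p`. -/
def opHom (n : ℕ) : MvPolynomial (Fin n) ℂ →ₐ[ℂ] Module.End ℂ (smoothFun n) :=
  commAeval (fun j => (dOp j : Module.End ℂ (smoothFun n))) dOp_comm

theorem opHom_X (j : Fin n) (u : smoothFun n) : opHom n (X j) u = dOp j u :=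
  LinearMap.congr_fun (commAeval_X _ dOp_comm j) u

theorem opHom_C (a : ℂ) (u : smoothFun n) : opHom n (C a) u = a • u :=
  LinearMap.congr_fun ((opHom n).commutes a) u

theorem opHom_mul (p q : MvPolynomial (Fin n) ℂ) (u : smoothFun n) :
    opHom n (p * q) u = opHom n p (opHom n q u) := by
  rw [map_mul, Module.End.mul_apply]

theorem iterComp_opHom {k : ℕ} (p : Fin k → MvPolynomial (Fin n) ℂ) (e : Fin k → ℕ)
    (u : smoothFun n) :
    iterComp (fun j v => opHom n (p j) v) e u = opHom n (∏ j, p j ^ e j) u :=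
  congrFun (iterComp_eq_prod_pow (fun p => ⇑(opHom n p)) (by simp; rfl)
    (fun p q => funext (opHom_mul p q)) p e) u

theorem polyOp_eq_opHom (p : MvPolynomial (Fin n) ℂ) (u : smoothFun n) :
    polyOp p u.1 = opHom n p u := by
  have hmonomial (α : Fin n →₀ ℕ) :
      iterComp D (fun j => α j) u.1 = (opHom n (∏ j, X j ^ α j) u).1 := by
    rw [← iterComp_opHom]
    exact iterComp_rel (fun v (w : smoothFun n) => v = w.1)
      (fun j v w h => by rw [h, opHom_X]; rfl) _ rfl
  have hsum : opHom n p u = ∑ α ∈ p.support, p.coeff α • opHom n (∏ j, X j ^ α j) u := by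
    conv_lhs => rw [p.as_sum, map_sum, LinearMap.sum_apply]
    refine Finset.sum_congr rfl fun α _ => ?_
    rw [monomial_eq, opHom_mul, opHom_C, Finsupp.prod_fintype _ _ fun _ => pow_zero _]
  funext x
  rw [hsum, AddSubmonoidClass.coe_finsetSum, Finset.sum_apply]
  simp only [polyOp, hmonomial]
  rfl

theorem sysIter_eq_opHom {N : ℕ} (P : Fin N → MvPolynomial (Fin n) ℂ) (β : Fin N → ℕ)
    (u : smoothFun n) : sysIter P β u.1 = opHom n (∏ j, P j ^ β j) u := by
  rw [← iterComp_opHom]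
  exact iterComp_rel (fun v (w : smoothFun n) => v = w.1)
    (fun j v w h => by rw [h, polyOp_eq_opHom]) _ rfl

theorem opHom_leibniz (p : MvPolynomial (Fin n) ℂ) (χ v : smoothFun n) :
    opHom n p (χ * v) = ∑ α ∈ (taylorShift p).support,
      opHom n (monomial α 1) χ * opHom n (hasse α p) v := by
  refine eq_sum_hasse_of_map_mul_X
    (fun α => (LinearMap.mulLeft ℂ (opHom n (monomial α 1) χ)).comp
      ((LinearMap.applyₗ v).comp (opHom n).toLinearMap))
    ((LinearMap.applyₗ (χ * v)).comp (opHom n).toLinearMap)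
    (fun i => (dOp i : Module.End ℂ (smoothFun n))) ?_ ?_ ?_ p
  · intro i p
    change opHom n (p * X i) _ = dOp i (opHom n p _)
    rw [mul_comm, opHom_mul, opHom_X]
  · change opHom n 1 (χ * v) = opHom n 1 χ * opHom n 1 v
    simp only [map_one, Module.End.one_apply]
  · intro α i p
    change dOp i (opHom n (monomial α 1) χ * opHom n p v) =
      opHom n (monomial (α + Finsupp.single i 1 : Fin n →₀ ℕ) 1) χ * opHom n p v +
        opHom n (monomial α 1) χ * opHom n (X i * p) v
    rw [monomial_add_single, pow_one, mul_comm (monomial α 1), opHom_mul, opHom_mul, opHom_X,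
      opHom_X, Derivation.leibniz, smul_eq_mul, smul_eq_mul]
    ring

section Locality

variable {U : Set (EuclideanSpace ℝ (Fin n))}

theorem D_eqOn (hU : IsOpen U) {u v : EuclideanSpace ℝ (Fin n) → ℂ} (h : Set.EqOn u v U)
    (j : Fin n) : Set.EqOn (D j u) (D j v) U := fun x hx => by
  rw [D, D, (h.eventuallyEq_of_mem (hU.mem_nhds hx)).fderiv_eq]

theorem polyOp_eqOn (hU : IsOpen U) {u v : EuclideanSpace ℝ (Fin n) → ℂ} (h : Set.EqOn u v U)
    (p : MvPolynomial (Fin n) ℂ) : Set.EqOn (polyOp p u) (polyOp p v) U := fun _ hx =>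
  Finset.sum_congr rfl fun _ _ => congrArg _
    (iterComp_rel (fun u v => Set.EqOn u v U) (fun j _ _ h => D_eqOn hU h j) _ h hx)

theorem sysIter_eqOn (hU : IsOpen U) {u v : EuclideanSpace ℝ (Fin n) → ℂ} (h : Set.EqOn u v U)
    {N : ℕ} (P : Fin N → MvPolynomial (Fin n) ℂ) (β : Fin N → ℕ) :
    Set.EqOn (sysIter P β u) (sysIter P β v) U :=
  iterComp_rel (fun u v => Set.EqOn u v U) (fun j _ _ h => polyOp_eqOn hU h (P j)) _ h

theorem opHom_eqOn (hU : IsOpen U) {u v : smoothFun n} (h : Set.EqOn u.1 v.1 U)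
    (p : MvPolynomial (Fin n) ℂ) : Set.EqOn (opHom n p u).1 (opHom n p v).1 U := by
  rw [← polyOp_eq_opHom, ← polyOp_eq_opHom]
  exact polyOp_eqOn hU h p

theorem support_opHom_subset {A : Set (EuclideanSpace ℝ (Fin n))} (hA : IsClosed A)
    {u : smoothFun n} (hu : Function.support u.1 ⊆ A) (p : MvPolynomial (Fin n) ℂ) :
    Function.support (opHom n p u).1 ⊆ A := by
  intro x hx
  by_contra hxA
  refine hx ?_
  rw [opHom_eqOn hA.isOpen_compl (v := 0) (fun y hy => Function.notMem_support.1 (mt (@hu y) hy))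
    p hxA, map_zero]
  rfl

theorem hasCompactSupport_opHom {u : smoothFun n} (hu : HasCompactSupport u.1)
    (p : MvPolynomial (Fin n) ℂ) : HasCompactSupport (opHom n p u).1 :=
  HasCompactSupport.of_support_subset_isCompact hu
    (support_opHom_subset (isClosed_tsupport _) (subset_tsupport _) p)

end Locality

end Operators

section Cutoffs

open MvPolynomial
open scoped Convolution ContDiff

variable {n : ℕ}

/-- The convolution of a locally integrable function with a test function, as a smooth function. -/
def convFun {f : EuclideanSpace ℝ (Fin n) → ℂ} (hf : LocallyIntegrable f) {g : smoothFun n}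
    (hg : HasCompactSupport g.1) : smoothFun n :=
  ⟨f ⋆[ContinuousLinearMap.mul ℝ ℂ] g.1,
    hg.contDiff_convolution_right _ hf (contDiff_coe g)⟩

section ConvFun

variable {f : EuclideanSpace ℝ (Fin n) → ℂ} (hf : LocallyIntegrable f) {g : smoothFun n}
  (hg : HasCompactSupport g.1)

theorem convFun_apply (x : EuclideanSpace ℝ (Fin n)) :
    (convFun hf hg).1 x = ∫ y, f y * g.1 (x - y) := rfl

include hg in
theorem hasCompactSupport_dOp (i : Fin n) : HasCompactSupport (dOp i g).1 :=
  opHom_X i g ▸ hasCompactSupport_opHom hg (X i)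

theorem dOp_convFun (i : Fin n) :
    dOp i (convFun hf hg) = convFun hf (hasCompactSupport_dOp hg i) := by
  ext x
  have hg1 : ContDiff ℝ 1 g.1 := (contDiff_coe g).of_le (WithTop.coe_le_coe.2 le_top)
  have hderiv := hg.hasFDerivAt_convolution_right (ContinuousLinearMap.mul ℝ ℂ) hf hg1 x
  rw [convFun_apply]
  change -Complex.I * fderiv ℝ (f ⋆[ContinuousLinearMap.mul ℝ ℂ] g.1) x _ =
    ∫ y, f y * (-Complex.I * fderiv ℝ g.1 (x - y) _)
  rw [hderiv.fderiv, convolution_precompR_apply _ hf (hg.fderiv ℝ)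
    (hg1.continuous_fderiv one_ne_zero), convolution_def, ← integral_const_mul]
  refine integral_congr_ae (.of_forall fun y => ?_)
  simp only [ContinuousLinearMap.mul_apply']
  ring

theorem opHom_monomial_convFun (α : Fin n →₀ ℕ) (a : ℂ) :
    opHom n (monomial α a) (convFun hf hg) =
      convFun hf (hasCompactSupport_opHom hg (monomial α a)) := by
  refine induction_on_monomial (motive := fun p => ∀ (g : smoothFun n) (hg : HasCompactSupport g.1),
    opHom n p (convFun hf hg) = convFun hf (hasCompactSupport_opHom hg p)) ?_ ?_ α a g hg
  · intro a g hg
    ext x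
    simp only [opHom_C]
    change a * ∫ y, f y * g.1 (x - y) = ∫ y, f y * (a * g.1 (x - y))
    rw [← integral_const_mul]
    exact integral_congr_ae (.of_forall fun y => mul_left_comm _ _ _)
  · intro p i ih g hg
    simp only [opHom_mul, opHom_X]
    rw [dOp_convFun, ih]

theorem norm_opHom_monomial_convFun_le (hf1 : ∀ y, ‖f y‖ ≤ 1) (α : Fin n →₀ ℕ) (a : ℂ)
    (x : EuclideanSpace ℝ (Fin n)) :
    ‖(opHom n (monomial α a) (convFun hf hg)).1 x‖ ≤ ∫ y, ‖(opHom n (monomial α a) g).1 y‖ := by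
  have hinteg : Integrable fun y => ‖(opHom n (monomial α a) g).1 y‖ :=
    ((continuous_coe _).integrable_of_hasCompactSupport (hasCompactSupport_opHom hg _)).norm
  rw [opHom_monomial_convFun, convFun_apply,
    ← integral_sub_left_eq_self (fun y => ‖(opHom n (monomial α a) g).1 y‖) volume x]
  refine norm_integral_le_of_norm_le (hinteg.comp_sub_left x) (.of_forall fun y => ?_)
  rw [norm_mul]
  exact mul_le_of_le_one_left (norm_nonneg _) (hf1 y)

variable {r : ℝ} (hgr : Function.support g.1 ⊆ ball 0 r)
include hgr

theorem convFun_apply_eq_const_mul {x : EuclideanSpace ℝ (Fin n)} {c : ℂ}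
    (h : ∀ y ∈ ball x r, f y = c) : (convFun hf hg).1 x = c * ∫ y, g.1 y := by
  rw [convFun_apply, ← integral_sub_left_eq_self (fun y => g.1 y) volume x, ← integral_const_mul]
  refine integral_congr_ae (.of_forall fun y => ?_)
  by_cases hy : y ∈ ball x r
  · simp only [h y hy]
  · have hg0 : g.1 (x - y) = 0 := by
      by_contra hg0
      rw [mem_ball'] at hy
      exact hy (dist_eq_norm x y ▸ mem_ball_zero_iff.1 (hgr hg0))
    simp only [hg0, mul_zero]

end ConvFun

theorem exists_smoothFun_support_subset_ball (n : ℕ) {r : ℝ} (hr : 0 < r) :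
    ∃ g : smoothFun n, HasCompactSupport g.1 ∧ Function.support g.1 ⊆ ball 0 r ∧
      ∫ x, g.1 x = 1 := by
  let b : ContDiffBump (0 : EuclideanSpace ℝ (Fin n)) := ⟨r / 2, r, half_pos hr, half_lt_self hr⟩
  refine ⟨⟨fun x => (b.normed volume x : ℂ), Complex.ofRealCLM.contDiff.comp b.contDiff_normed⟩,
    b.hasCompactSupport_normed.comp_left (g := fun x : ℝ => (x : ℂ)) Complex.ofReal_zero,
    fun x hx => ?_, ?_⟩
  · rw [← b.support_normed_eq (μ := volume)]
    exact fun h => hx (by simp [h])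
  · change ∫ x, (b.normed volume x : ℂ) = 1
    rw [integral_complex_ofReal, b.integral_normed, Complex.ofReal_one]

theorem exists_cutoff_one (n : ℕ) : ∃ C : (Fin n →₀ ℕ) → ℝ, ∀ A : Set (EuclideanSpace ℝ (Fin n)),
    ∃ χ : smoothFun n, Set.EqOn χ.1 1 (thickening (1 / 4) A) ∧
      Function.support χ.1 ⊆ thickening 1 A ∧
      ∀ α x, ‖(opHom n (monomial α 1) χ).1 x‖ ≤ C α := by
  obtain ⟨g, hg, hgr, hg1⟩ := exists_smoothFun_support_subset_ball n (r := 1 / 4) (by norm_num)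
  refine ⟨fun α => ∫ x, ‖(opHom n (monomial α 1) g).1 x‖, fun A => ?_⟩
  have hf : LocallyIntegrable ((thickening (1 / 2) A).indicator fun _ => (1 : ℂ)) :=
    (locallyIntegrable_const 1).indicator isOpen_thickening.measurableSet
  have hball (x : EuclideanSpace ℝ (Fin n)) {ε : ℝ} {s : Set (EuclideanSpace ℝ (Fin n))}
      (hx : x ∈ thickening ε s) {y} (hy : y ∈ ball x (1 / 4)) : y ∈ thickening (1 / 4 + ε) s :=
    thickening_thickening_subset _ _ _ (mem_thickening_iff.2 ⟨x, hx, hy⟩)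
  refine ⟨convFun hf hg, fun x hx => ?_, fun x hx => ?_,
    fun α x => norm_opHom_monomial_convFun_le hf hg (fun y => ?_) α 1 x⟩
  · rw [convFun_apply_eq_const_mul hf hg hgr fun y hy => Set.indicator_of_mem ?_ _, hg1,
      mul_one, Pi.one_apply]
    convert hball x hx hy using 2
    norm_num
  · by_contra hxA
    refine hx ((convFun_apply_eq_const_mul hf hg hgr fun y hy =>
      Set.indicator_of_notMem (fun hyA => ?_) _).trans (zero_mul _))
    refine hxA (thickening_mono (by norm_num) A (hball y hyA (mem_ball_comm.1 hy)))
  · exact (norm_indicator_le_norm_self _ _).trans_eq norm_one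

/-- The dilation `u ↦ u (t⁻¹ ·)` of smooth functions, used to rescale cutoff functions. -/
def dilate (t : ℝ) (u : smoothFun n) : smoothFun n :=
  ⟨fun x => u.1 (t⁻¹ • x), (contDiff_coe u).comp (contDiff_id.const_smul t⁻¹)⟩

theorem dOp_dilate (t : ℝ) (i : Fin n) (u : smoothFun n) :
    dOp i (dilate t u) = ((t⁻¹ : ℝ) : ℂ) • dilate t (dOp i u) := by
  ext x
  change -Complex.I * fderiv ℝ (fun x => u.1 (t⁻¹ • x)) x _ =
    ((t⁻¹ : ℝ) : ℂ) * (-Complex.I * fderiv ℝ u.1 (t⁻¹ • x) _)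
  rw [fderiv_comp_smul, smul_apply, Complex.real_smul]
  ring

theorem opHom_monomial_dilate (t : ℝ) (u : smoothFun n) (α : Fin n →₀ ℕ) :
    opHom n (monomial α 1) (dilate t u) =
      ((t⁻¹ ^ α.degree : ℝ) : ℂ) • dilate t (opHom n (monomial α 1) u) := by
  have hdegree : (monomial α (1 : ℂ)).totalDegree = α.degree :=
    totalDegree_monomial α one_ne_zero
  rw [← hdegree]
  refine induction_on_monomial (motive := fun p => ∀ u : smoothFun n, opHom n p (dilate t u) =
    ((t⁻¹ ^ p.totalDegree : ℝ) : ℂ) • dilate t (opHom n p u)) ?_ ?_ α 1 u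
  · intro a u
    rw [opHom_C, opHom_C, totalDegree_C, pow_zero, Complex.ofReal_one, one_smul]
    rfl
  · intro p i ih u
    rcases eq_or_ne p 0 with rfl | hp
    · simp only [zero_mul, map_zero, LinearMap.zero_apply, totalDegree_zero, pow_zero,
        Complex.ofReal_one, one_smul]
      rfl
    · rw [opHom_mul, opHom_mul, opHom_X, opHom_X, dOp_dilate, map_smul, ih, smul_smul,
        totalDegree_mul_of_isDomain hp (X_ne_zero i), totalDegree_X, pow_succ', Complex.ofReal_mul]

theorem exists_cutoff (n : ℕ) : ∃ C : (Fin n →₀ ℕ) → ℝ, (∀ α, 0 ≤ C α) ∧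
    ∀ (A : Set (EuclideanSpace ℝ (Fin n))) (t : ℝ), 0 < t →
    ∃ χ : smoothFun n, Set.EqOn χ.1 1 (thickening (t / 4) A) ∧
      Function.support χ.1 ⊆ thickening t A ∧
      ∀ α x, ‖(opHom n (monomial α 1) χ).1 x‖ ≤ C α * t⁻¹ ^ α.degree := by
  obtain ⟨C, hC⟩ := exists_cutoff_one n
  have hC0 (α) : 0 ≤ C α := by
    obtain ⟨χ, -, -, hχ⟩ := hC ∅
    exact (norm_nonneg _).trans (hχ α 0)
  refine ⟨C, hC0, fun A t ht => ?_⟩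
  obtain ⟨χ, hone, hsupp, hbound⟩ := hC ((fun x => t⁻¹ • x) '' A)
  have hdist (x y : EuclideanSpace ℝ (Fin n)) : dist (t⁻¹ • x) (t⁻¹ • y) = t⁻¹ * dist x y := by
    rw [dist_smul₀, Real.norm_of_nonneg (inv_nonneg.2 ht.le)]
  refine ⟨dilate t χ, fun x hx => hone (x := t⁻¹ • x) ?_, fun x hx => ?_, fun α x => ?_⟩
  · obtain ⟨a, ha, hxa⟩ := mem_thickening_iff.1 hx
    refine mem_thickening_iff.2 ⟨_, ⟨a, ha, rfl⟩, ?_⟩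
    rwa [hdist, inv_mul_lt_iff₀ ht, mul_one_div]
  · obtain ⟨_, ⟨a, ha, rfl⟩, hxa⟩ := mem_thickening_iff.1 (hsupp (a := t⁻¹ • x) hx)
    refine mem_thickening_iff.2 ⟨a, ha, ?_⟩
    rwa [hdist, inv_mul_lt_iff₀ ht, mul_one] at hxa
  · rw [opHom_monomial_dilate]
    change ‖((t⁻¹ ^ α.degree : ℝ) : ℂ) * (opHom n (monomial α 1) χ).1 (t⁻¹ • x)‖ ≤ _
    rw [norm_mul, Complex.norm_real, Real.norm_of_nonneg (by positivity), mul_comm]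
    exact mul_le_mul_of_nonneg_right (hbound _ _) (by positivity)

theorem exists_smoothFun_eqOn {Ω K : Set (EuclideanSpace ℝ (Fin n))} (hΩ : IsOpen Ω)
    (hK : IsCompact K) (hKΩ : K ⊆ Ω) {u : EuclideanSpace ℝ (Fin n) → ℂ}
    (hu : ContDiffOn ℝ ∞ u Ω) :
    ∃ (U : Set (EuclideanSpace ℝ (Fin n))) (v : smoothFun n), IsOpen U ∧ K ⊆ U ∧
      Set.EqOn u v.1 U := by
  obtain ⟨δ, hδ, hKδ⟩ := hK.exists_cthickening_subset_open hΩ hKΩ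
  obtain ⟨C, -, hC⟩ := exists_cutoff n
  obtain ⟨χ, hone, hsupp, -⟩ := hC K δ hδ
  have hsmooth : ContDiff ℝ ∞ fun x => χ.1 x * u x := by
    refine contDiff_iff_contDiffAt.2 fun x => ?_
    by_cases hx : x ∈ Ω
    · exact (contDiff_coe χ).contDiffAt.mul (hu.contDiffAt (hΩ.mem_nhds hx))
    · refine (contDiffAt_const (c := (0 : ℂ))).congr_of_eventuallyEq ?_
      filter_upwards [isClosed_cthickening.isOpen_compl.mem_nhds fun h => hx (hKδ h)] with y hy
      rw [Function.notMem_support.1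
        (mt (fun h => thickening_subset_cthickening _ _ (hsupp h)) hy), zero_mul]
  refine ⟨thickening (δ / 4) K, ⟨_, hsmooth⟩, isOpen_thickening,
    self_subset_thickening (by positivity) K, fun x hx => ?_⟩
  change u x = χ.1 x * u x
  rw [hone hx, Pi.one_apply, one_mul]

end Cutoffs

section LTwo

open MvPolynomial

variable {n : ℕ} {A B : Set (EuclideanSpace ℝ (Fin n))}

/-- The `L²` norm over a set, as a real number; it is `0` by convention if the norm is infinite. -/
def l2 (A : Set (EuclideanSpace ℝ (Fin n))) (f : EuclideanSpace ℝ (Fin n) → ℂ) : ℝ :=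
  (eLpNorm f 2 (volume.restrict A)).toReal

theorem l2_nonneg (A : Set (EuclideanSpace ℝ (Fin n))) (f : EuclideanSpace ℝ (Fin n) → ℂ) :
    0 ≤ l2 A f := ENNReal.toReal_nonneg

theorem l2_le_sum {ι : Type*} (s : Finset ι) {f : EuclideanSpace ℝ (Fin n) → ℂ}
    {g : ι → EuclideanSpace ℝ (Fin n) → ℂ} {c : ι → ℝ} (hc : ∀ i ∈ s, 0 ≤ c i)
    (hg : ∀ i ∈ s, MemLp (g i) 2 (volume.restrict A))
    (h : ∀ x, ‖f x‖ ≤ ∑ i ∈ s, c i * ‖g i x‖) : l2 A f ≤ ∑ i ∈ s, c i * l2 A (g i) := by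
  have hfin : ∀ i ∈ s, ENNReal.ofReal (c i) * eLpNorm (g i) 2 (volume.restrict A) ≠ ⊤ :=
    fun i hi => ENNReal.mul_ne_top ENNReal.ofReal_ne_top (hg i hi).2.ne
  have hle : eLpNorm f 2 (volume.restrict A) ≤
      ∑ i ∈ s, ENNReal.ofReal (c i) * eLpNorm (g i) 2 (volume.restrict A) := calc
    _ ≤ eLpNorm (∑ i ∈ s, fun x => c i * ‖g i x‖) 2 (volume.restrict A) :=
      eLpNorm_mono_real fun x => by rw [Finset.sum_apply]; exact h x
    _ ≤ ∑ i ∈ s, eLpNorm (fun x => c i * ‖g i x‖) 2 (volume.restrict A) :=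
      eLpNorm_sum_le (fun i hi => (hg i hi).1.norm.const_mul _) one_le_two
    _ ≤ _ := Finset.sum_le_sum fun i hi => eLpNorm_le_mul_eLpNorm_of_ae_le_mul
      (.of_forall fun x => by rw [norm_mul, norm_norm, Real.norm_of_nonneg (hc i hi)]) 2
  refine (ENNReal.toReal_mono (ENNReal.sum_ne_top.2 hfin) hle).trans_eq ?_
  rw [ENNReal.toReal_sum hfin]
  exact Finset.sum_congr rfl fun i hi => by
    rw [ENNReal.toReal_mul, ENNReal.toReal_ofReal (hc i hi), l2]

theorem memLp_restrict (u : smoothFun n) (hA : IsCompact A) : MemLp u.1 2 (volume.restrict A) := by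
  have : Fact (volume A < ⊤) := ⟨hA.measure_lt_top⟩
  obtain ⟨C, hC⟩ := hA.exists_bound_of_continuousOn (continuous_coe u).continuousOn
  exact MemLp.of_bound (continuous_coe u).aestronglyMeasurable C
    (ae_restrict_of_forall_mem hA.measurableSet hC)

theorem l2_mono (u : smoothFun n) (hB : IsCompact B) (h : A ⊆ B) : l2 A u.1 ≤ l2 B u.1 :=
  ENNReal.toReal_mono (memLp_restrict u hB).2.ne
    (eLpNorm_mono_measure _ (Measure.restrict_mono h le_rfl))

theorem l2_univ_eq {f : EuclideanSpace ℝ (Fin n) → ℂ} (h : Function.support f ⊆ A) :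
    l2 Set.univ f = l2 A f := by
  rw [l2, l2, Measure.restrict_univ, eLpNorm_restrict_eq_of_support_subset h]

theorem l2_congr {f g : EuclideanSpace ℝ (Fin n) → ℂ} (hA : MeasurableSet A)
    (h : Set.EqOn f g A) : l2 A f = l2 A g := by
  rw [l2, l2, eLpNorm_congr_ae (ae_restrict_of_forall_mem hA h)]

end LTwo

section Fourier

open MvPolynomial
open scoped FourierTransform

variable {n : ℕ} {u : smoothFun n}

/-- A test function as a Schwartz function, through which it inherits the Plancherel formula. -/
def toSchwartz (hu : HasCompactSupport u.1) : SchwartzMap (EuclideanSpace ℝ (Fin n)) ℂ :=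
  hu.toSchwartzMap (contDiff_coe u)

theorem fourier_toSchwartz_coe (hu : HasCompactSupport u.1) :
    ⇑(𝓕 (toSchwartz hu) : SchwartzMap (EuclideanSpace ℝ (Fin n)) ℂ) = 𝓕 u.1 :=
  SchwartzMap.fourier_coe _

theorem memLp_fourier (hu : HasCompactSupport u.1) : MemLp (𝓕 u.1) 2 :=
  fourier_toSchwartz_coe hu ▸ SchwartzMap.memLp _ _ _

theorem l2_univ_fourier (hu : HasCompactSupport u.1) : l2 Set.univ (𝓕 u.1) = l2 Set.univ u.1 := by
  have h := SchwartzMap.norm_fourier_toL2_eq (toSchwartz hu)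
  rw [SchwartzMap.norm_toLp, SchwartzMap.norm_toLp, fourier_toSchwartz_coe] at h
  rw [l2, l2, Measure.restrict_univ]
  exact h

theorem integrable_of_hasCompactSupport (hu : HasCompactSupport u.1) : Integrable u.1 :=
  (continuous_coe u).integrable_of_hasCompactSupport hu

theorem fourier_dOp (hu : HasCompactSupport u.1) (i : Fin n) (ξ : EuclideanSpace ℝ (Fin n)) :
    𝓕 (dOp i u).1 ξ = ((2 * Real.pi * ξ i : ℝ) : ℂ) * 𝓕 u.1 ξ := by
  have h2 : (fun x : EuclideanSpace ℝ (Fin n) =>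
      inner ℝ x (EuclideanSpace.single i (1 : ℝ))).HasTemperateGrowth :=
    ((innerSL ℝ).flip (EuclideanSpace.single i (1 : ℝ))).hasTemperateGrowth
  have hd : toSchwartz (hasCompactSupport_dOp hu i) = (-Complex.I) •
      LineDeriv.lineDerivOp (EuclideanSpace.single i (1 : ℝ)) (toSchwartz hu) := by
    ext x
    rw [smul_apply, SchwartzMap.lineDerivOp_apply_eq_fderiv]
    rfl
  rw [← fourier_toSchwartz_coe hu, ← fourier_toSchwartz_coe (hasCompactSupport_dOp hu i), hd,
    FourierTransform.fourier_smul, SchwartzMap.fourier_lineDerivOp_eq, smul_apply, smul_apply,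
    SchwartzMap.smulLeftCLM_apply_apply h2, EuclideanSpace.inner_single_right, smul_eq_mul,
    smul_eq_mul, Complex.real_smul, ← mul_assoc, ← mul_assoc]
  simp only [conj_trivial, one_mul, Complex.ofReal_mul, Complex.ofReal_ofNat]
  linear_combination (-2 * Real.pi * ξ i * 𝓕 (toSchwartz hu) ξ : ℂ) * Complex.I_sq

theorem fourier_opHom (p : MvPolynomial (Fin n) ℂ) (hu : HasCompactSupport u.1)
    (ξ : EuclideanSpace ℝ (Fin n)) :
    𝓕 (opHom n p u).1 ξ = symb p ((2 * Real.pi) • ξ) * 𝓕 u.1 ξ := by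
  induction p using MvPolynomial.induction_on generalizing u with
  | C a =>
    rw [opHom_C, symb, eval_C]
    exact congrFun (VectorFourier.fourierIntegral_const_smul _ _ _ u.1 a) ξ
  | add p q hp hq =>
    rw [map_add, symb, map_add, add_mul]
    change _ = symb p _ * _ + symb q _ * _
    rw [← hp hu, ← hq hu]
    exact (congrFun (VectorFourier.fourierIntegral_add Real.continuous_fourierChar
      continuous_inner (integrable_of_hasCompactSupport (hasCompactSupport_opHom hu p))
      (integrable_of_hasCompactSupport (hasCompactSupport_opHom hu q))) ξ)
  | mul_X p i hp =>
    rw [opHom_mul, opHom_X, hp (hasCompactSupport_dOp hu i), fourier_dOp hu, symb, symb, map_mul,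
      eval_X, mul_assoc (eval _ p), PiLp.smul_apply, smul_eq_mul]

theorem l2_opHom_le {ι : Type*} [Fintype ι] {p : MvPolynomial (Fin n) ℂ}
    {q : ι → MvPolynomial (Fin n) ℂ} {c : ι → ℝ} (hc : ∀ i, 0 ≤ c i)
    (h : ∀ ξ, ‖symb p ξ‖ ≤ ∑ i, c i * ‖symb (q i) ξ‖) (hu : HasCompactSupport u.1) :
    l2 Set.univ (opHom n p u).1 ≤ ∑ i, c i * l2 Set.univ (opHom n (q i) u).1 := by
  have hu' := hasCompactSupport_opHom hu
  rw [← l2_univ_fourier (hu' p)]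
  simp only [fun i => (l2_univ_fourier (hu' (q i))).symm]
  refine l2_le_sum _ (fun i _ => hc i) (fun i _ => ?_) fun ξ => ?_
  · rw [Measure.restrict_univ]
    exact memLp_fourier (hu' (q i))
  · simp only [fourier_opHom _ hu, norm_mul, ← mul_assoc, ← Finset.sum_mul]
    gcongr
    exact h _

end Fourier

section LocalEstimate

open MvPolynomial

variable {n N : ℕ} {P : Fin N → MvPolynomial (Fin n) ℂ} {γ : ℝ}

/-- The scaled sum of the `L²` norms over `A` of the `q^{(α)}(D) v / α!`, in which each derivative
of the symbol costs a factor `t⁻¹`. -/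
def taylorNorm (q : MvPolynomial (Fin n) ℂ) (v : smoothFun n) (A : Set (EuclideanSpace ℝ (Fin n)))
    (t : ℝ) : ℝ :=
  ∑ α ∈ (taylorShift q).support, t⁻¹ ^ α.degree * l2 A (opHom n (hasse α q) v).1

theorem taylorNorm_nonneg (q : MvPolynomial (Fin n) ℂ) (v : smoothFun n)
    (A : Set (EuclideanSpace ℝ (Fin n))) {t : ℝ} (ht : 0 ≤ t) : 0 ≤ taylorNorm q v A t :=
  Finset.sum_nonneg fun _ _ => mul_nonneg (by positivity) (l2_nonneg _ _)

theorem taylorNorm_one (v : smoothFun n) (A : Set (EuclideanSpace ℝ (Fin n))) (t : ℝ) :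
    taylorNorm 1 v A t = l2 A v.1 := by
  rw [taylorNorm, map_one, ← C_1, support_C, if_neg one_ne_zero, Finset.sum_singleton, hasse_zero]
  simp

theorem taylorNorm_mono (q : MvPolynomial (Fin n) ℂ) (v : smoothFun n)
    {A B : Set (EuclideanSpace ℝ (Fin n))} (hB : IsCompact B) (h : A ⊆ B) {s t : ℝ} (hs : 0 < s)
    (hst : s ≤ t) : taylorNorm q v A t ≤ taylorNorm q v B s :=
  Finset.sum_le_sum fun _ _ =>
    mul_le_mul (pow_le_pow_left₀ (inv_nonneg.2 (hs.le.trans hst)) (inv_anti₀ hs hst) _)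
      (l2_mono _ hB h) (l2_nonneg _ _) (by positivity)

theorem rpow_mul_taylorNorm_le {q : MvPolynomial (Fin n) ℂ} (hq : (q.totalDegree : ℝ) ≤ γ)
    (v : smoothFun n) (A : Set (EuclideanSpace ℝ (Fin n))) {t : ℝ} (ht : 0 < t) (ht1 : t ≤ 1) :
    t ^ γ * taylorNorm q v A t ≤ taylorNorm q v A 1 := by
  rw [taylorNorm, taylorNorm, Finset.mul_sum]
  refine Finset.sum_le_sum fun α hα => ?_
  rw [← mul_assoc]
  refine mul_le_mul_of_nonneg_right ?_ (l2_nonneg _ _)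
  rw [inv_one, one_pow, inv_pow, ← div_eq_mul_inv, div_le_one (by positivity), ← Real.rpow_natCast]
  exact Real.rpow_le_rpow_of_exponent_ge ht ht1
    ((Nat.cast_le.2 (degree_le_of_mem_support_taylorShift hα)).trans hq)

theorem l2_opHom_mul_le {c : (Fin n →₀ ℕ) → ℝ} (hc : ∀ α, 0 ≤ c α) {χ : smoothFun n}
    {B : Set (EuclideanSpace ℝ (Fin n))} (hB : IsCompact B) (hχB : Function.support χ.1 ⊆ B)
    {t : ℝ} (ht : 0 < t) (hχ : ∀ α x, ‖(opHom n (monomial α 1) χ).1 x‖ ≤ c α * t⁻¹ ^ α.degree)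
    (q : MvPolynomial (Fin n) ℂ) (v : smoothFun n) :
    l2 Set.univ (opHom n q (χ * v)).1 ≤
      (∑ α ∈ (taylorShift q).support, c α) * taylorNorm q v B t := by
  have hsupp : Function.support (χ * v).1 ⊆ B := fun x hx => hχB (left_ne_zero_of_mul hx)
  have hsum : 0 ≤ ∑ α ∈ (taylorShift q).support, c α := Finset.sum_nonneg fun α _ => hc α
  rw [l2_univ_eq (support_opHom_subset hB.isClosed hsupp q), taylorNorm, Finset.mul_sum]
  simp only [← mul_assoc]
  refine l2_le_sum _ (fun α _ => by positivity) (fun α _ => memLp_restrict _ hB) fun x => ?_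
  rw [opHom_leibniz, AddSubmonoidClass.coe_finsetSum, Finset.sum_apply]
  refine (norm_sum_le _ _).trans (Finset.sum_le_sum fun α hα => ?_)
  change ‖(opHom n (monomial α 1) χ).1 x * (opHom n (hasse α q) v).1 x‖ ≤ _
  rw [norm_mul]
  gcongr
  refine (hχ α x).trans ?_
  gcongr
  exact Finset.single_le_sum (fun β _ => hc β) hα

theorem exists_l2_opHom_le_sum_taylorNorm {ι : Type*} [Fintype ι]
    (q : ι → MvPolynomial (Fin n) ℂ) :
    ∃ C, 0 ≤ C ∧ ∀ (A : Set (EuclideanSpace ℝ (Fin n))) (t : ℝ) (v : smoothFun n)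
      (p : MvPolynomial (Fin n) ℂ) (c : ι → ℝ), IsCompact A → 0 < t → (∀ i, 0 ≤ c i) →
      (∀ ξ, ‖symb p ξ‖ ≤ ∑ i, c i * ‖symb (q i) ξ‖) →
      l2 A (opHom n p v).1 ≤ C * ∑ i, c i * taylorNorm (q i) v (cthickening t A) t := by
  obtain ⟨b, hb, hcutoff⟩ := exists_cutoff n
  have hb' (i) : 0 ≤ ∑ α ∈ (taylorShift (q i)).support, b α := Finset.sum_nonneg fun α _ => hb α
  refine ⟨∑ i, ∑ α ∈ (taylorShift (q i)).support, b α, Finset.sum_nonneg fun i _ => hb' i,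
    fun A t v p c hA ht hc hp => ?_⟩
  obtain ⟨χ, hone, hsupp, hχ⟩ := hcutoff A t ht
  have hB : IsCompact (cthickening t A) := hA.cthickening
  have hχB := hsupp.trans (thickening_subset_cthickening t A)
  have hχv : Function.support (χ * v).1 ⊆ cthickening t A :=
    fun x hx => hχB (left_ne_zero_of_mul hx)
  have hA_eq : Set.EqOn (opHom n p v).1 (opHom n p (χ * v)).1 A :=
    (opHom_eqOn isOpen_thickening (fun x hx => by
      change v.1 x = χ.1 x * v.1 x
      rw [hone hx, Pi.one_apply, one_mul]) p).mono (self_subset_thickening (by positivity) A)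
  calc l2 A (opHom n p v).1 = l2 A (opHom n p (χ * v)).1 := l2_congr hA.measurableSet hA_eq
    _ ≤ l2 Set.univ (opHom n p (χ * v)).1 := by
      rw [l2_univ_eq (support_opHom_subset hB.isClosed hχv p)]
      exact l2_mono _ hB (self_subset_cthickening A)
    _ ≤ ∑ i, c i * l2 Set.univ (opHom n (q i) (χ * v)).1 :=
      l2_opHom_le hc hp (HasCompactSupport.of_support_subset_isCompact hB hχv)
    _ ≤ _ := by
      rw [Finset.mul_sum]
      refine Finset.sum_le_sum fun i _ => ?_
      rw [mul_left_comm]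
      refine mul_le_mul_of_nonneg_left ?_ (hc i)
      refine (l2_opHom_mul_le hb hB hχB ht hχ (q i) v).trans ?_
      exact mul_le_mul_of_nonneg_right
        (Finset.single_le_sum (fun i _ => hb' i) (Finset.mem_univ i))
        (taylorNorm_nonneg _ _ _ ht.le)

theorem exists_l2_opHom_le_taylorNorm_add (P : Fin N → MvPolynomial (Fin n) ℂ) :
    ∃ C, 0 ≤ C ∧ ∀ (A : Set (EuclideanSpace ℝ (Fin n))) (t : ℝ) (v : smoothFun n)
      (p : MvPolynomial (Fin n) ℂ) (a b : ℝ), IsCompact A → 0 < t → 0 ≤ a → 0 ≤ b →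
      (∀ ξ, ‖symb p ξ‖ ≤ a * ∑ j, ‖symb (P j) ξ‖ + b) →
      l2 A (opHom n p v).1 ≤
        C * (a * ∑ j, taylorNorm (P j) v (cthickening t A) t + b * l2 (cthickening t A) v.1) := by
  obtain ⟨C, hC, h⟩ := exists_l2_opHom_le_sum_taylorNorm fun o : Option (Fin N) => o.elim 1 P
  refine ⟨C, hC, fun A t v p a b hA ht ha hb hp => ?_⟩
  have h := h A t v p (fun o => o.elim b fun _ => a) hA ht (by rintro (_ | _) <;> assumption)
  simp only [Fintype.sum_option, Option.elim, taylorNorm_one, ← Finset.mul_sum, symb, map_one,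
    norm_one, mul_one] at h
  rw [add_comm (a * _)]
  exact h fun ξ => (hp ξ).trans_eq (add_comm _ _)

theorem exists_rpow_mul_rpow_le {θ₀ C ε : ℝ} (hθ₀ : 0 < θ₀) (hC : 0 ≤ C) (hε : 0 < ε) :
    ∃ B, 0 ≤ B ∧ ∀ θ, θ₀ ≤ θ → θ ≤ 1 → ∀ x f, 0 ≤ x → 0 ≤ f →
      C * (x ^ θ * f ^ (1 - θ)) ≤ B * x + ε * f := by
  have hbase : 1 ≤ 1 + C / ε := le_add_of_nonneg_right (by positivity)
  set R := (1 + C / ε) ^ θ₀⁻¹ with hR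
  have hR0 : 0 ≤ R := by positivity
  have hR1 : 1 ≤ R := Real.one_le_rpow hbase (by positivity)
  have hRθ₀ : C ≤ ε * R ^ θ₀ := by
    rw [hR, Real.rpow_inv_rpow (by positivity) hθ₀.ne', mul_add, mul_div_cancel₀ _ hε.ne']
    linarith
  refine ⟨ε * R, by positivity, fun θ hθ hθ1 x f hx hf => ?_⟩
  calc C * (x ^ θ * f ^ (1 - θ)) ≤ ε * R ^ θ * (x ^ θ * f ^ (1 - θ)) := by
        gcongr
        exact hRθ₀.trans (by gcongr)
    _ = ε * ((R * x) ^ θ * f ^ (1 - θ)) := by rw [Real.mul_rpow hR0 hx]; ring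
    _ ≤ ε * (θ * (R * x) + (1 - θ) * f) := by
        gcongr
        exact Real.geom_mean_le_arith_mean2_weighted (hθ₀.le.trans hθ) (sub_nonneg.2 hθ1)
          (by positivity) hf (by ring)
    _ ≤ ε * (1 * (R * x) + 1 * f) := by
        gcongr
        linarith
    _ = _ := by ring

theorem CondHWith.exists_scaled_hasse_le (h : CondHWith P γ) (hγ : 0 < γ) {ε : ℝ} (hε : 0 < ε) :
    ∃ B, 0 ≤ B ∧ ∀ α : Fin n →₀ ℕ, α ≠ 0 → (α.degree : ℝ) ≤ γ → ∀ j t, 0 < t → t ≤ 1 → ∀ ξ,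
      t⁻¹ ^ α.degree * ‖symb (hasse α (P j)) ξ‖ ≤ ε * ∑ i, ‖symb (P i) ξ‖ + B * t ^ (-γ) := by
  obtain ⟨C, hC, hH⟩ := h.exists_norm_hasse_le
  obtain ⟨B, hB, hinterp⟩ := exists_rpow_mul_rpow_le (inv_pos.2 hγ) hC.le hε
  refine ⟨B + ε, by positivity, fun α hα hαγ j t ht ht1 ξ => ?_⟩
  have hdegree : (1 : ℝ) ≤ α.degree := Nat.one_le_cast.2
    (Nat.one_le_iff_ne_zero.2 (mt (Finsupp.degree_eq_zero_iff α).1 hα))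
  have hpow : t⁻¹ ^ α.degree = (t ^ (-γ)) ^ (α.degree / γ : ℝ) := by
    rw [← Real.rpow_mul ht.le, neg_mul, mul_div_cancel₀ _ hγ.ne', Real.rpow_neg ht.le,
      Real.rpow_natCast, inv_pow]
  have hone : 1 ≤ t ^ (-γ) :=
    Real.one_le_rpow_of_pos_of_le_one_of_nonpos ht ht1 (neg_nonpos.2 hγ.le)
  calc t⁻¹ ^ α.degree * ‖symb (hasse α (P j)) ξ‖
      ≤ t⁻¹ ^ α.degree * (C * symbSize P ξ ^ (1 - (α.degree : ℝ) / γ)) := by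
        gcongr
        exact hH α ξ j
    _ = C * ((t ^ (-γ)) ^ (α.degree / γ : ℝ) * symbSize P ξ ^ (1 - (α.degree : ℝ) / γ)) := by
        rw [hpow]
        ring
    _ ≤ B * t ^ (-γ) + ε * symbSize P ξ :=
        hinterp _ (by rw [inv_eq_one_div]; gcongr) ((div_le_one hγ).2 hαγ) _ _ (by positivity)
          (symbSize_pos P ξ).le
    _ = ε * ∑ i, ‖symb (P i) ξ‖ + (B * t ^ (-γ) + ε * 1) := by
        rw [symbSize]
        ring
    _ ≤ ε * ∑ i, ‖symb (P i) ξ‖ + (B * t ^ (-γ) + ε * t ^ (-γ)) := by gcongr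
    _ = _ := by ring

theorem CondHWith.exists_scaled_l2_hasse_le (h : CondHWith P γ) (hγ : 0 < γ) {ε : ℝ}
    (hε : 0 < ε) :
    ∃ K, 0 ≤ K ∧ ∀ (A : Set (EuclideanSpace ℝ (Fin n))) (t : ℝ) (v : smoothFun n),
      IsCompact A → 0 < t → t ≤ 1 → ∀ α : Fin n →₀ ℕ, α ≠ 0 → (α.degree : ℝ) ≤ γ → ∀ j,
      t⁻¹ ^ α.degree * l2 A (opHom n (hasse α (P j)) v).1 ≤
        ε * ∑ i, taylorNorm (P i) v (cthickening t A) t +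
          K * (t ^ (-γ) * l2 (cthickening t A) v.1) := by
  obtain ⟨C, hC, hl2⟩ := exists_l2_opHom_le_taylorNorm_add P
  obtain ⟨B, hB, hscaled⟩ := h.exists_scaled_hasse_le hγ (ε := ε / (C + 1)) (by positivity)
  refine ⟨C * B, by positivity, fun A t v hA ht ht1 α hα hαγ j => ?_⟩
  have htα : 0 < t ^ α.degree := by positivity
  have hsum : 0 ≤ ∑ i, taylorNorm (P i) v (cthickening t A) t :=
    Finset.sum_nonneg fun i _ => taylorNorm_nonneg _ _ _ ht.le
  have hsymb (ξ) : ‖symb (hasse α (P j)) ξ‖ ≤ t ^ α.degree * (ε / (C + 1)) *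
      ∑ i, ‖symb (P i) ξ‖ + t ^ α.degree * (B * t ^ (-γ)) := by
    have := hscaled α hα hαγ j t ht ht1 ξ
    rw [inv_pow, inv_mul_le_iff₀ htα] at this
    linarith
  have hle := hl2 A t v _ _ _ hA ht (by positivity) (by positivity) hsymb
  rw [inv_pow, inv_mul_le_iff₀ htα]
  calc _ ≤ _ := hle
    _ = t ^ α.degree * (ε * (C / (C + 1)) * ∑ i, taylorNorm (P i) v (cthickening t A) t +
          C * B * (t ^ (-γ) * l2 (cthickening t A) v.1)) := by ring
    _ ≤ t ^ α.degree * (ε * 1 * ∑ i, taylorNorm (P i) v (cthickening t A) t +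
          C * B * (t ^ (-γ) * l2 (cthickening t A) v.1)) := by
        gcongr
        exact (div_le_one (by positivity)).2 (le_add_of_nonneg_right zero_le_one)
    _ = _ := by rw [mul_one]

theorem taylorNorm_le_l2_add {q : MvPolynomial (Fin n) ℂ} {v : smoothFun n}
    {A : Set (EuclideanSpace ℝ (Fin n))} {t X : ℝ} (hX : 0 ≤ X)
    (h : ∀ α ∈ (taylorShift q).support, α ≠ 0 →
      t⁻¹ ^ α.degree * l2 A (opHom n (hasse α q) v).1 ≤ X) :
    taylorNorm q v A t ≤ l2 A (opHom n q v).1 + (taylorShift q).support.card * X := by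
  classical
  have hl2 := l2_nonneg A (opHom n q v).1
  calc taylorNorm q v A t
      ≤ ∑ α ∈ (taylorShift q).support, ((if 0 = α then l2 A (opHom n q v).1 else 0) + X) := by
        refine Finset.sum_le_sum fun α hα => ?_
        rcases eq_or_ne α 0 with rfl | hα0
        · simpa [hasse_zero] using hX
        · rw [if_neg hα0.symm, zero_add]
          exact h α hα hα0
    _ = (if 0 ∈ (taylorShift q).support then l2 A (opHom n q v).1 else 0) +
          (taylorShift q).support.card * X := by
        rw [Finset.sum_add_distrib, Finset.sum_ite_eq, Finset.sum_const, nsmul_eq_mul]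
    _ ≤ _ := by
        gcongr
        split_ifs
        exacts [le_rfl, hl2]

theorem CondHWith.exists_sum_taylorNorm_le (h : CondHWith P γ) (hγ : 0 < γ)
    (hPγ : ∀ j, ((P j).totalDegree : ℝ) ≤ γ) {ε : ℝ} (hε : 0 < ε) :
    ∃ K, 0 ≤ K ∧ ∀ (A : Set (EuclideanSpace ℝ (Fin n))) (t : ℝ) (v : smoothFun n),
      IsCompact A → 0 < t → t ≤ 1 →
      ∑ j, taylorNorm (P j) v A t ≤ ∑ j, l2 A (opHom n (P j) v).1 +
        ε * ∑ j, taylorNorm (P j) v (cthickening t A) t +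
          K * (t ^ (-γ) * l2 (cthickening t A) v.1) := by
  obtain ⟨k, hk⟩ : ∃ k : ℝ, k = ∑ j, ((taylorShift (P j)).support.card : ℝ) := ⟨_, rfl⟩
  have hk0 : 0 ≤ k := hk ▸ Finset.sum_nonneg fun _ _ => Nat.cast_nonneg _
  obtain ⟨K, hK, hterm⟩ := h.exists_scaled_l2_hasse_le hγ (ε := ε / (k + 1)) (by positivity)
  refine ⟨k * K, by positivity, fun A t v hA ht ht1 => ?_⟩
  set T := ∑ j, taylorNorm (P j) v (cthickening t A) t
  set U := t ^ (-γ) * l2 (cthickening t A) v.1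
  have hT : 0 ≤ T := Finset.sum_nonneg fun i _ => taylorNorm_nonneg _ _ _ ht.le
  have hU : 0 ≤ U := mul_nonneg (by positivity) (l2_nonneg _ _)
  calc ∑ j, taylorNorm (P j) v A t
      ≤ ∑ j, (l2 A (opHom n (P j) v).1 +
          (taylorShift (P j)).support.card * (ε / (k + 1) * T + K * U)) :=
        Finset.sum_le_sum fun j _ => taylorNorm_le_l2_add (by positivity) fun α hα hα0 =>
          hterm A t v hA ht ht1 α hα0
            ((Nat.cast_le.2 (degree_le_of_mem_support_taylorShift hα)).trans (hPγ j)) j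
    _ = ∑ j, l2 A (opHom n (P j) v).1 + (ε * (k / (k + 1)) * T + k * K * U) := by
        rw [Finset.sum_add_distrib, ← Finset.sum_mul, ← hk]
        ring
    _ ≤ ∑ j, l2 A (opHom n (P j) v).1 + (ε * 1 * T + k * K * U) := by
        gcongr
        exact (div_le_one (by positivity)).2 (le_add_of_nonneg_right zero_le_one)
    _ = _ := by rw [mul_one, add_assoc]

theorem le_two_mul_of_forall_le_half_add {g : ℝ → ℝ} {t B e : ℝ}
    (hB : ∀ r, 0 < r → r ≤ t → g r ≤ B)
    (hg : ∀ r, 0 < r → r ≤ t → g r ≤ g (r / 2) / 2 + e) {r : ℝ} (hr : 0 < r) (hrt : r ≤ t) :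
    g r ≤ 2 * e := by
  have hbdd : BddAbove (g '' Set.Ioc 0 t) := ⟨B, by rintro _ ⟨r, hr, rfl⟩; exact hB r hr.1 hr.2⟩
  have hle (r) (hr : 0 < r) (hrt : r ≤ t) : g r ≤ sSup (g '' Set.Ioc 0 t) :=
    le_csSup hbdd ⟨r, ⟨hr, hrt⟩, rfl⟩
  have hsup : sSup (g '' Set.Ioc 0 t) ≤ sSup (g '' Set.Ioc 0 t) / 2 + e := by
    refine csSup_le ⟨_, r, ⟨hr, hrt⟩, rfl⟩ ?_
    rintro _ ⟨r, ⟨hr, hrt⟩, rfl⟩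
    linarith [hg r hr hrt, hle (r / 2) (by positivity) (by linarith)]
  linarith [hle r hr hrt]

/- Halving `r` loses a factor `2 ^ γ` in `r ^ γ`, which the small constant `(2 · 2 ^ γ)⁻¹` in front
of the Taylor norm compensates. -/
theorem CondHWith.exists_rpow_mul_sum_taylorNorm_le_half_add (h : CondHWith P γ) (hγ : 0 < γ)
    (hPγ : ∀ j, ((P j).totalDegree : ℝ) ≤ γ) :
    ∃ K, 0 ≤ K ∧ ∀ (A : Set (EuclideanSpace ℝ (Fin n))) (t : ℝ) (v : smoothFun n),
      IsCompact A → t ≤ 1 → ∀ r, 0 < r → r ≤ t →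
      r ^ γ * ∑ j, taylorNorm (P j) v (cthickening (t - r) A) r ≤
        (r / 2) ^ γ * (∑ j, taylorNorm (P j) v (cthickening (t - r / 2) A) (r / 2)) / 2 +
          (t ^ γ * ∑ j, l2 (cthickening t A) (opHom n (P j) v).1 +
            K * l2 (cthickening t A) v.1) := by
  obtain ⟨K, hK, hstep⟩ := h.exists_sum_taylorNorm_le hγ hPγ (ε := (2 * 2 ^ γ)⁻¹) (by positivity)
  refine ⟨K * 2 ^ γ, by positivity, fun A t v hA ht1 r hr hrt => ?_⟩
  have hr2 : 0 < r / 2 := half_pos hr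
  have hcpt (s : ℝ) : IsCompact (cthickening s A) := hA.cthickening
  have hhalf : cthickening (r / 2) (cthickening (t - r) A) ⊆ cthickening (t - r / 2) A :=
    (cthickening_cthickening_subset hr2.le (sub_nonneg.2 hrt) A).trans
      (cthickening_mono (by linarith) A)
  have hsub {s : ℝ} (hs : 0 ≤ s) : cthickening (t - s) A ⊆ cthickening t A :=
    cthickening_mono (by linarith) A
  calc r ^ γ * ∑ j, taylorNorm (P j) v (cthickening (t - r) A) r
      ≤ r ^ γ * ∑ j, taylorNorm (P j) v (cthickening (t - r) A) (r / 2) := by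
        gcongr with j
        exact taylorNorm_mono _ _ (hcpt _) le_rfl hr2 (half_le_self hr.le)
    _ ≤ r ^ γ * (∑ j, l2 (cthickening t A) (opHom n (P j) v).1 +
          (2 * 2 ^ γ)⁻¹ * (∑ j, taylorNorm (P j) v (cthickening (t - r / 2) A) (r / 2)) +
            K * ((r / 2) ^ (-γ) * l2 (cthickening t A) v.1)) := by
        refine mul_le_mul_of_nonneg_left ?_ (Real.rpow_nonneg hr.le γ)
        refine (hstep _ (r / 2) v (hcpt _) hr2 (by linarith)).trans ?_
        gcongr with j _ j
        · exact l2_mono _ (hcpt t) (hsub hr.le)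
        · exact taylorNorm_mono _ _ (hcpt _) hhalf hr2 le_rfl
        · exact l2_mono _ (hcpt t) (hhalf.trans (hsub hr2.le))
    _ = (r / 2) ^ γ * (∑ j, taylorNorm (P j) v (cthickening (t - r / 2) A) (r / 2)) / 2 +
          (r ^ γ * ∑ j, l2 (cthickening t A) (opHom n (P j) v).1 +
            K * 2 ^ γ * l2 (cthickening t A) v.1) := by
        rw [Real.rpow_neg hr2.le, Real.div_rpow hr.le zero_le_two]
        field_simp
        ring
    _ ≤ _ := by
        have := fun j => l2_nonneg (cthickening t A) (opHom n (P j) v).1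
        gcongr
        exact Finset.sum_nonneg fun j _ => this j

theorem CondHWith.exists_sum_taylorNorm_half_le (h : CondHWith P γ) (hγ : 0 < γ)
    (hPγ : ∀ j, ((P j).totalDegree : ℝ) ≤ γ) :
    ∃ K, 0 ≤ K ∧ ∀ (A : Set (EuclideanSpace ℝ (Fin n))) (t : ℝ) (v : smoothFun n),
      IsCompact A → 0 < t → t ≤ 1 →
      ∑ j, taylorNorm (P j) v (cthickening (t / 2) A) (t / 2) ≤
        2 * 2 ^ γ * ∑ j, l2 (cthickening t A) (opHom n (P j) v).1 +
          K * (t ^ (-γ) * l2 (cthickening t A) v.1) := by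
  obtain ⟨K, hK, hhalf⟩ := h.exists_rpow_mul_sum_taylorNorm_le_half_add hγ hPγ
  refine ⟨2 * 2 ^ γ * K, by positivity, fun A t v hA ht ht1 => ?_⟩
  have hbound (r) (hr : 0 < r) (hrt : r ≤ t) :
      r ^ γ * ∑ j, taylorNorm (P j) v (cthickening (t - r) A) r ≤
        ∑ j, taylorNorm (P j) v (cthickening t A) 1 := by
    rw [Finset.mul_sum]
    gcongr with j
    exact (rpow_mul_taylorNorm_le (hPγ j) v _ hr (hrt.trans ht1)).trans
      (taylorNorm_mono _ _ hA.cthickening (cthickening_mono (by linarith) A) one_pos le_rfl)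
  have hle := le_two_mul_of_forall_le_half_add
    (g := fun r => r ^ γ * ∑ j, taylorNorm (P j) v (cthickening (t - r) A) r)
    hbound (hhalf A t v hA ht1) (half_pos ht) (half_le_self ht.le)
  simp only [sub_half, Real.div_rpow ht.le zero_le_two] at hle
  rw [div_mul_eq_mul_div, div_le_iff₀ (by positivity), mul_comm,
    ← le_div_iff₀ (by positivity)] at hle
  refine hle.trans_eq ?_
  rw [Real.rpow_neg ht.le]
  field_simp

theorem CondHWith.exists_l2_le (h : CondHWith P γ) (hγ : 0 < γ)
    (hPγ : ∀ j, ((P j).totalDegree : ℝ) ≤ γ) :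
    ∃ C, 0 < C ∧ ∀ (p : MvPolynomial (Fin n) ℂ) (a : ℝ), 0 ≤ a →
      (∀ ξ, ‖symb p ξ‖ ≤ a * symbSize P ξ) →
      ∀ (A : Set (EuclideanSpace ℝ (Fin n))) (t : ℝ) (v : smoothFun n),
      IsCompact A → 0 < t → t ≤ 1 →
      l2 A (opHom n p v).1 ≤ C * a * (∑ j, l2 (cthickening t A) (opHom n (P j) v).1 +
        t ^ (-γ) * l2 (cthickening t A) v.1) := by
  obtain ⟨C, hC, hl2⟩ := exists_l2_opHom_le_taylorNorm_add P
  obtain ⟨K, hK, hhalf⟩ := h.exists_sum_taylorNorm_half_le hγ hPγ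
  refine ⟨(C + 1) * (2 * 2 ^ γ + K + 1), by positivity, fun p a ha hp A t v hA ht ht1 => ?_⟩
  have hone : 1 ≤ t ^ (-γ) :=
    Real.one_le_rpow_of_pos_of_le_one_of_nonpos ht ht1 (neg_nonpos.2 hγ.le)
  set S := ∑ j, l2 (cthickening t A) (opHom n (P j) v).1
  set U := t ^ (-γ) * l2 (cthickening t A) v.1
  have hS : 0 ≤ S := Finset.sum_nonneg fun _ _ => l2_nonneg _ _
  have hU : 0 ≤ U := mul_nonneg (by positivity) (l2_nonneg _ _)
  have hlow : l2 (cthickening (t / 2) A) v.1 ≤ U :=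
    (l2_mono v hA.cthickening (cthickening_mono (half_le_self ht.le) A)).trans
      (le_mul_of_one_le_left (l2_nonneg _ _) hone)
  calc l2 A (opHom n p v).1
      ≤ C * (a * ∑ j, taylorNorm (P j) v (cthickening (t / 2) A) (t / 2) +
          a * l2 (cthickening (t / 2) A) v.1) :=
        hl2 A (t / 2) v p a a hA (half_pos ht) ha ha fun ξ =>
          (hp ξ).trans_eq (by rw [symbSize]; ring)
    _ ≤ C * (a * (2 * 2 ^ γ * S + K * U) + a * U) := by
        gcongr
        exact hhalf A t v hA ht ht1
    _ = C * a * (2 * 2 ^ γ * S + (K + 1) * U) := by ring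
    _ ≤ (C + 1) * a * ((2 * 2 ^ γ + K + 1) * S + (2 * 2 ^ γ + K + 1) * U) := by
        gcongr
        · linarith
        · linarith
        · linarith [Real.rpow_pos_of_pos two_pos γ]
    _ = _ := by ring

end LocalEstimate

section Iterates

open MvPolynomial

variable {n N : ℕ} {P : Fin N → MvPolynomial (Fin n) ℂ} {γ : ℝ}

theorem CondHWith.exists_l2_le_mul_of_forall_le (h : CondHWith P γ) (hγ : 0 < γ)
    (hPγ : ∀ j, ((P j).totalDegree : ℝ) ≤ γ) {a δ : ℝ} (ha : 0 ≤ a) (hδ : 0 < δ) (hδ1 : δ ≤ 1) :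
    ∃ C, 0 < C ∧ ∀ (q : MvPolynomial (Fin n) ℂ), (∀ ξ, ‖symb q ξ‖ ≤ a * symbSize P ξ) →
      ∀ (A : Set (EuclideanSpace ℝ (Fin n))) (w : smoothFun n) (k Y : ℝ),
      IsCompact A → 1 ≤ k →
      (∀ j, l2 (cthickening (δ / k) A) (opHom n (P j) w).1 ≤ Y) →
      k ^ γ * l2 (cthickening (δ / k) A) w.1 ≤ Y →
      l2 A (opHom n q w).1 ≤ C * Y := by
  obtain ⟨C, hC, hl2⟩ := h.exists_l2_le hγ hPγ
  refine ⟨C * a * (N + δ ^ (-γ)) + 1, by positivity, fun q hq A w k Y hA hk hP hw => ?_⟩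
  have hk0 : 0 < k := one_pos.trans_le hk
  have hY : 0 ≤ Y := (mul_nonneg (by positivity) (l2_nonneg _ _)).trans hw
  calc l2 A (opHom n q w).1
      ≤ C * a * (∑ j, l2 (cthickening (δ / k) A) (opHom n (P j) w).1 +
          (δ / k) ^ (-γ) * l2 (cthickening (δ / k) A) w.1) :=
        hl2 q a ha hq A (δ / k) w hA (by positivity) ((div_le_self hδ.le hk).trans hδ1)
    _ = C * a * (∑ j, l2 (cthickening (δ / k) A) (opHom n (P j) w).1 +
          δ ^ (-γ) * (k ^ γ * l2 (cthickening (δ / k) A) w.1)) := by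
        rw [Real.div_rpow hδ.le hk0.le, Real.rpow_neg hk0.le, div_inv_eq_mul,
          mul_assoc (δ ^ (-γ))]
    _ ≤ C * a * (∑ _j : Fin N, Y + δ ^ (-γ) * Y) := by
        gcongr with j
        exact hP j
    _ = C * a * (N + δ ^ (-γ)) * Y := by
        rw [Finset.sum_const, Finset.card_univ, Fintype.card_fin, nsmul_eq_mul]
        ring
    _ ≤ _ := by
        gcongr
        exact le_add_of_nonneg_right zero_le_one

theorem prod_pow_add_single {ι R : Type*} [Fintype ι] [DecidableEq ι] [CommMonoid R] (p : ι → R)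
    (α : ι → ℕ) (i : ι) :
    ∏ l, p l ^ (α + Pi.single i 1 : ι → ℕ) l = p i * ∏ l, p l ^ α l := by
  simp only [Pi.add_apply, pow_add, Finset.prod_mul_distrib, Pi.single_apply]
  simp only [eq_comm (b := i), Finset.prod_pow_boole, Finset.mem_univ, if_true, mul_comm]

/- Each factor of `r` is traded for one factor `P j`, on a neighbourhood thinner by `δ / k`; the
exponents `α` have to stay arbitrary for the induction. -/
theorem l2_opHom_multiset_prod_mul_le {D : MvPolynomial (Fin n) ℂ → Prop} {C δ X : ℝ}
    {k : ℕ} {v : smoothFun n} {K : Set (EuclideanSpace ℝ (Fin n))} (hδ : 0 < δ)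
    (hK : IsCompact K)
    (hstep : ∀ q, D q → ∀ (A : Set (EuclideanSpace ℝ (Fin n))) (w : smoothFun n) (k Y : ℝ),
      IsCompact A → 1 ≤ k → (∀ j, l2 (cthickening (δ / k) A) (opHom n (P j) w).1 ≤ Y) →
      k ^ γ * l2 (cthickening (δ / k) A) w.1 ≤ Y → l2 A (opHom n q w).1 ≤ C * Y)
    (hX : ∀ α : Fin N → ℕ, ∑ i, α i ≤ k →
      l2 (cthickening δ K) (opHom n (∏ i, P i ^ α i) v).1 ≤
        X * (k : ℝ) ^ (γ * ((∑ i, α i : ℕ) - k)))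
    {r : Multiset (MvPolynomial (Fin n) ℂ)} (hr : ∀ q ∈ r, D q) (α : Fin N → ℕ)
    (hα : r.card + ∑ i, α i ≤ k) :
    l2 (cthickening (δ - r.card * (δ / k)) K) (opHom n (r.prod * ∏ i, P i ^ α i) v).1 ≤
      C ^ r.card * X * (k : ℝ) ^ (γ * (r.card + (∑ i, α i : ℕ) - k)) := by
  induction r using Multiset.induction generalizing α with
  | empty => simpa using hX α (by simpa using hα)
  | cons q r ih =>
    rw [Multiset.forall_mem_cons] at hr
    rw [Multiset.card_cons] at hα ⊢
    have hk : (0 : ℝ) < k := Nat.cast_pos.2 (by omega)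
    have hrk : ((r.card + 1 : ℕ) : ℝ) * (δ / k) ≤ δ := by
      rw [mul_div_assoc', div_le_iff₀ hk, mul_comm]
      exact mul_le_mul_of_nonneg_left (Nat.cast_le.2 (by omega)) hδ.le
    have hsub : cthickening (δ / k) (cthickening (δ - (r.card + 1 : ℕ) * (δ / k)) K) ⊆
        cthickening (δ - r.card * (δ / k)) K :=
      (cthickening_cthickening_subset (by positivity) (by linarith) K).trans
        (cthickening_mono (by push_cast; linarith) K)
    have hmono (u : smoothFun n) := l2_mono u hK.cthickening hsub
    rw [Multiset.prod_cons, mul_assoc, opHom_mul, pow_succ', mul_assoc, mul_assoc]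
    refine hstep q hr.1 _ _ k _ hK.cthickening (Nat.one_le_cast.2 (by omega))
      (fun j => (hmono _).trans ?_) ?_
    · have hj := ih hr.2 (α + Pi.single j 1) (by simp [Finset.sum_add_distrib]; omega)
      rw [prod_pow_add_single, mul_left_comm, opHom_mul] at hj
      refine hj.trans_eq ?_
      simp only [Pi.add_apply, Finset.sum_add_distrib, Finset.sum_pi_single', Finset.mem_univ,
        if_true]
      push_cast
      ring_nf
    · calc (k : ℝ) ^ γ * l2 _ (opHom n (r.prod * ∏ i, P i ^ α i) v).1
          ≤ (k : ℝ) ^ γ *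
              (C ^ r.card * X * (k : ℝ) ^ (γ * (r.card + (∑ i, α i : ℕ) - k))) := by
            gcongr
            exact (hmono _).trans (ih hr.2 α (by omega))
        _ = C ^ r.card * X * (k : ℝ) ^ (γ + γ * (r.card + (∑ i, α i : ℕ) - k)) := by
            rw [Real.rpow_add hk]
            ring
        _ = _ := by
            push_cast
            ring_nf

theorem CondHWith.exists_l2_iterate_le {M : ℕ} {Q : Fin M → MvPolynomial (Fin n) ℂ}
    (h : CondHWith P γ) (hγ : 0 < γ) (hPγ : ∀ j, ((P j).totalDegree : ℝ) ≤ γ)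
    (hQP : HWeaker 1 Q P) {δ : ℝ} (hδ : 0 < δ) (hδ1 : δ ≤ 1) :
    ∃ C, 0 < C ∧ ∀ (K : Set (EuclideanSpace ℝ (Fin n))) (v : smoothFun n) (X : ℝ) (k : ℕ),
      IsCompact K →
      (∀ α : Fin N → ℕ, ∑ i, α i ≤ k → l2 (cthickening δ K) (opHom n (∏ i, P i ^ α i) v).1 ≤
        X * (k : ℝ) ^ (γ * ((∑ i, α i : ℕ) - k))) →
      ∀ β : Fin M → ℕ, ∑ i, β i = k → l2 K (opHom n (∏ i, Q i ^ β i) v).1 ≤ C ^ k * X := by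
  obtain ⟨a, ha, hQ⟩ := hQP.exists_symbSize_le
  obtain ⟨C, hC, hstep⟩ := h.exists_l2_le_mul_of_forall_le hγ hPγ ha.le hδ hδ1
  refine ⟨C, hC, fun K v X k hK hX β hβ => ?_⟩
  set r : Multiset (MvPolynomial (Fin n) ℂ) := ∑ i, β i • {Q i}
  have hr : ∀ q ∈ r, ∀ ξ, ‖symb q ξ‖ ≤ a * symbSize P ξ := by
    intro q hq ξ
    obtain ⟨i, -, hi⟩ := Multiset.mem_sum.1 hq
    rw [Multiset.mem_singleton.1 (Multiset.mem_of_mem_nsmul hi)]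
    exact (norm_symb_le_symbSize Q i ξ).trans (hQ ξ)
  have hcard : r.card = k := by simp [r, hβ]
  have hprod : r.prod = ∏ i, Q i ^ β i := by simp [r, Multiset.prod_sum, Multiset.prod_nsmul]
  have hl2 := l2_opHom_multiset_prod_mul_le hδ hK hstep hX hr 0 (by simp [hcard])
  simp only [hcard, hprod, Pi.zero_apply, pow_zero, Finset.prod_const_one, mul_one,
    Finset.sum_const_zero, Nat.cast_zero, add_zero, sub_self, mul_zero, Real.rpow_zero] at hl2
  exact (l2_mono _ hK.cthickening (self_subset_cthickening K)).trans hl2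

end Iterates

section Seminorms

open MvPolynomial

variable {n N M m : ℕ} {P : Fin N → MvPolynomial (Fin n) ℂ} {Q : Fin M → MvPolynomial (Fin n) ℂ}
  {σ : ℝ → ℝ} {γ μ : ℝ} {Ω K : Set (EuclideanSpace ℝ (Fin n))}

theorem seminormP_lt_top_of_le {u : EuclideanSpace ℝ (Fin n) → ℂ} {B : ℝ} (hμ : 0 < μ)
    (hu : ∀ β, eLpNorm (sysIter P β u) 2 (volume.restrict K) ≠ ⊤)
    (h : ∀ β : Fin N → ℕ, l2 K (sysIter P β u) ≤
      B * Real.exp (youngConj (fun t => μ * σ t) ((∑ j, β j : ℕ) * m))) :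
    seminormP P m σ K μ u < ⊤ := by
  refine (iSup_le fun β => ?_).trans_lt (ENNReal.ofReal_lt_top (r := B))
  rw [← ENNReal.ofReal_toReal (hu β), ← ENNReal.ofReal_mul ENNReal.toReal_nonneg]
  refine ENNReal.ofReal_le_ofReal ?_
  rw [mul_youngConj_div hμ, Real.exp_neg, ← div_eq_mul_inv, div_le_iff₀ (Real.exp_pos _)]
  exact h β

theorem l2_le_of_seminormP_lt_top {u : EuclideanSpace ℝ (Fin n) → ℂ} (hμ : 0 < μ)
    (h : seminormP P m σ K μ u < ⊤) (β : Fin N → ℕ) :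
    l2 K (sysIter P β u) ≤ (seminormP P m σ K μ u).toReal *
      Real.exp (youngConj (fun t => μ * σ t) ((∑ j, β j : ℕ) * m)) := by
  have hle := ENNReal.toReal_mono h.ne (le_iSup (fun β : Fin N → ℕ =>
    eLpNorm (sysIter P β u) 2 (volume.restrict K) *
      ENNReal.ofReal (Real.exp (-(μ * youngConj σ (((∑ j, β j : ℕ) : ℝ) * m / μ))))) β)
  rwa [ENNReal.toReal_mul, ENNReal.toReal_ofReal (Real.exp_pos _).le, mul_youngConj_div hμ,
    Real.exp_neg, ← div_eq_mul_inv, div_le_iff₀ (Real.exp_pos _)] at hle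

theorem CondHWith.exists_l2_iterate_le_exp (h : CondHWith P γ) (hγ : 0 < γ)
    (hPγ : ∀ j, ((P j).totalDegree : ℝ) ≤ γ) (hQP : HWeaker 1 Q P) (hm : 0 < m)
    (hσ : IsWeight σ) (hσm : σ =o[atTop] fun t => t ^ ((m : ℝ) / γ))
    {δ : ℝ} (hδ : 0 < δ) (hδ1 : δ ≤ 1) :
    ∃ L : ℕ, 0 < L ∧ ∀ μ > 0, ∃ B, ∀ (K : Set (EuclideanSpace ℝ (Fin n))) (v : smoothFun n)
      (S : ℝ), IsCompact K → 0 ≤ S →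
      (∀ α : Fin N → ℕ, l2 (cthickening δ K) (opHom n (∏ i, P i ^ α i) v).1 ≤
        S * Real.exp (youngConj (fun t => μ * σ t) ((∑ i, α i : ℕ) * m))) →
      ∀ β : Fin M → ℕ, l2 K (opHom n (∏ i, Q i ^ β i) v).1 ≤
        S * B * Real.exp (youngConj (fun t => μ / L * σ t) ((∑ i, β i : ℕ) * m)) := by
  obtain ⟨C, hC, hiter⟩ := h.exists_l2_iterate_le hγ hPγ hQP hδ hδ1
  obtain ⟨L, hL, habsorb⟩ :=
    hσ.exists_pow_mul_rpow_mul_exp_le (Nat.cast_pos.2 hm) hγ hσm hC.le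
  refine ⟨L, hL, fun μ hμ => ?_⟩
  obtain ⟨B, hB⟩ := habsorb μ hμ
  refine ⟨B, fun K v S hK hS hP β => ?_⟩
  obtain ⟨k, hk⟩ : ∃ k, ∑ i, β i = k := ⟨_, rfl⟩
  set E := Real.exp (youngConj (fun t => μ / L * σ t) (k * m))
  rw [hk]
  refine (hiter K v (S * B * E / C ^ k) k hK (fun α hα => ?_) β hk).trans_eq
    (mul_div_cancel₀ _ (by positivity))
  have hexp := hB k (∑ i, α i : ℕ) (Nat.cast_nonneg _) (Nat.cast_le.2 hα)
  rw [Real.rpow_natCast] at hexp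
  have hpow : 0 < (k : ℝ) ^ (γ * (k - (∑ i, α i : ℕ))) := by
    rcases k.eq_zero_or_pos with rfl | hk
    · simp [Nat.le_zero.1 hα]
    · positivity
  rw [← neg_sub (k : ℝ), mul_neg, Real.rpow_neg k.cast_nonneg, ← div_eq_mul_inv, div_div,
    le_div_iff₀ (by positivity)]
  calc l2 (cthickening δ K) (opHom n (∏ i, P i ^ α i) v).1 *
        (C ^ k * (k : ℝ) ^ (γ * (k - (∑ i, α i : ℕ))))
      ≤ S * Real.exp (youngConj (fun t => μ * σ t) ((∑ i, α i : ℕ) * m)) *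
          (C ^ k * (k : ℝ) ^ (γ * (k - (∑ i, α i : ℕ)))) := by
        gcongr
        exact hP α
    _ = S * (C ^ k * (k : ℝ) ^ (γ * (k - (∑ i, α i : ℕ))) *
          Real.exp (youngConj (fun t => μ * σ t) ((∑ i, α i : ℕ) * m))) := by ring
    _ ≤ S * (B * E) := mul_le_mul_of_nonneg_left hexp hS
    _ = S * B * E := (mul_assoc _ _ _).symm

theorem CondHWith.exists_seminormP_lt_top (h : CondHWith P γ) (hγ : 0 < γ)
    (hPγ : ∀ j, ((P j).totalDegree : ℝ) ≤ γ) (hQP : HWeaker 1 Q P) (hm : 0 < m)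
    (hσ : IsWeight σ) (hσm : σ =o[atTop] fun t => t ^ ((m : ℝ) / γ))
    (hΩ : IsOpen Ω) (hK : IsCompact K) (hKΩ : K ⊆ Ω) :
    ∃ K' : Set (EuclideanSpace ℝ (Fin n)), IsCompact K' ∧ K' ⊆ Ω ∧ ∃ L : ℕ, 0 < L ∧
      ∀ u, ContDiffOn ℝ ((⊤ : ℕ∞) : WithTop ℕ∞) u Ω → ∀ μ, 0 < μ →
        seminormP P m σ K' μ u < ⊤ → seminormP Q m σ K (μ / L) u < ⊤ := by
  obtain ⟨δ₀, hδ₀, hδΩ⟩ := hK.exists_cthickening_subset_open hΩ hKΩ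
  have hδ : 0 < min δ₀ 1 := lt_min hδ₀ one_pos
  obtain ⟨L, hL, hQ⟩ :=
    h.exists_l2_iterate_le_exp hγ hPγ hQP hm hσ hσm hδ (min_le_right _ _)
  set K' := cthickening (min δ₀ 1) K
  have hK' : IsCompact K' := hK.cthickening
  have hKK' : K ⊆ K' := self_subset_cthickening K
  have hK'Ω : K' ⊆ Ω := (cthickening_mono (min_le_left _ _) K).trans hδΩ
  refine ⟨K', hK', hK'Ω, L, hL, fun u hu μ hμ hsem => ?_⟩
  obtain ⟨B, hB⟩ := hQ μ hμ
  obtain ⟨U, v, hU, hK'U, huv⟩ := exists_smoothFun_eqOn hΩ hK' hK'Ω hu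
  have heq {r : ℕ} (R : Fin r → MvPolynomial (Fin n) ℂ) (β : Fin r → ℕ) :
      Set.EqOn (sysIter R β u) (opHom n (∏ j, R j ^ β j) v).1 K' := by
    rw [← sysIter_eq_opHom]
    exact (sysIter_eqOn hU huv R β).mono hK'U
  refine seminormP_lt_top_of_le (B := (seminormP P m σ K' μ u).toReal * B) (by positivity)
    (fun β => ?_) fun β => ?_
  · rw [eLpNorm_congr_ae (ae_restrict_of_forall_mem hK.measurableSet ((heq Q β).mono hKK'))]
    exact (memLp_restrict _ hK).2.ne
  · rw [l2_congr hK.measurableSet ((heq Q β).mono hKK')]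
    refine hB K v _ hK ENNReal.toReal_nonneg (fun α => ?_) β
    rw [← l2_congr hK'.measurableSet (heq P α)]
    exact l2_le_of_seminormP_lt_top hμ hsem α

theorem CondHWith.beurling_subset (h : CondHWith P γ) (hγ : 0 < γ)
    (hPγ : ∀ j, ((P j).totalDegree : ℝ) ≤ γ) (hQP : HWeaker 1 Q P) (hm : 0 < m)
    (hσ : IsWeight σ) (hσm : σ =o[atTop] fun t => t ^ ((m : ℝ) / γ)) (hΩ : IsOpen Ω) :
    beurling P m σ Ω ⊆ beurling Q m σ Ω := by
  rintro u ⟨hu, huP⟩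
  refine ⟨hu, fun K hK hKΩ μ hμ => ?_⟩
  obtain ⟨K', hK', hK'Ω, L, hL, hQ⟩ :=
    h.exists_seminormP_lt_top hγ hPγ hQP hm hσ hσm hΩ hK hKΩ
  have hL0 : (0 : ℝ) < L := Nat.cast_pos.2 hL
  have hμL : 0 < μ * L := mul_pos hμ hL0
  simpa only [mul_div_cancel_right₀ _ hL0.ne'] using hQ u hu _ hμL (huP K' hK' hK'Ω _ hμL)

theorem CondHWith.roumieu_subset (h : CondHWith P γ) (hγ : 0 < γ)
    (hPγ : ∀ j, ((P j).totalDegree : ℝ) ≤ γ) (hQP : HWeaker 1 Q P) (hm : 0 < m)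
    (hσ : IsWeight σ) (hσm : σ =o[atTop] fun t => t ^ ((m : ℝ) / γ)) (hΩ : IsOpen Ω) :
    roumieu P m σ Ω ⊆ roumieu Q m σ Ω := by
  rintro u ⟨hu, huP⟩
  refine ⟨hu, fun K hK hKΩ => ?_⟩
  obtain ⟨K', hK', hK'Ω, L, hL, hQ⟩ :=
    h.exists_seminormP_lt_top hγ hPγ hQP hm hσ hσm hΩ hK hKΩ
  obtain ⟨l, hl, hlu⟩ := huP K' hK' hK'Ω
  refine ⟨l * L, Nat.mul_pos hl hL, ?_⟩
  simpa only [div_div, Nat.cast_mul] using hQ u hu (1 / l) (by positivity) hlu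

theorem CondH.one_div_pos_and_le_div_gammaOf (hm : 0 < m) (hP : CondH P m) {s : ℝ}
    (hs : gammaOf P m / m ≤ s) : 0 < 1 / s ∧ 1 / s ≤ m / gammaOf P m := by
  have hm0 : (0 : ℝ) < m := Nat.cast_pos.2 hm
  have hγ : 0 < gammaOf P m / m := div_pos (hm0.trans_le (le_gammaOf hP)) hm0
  exact ⟨one_div_pos.2 (hγ.trans_le hs),
    (one_div_le_one_div_of_le hγ hs).trans_eq (one_div_div _ _)⟩

end Seminorms

end IterateSystems

end

open IterateSystems Asymptotics Filter in
theorem corollary0_general {n N M m : ℕ} (hm : 0 < m)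
    {P : Fin N → MvPolynomial (Fin n) ℂ} {Q : Fin M → MvPolynomial (Fin n) ℂ}
    (hPm : ∀ j, (P j).totalDegree ≤ m) (hQm : ∀ j, (Q j).totalDegree ≤ m)
    (hP : CondH P m) (hPQ : EquallyStrong 1 P Q)
    {Ω : Set (EuclideanSpace ℝ (Fin n))} (hΩ : IsOpen Ω) {σ : ℝ → ℝ} (hσ : IsWeight σ)
    (hσm : σ =o[atTop] fun t => t ^ ((m : ℝ) / gammaOf P m)) :
    gammaOf P m = gammaOf Q m ∧ beurling P m σ Ω = beurling Q m σ Ω ∧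
      roumieu P m σ Ω = roumieu Q m σ Ω := by
  have hγ : gammaOf P m = gammaOf Q m := hPQ.gammaOf_eq m
  have hmγ : (m : ℝ) ≤ gammaOf P m := le_gammaOf hP
  have hγ0 : 0 < gammaOf P m := (Nat.cast_pos.2 hm).trans_le hmγ
  have hPγ : CondHWith P (gammaOf P m) := condHWith_gammaOf hm hPm hP
  have hQγ : CondHWith Q (gammaOf P m) := hPQ.condHWith_iff.1 hPγ
  have hPd (j) : ((P j).totalDegree : ℝ) ≤ gammaOf P m := (Nat.cast_le.2 (hPm j)).trans hmγ
  have hQd (j) : ((Q j).totalDegree : ℝ) ≤ gammaOf P m := (Nat.cast_le.2 (hQm j)).trans hmγ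
  exact ⟨hγ,
    (hPγ.beurling_subset hγ0 hPd hPQ.2 hm hσ hσm hΩ).antisymm
      (hQγ.beurling_subset hγ0 hQd hPQ.1 hm hσ hσm hΩ),
    (hPγ.roumieu_subset hγ0 hPd hPQ.2 hm hσ hσm hΩ).antisymm
      (hQγ.roumieu_subset hγ0 hQd hPQ.1 hm hσ hσm hΩ)⟩

theorem corollary0 {n N M : ℕ} (m : ℕ) (hm : 0 < m)
    (P : Fin N → MvPolynomial (Fin n) ℂ) (Q : Fin M → MvPolynomial (Fin n) ℂ)
    (hPm : IterateSystems.HasOrder P m) (hQm : IterateSystems.HasOrder Q m)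
    (hP : IterateSystems.CondH P m) (hQ : IterateSystems.CondH Q m)
    (hPQ : IterateSystems.EquallyStrong 1 P Q)
    (Ω : Set (EuclideanSpace ℝ (Fin n))) (hΩ : IsOpen Ω)
    (ω : ℝ → ℝ) (hω : IterateSystems.IsNQWeight ω)
    (s : ℝ) (hs : IterateSystems.gammaOf P m / (m : ℝ) ≤ s) :
    IterateSystems.gammaOf P m = IterateSystems.gammaOf Q m ∧
    IterateSystems.beurling P m (fun t => ω (t ^ (1 / s))) Ω
      = IterateSystems.beurling Q m (fun t => ω (t ^ (1 / s))) Ω ∧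
    IterateSystems.roumieu P m (fun t => ω (t ^ (1 / s))) Ω
      = IterateSystems.roumieu Q m (fun t => ω (t ^ (1 / s))) Ω := by
  obtain ⟨hs0, hsγ⟩ := hP.one_div_pos_and_le_div_gammaOf hm hs
  exact corollary0_general hm (fun j => (hPm j).le) (fun j => (hQm j).le) hP hPQ hΩ
    (hω.isWeight.comp_rpow hs0) (hω.isLittleO_comp_rpow hs0 hsγ)
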